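/- Let $k,d\ge 1$ be integers with $k>d/2$ and let $1\le q\le\infty$. Functions on the torus $\mathbb T^d=\mathbb R^d/\mathbb Z^d$ are identified with periodic functions, $H^k_0(\mathbb T^d)$ is the space of mean-zero Sobolev functions of order $k$ (identified with their continuous representatives), with inner product $\langle u,v\rangle_{H^k_0}=\int_{\mathbb T^d}D^ku\cdot D^kv\,dx$, where $D^k$ is the tensor of all $k$-th order weak derivatives, and with norm $\|u\|_{H^k_0}=\|D^ku\|_{L^2}$. For $n=m^d$, $m\in\mathbb N$, let $\Gamma_n=\{(\tau_1/m,\dots,\tau_d/m):\tau_i\in\{0,\dots,m-1\}\}$, and let $S_n g=(g(x))_{x\in\Gamma_n}$ be the sampling operator on $H^k_0(\mathbb T^d)$, with adjoint $S_n^*:\mathbb R^{\Gamma_n}\to H^k_0(\mathbb T^d)$ with respect to $\langle\cdot,\cdot\rangle_{H^k_0}$ (and the standard inner product on $\mathbb R^{\Gamma_n}$). A cube is a set $B=\prod_{i=1}^d[a_i,a_i+h)\subseteq[0,1]^d$ with $0<h\le1$, and $|B|=h^d$. Let $\mathcal B$ be a normal system of cubes: there is $c>1$ such that every cube $B$ contains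 some $\tilde B\in\mathcal B$ with $|\tilde B|\ge|B|/c$. For $y,w\in\mathbb R^{\Gamma_n}$ put $$\|y\|_{\mathcal B}=\sup_{B\in\mathcal B}\frac{1}{\sqrt{\#(\Gamma_n\cap B)}}\Bigl|\sum_{x\in\Gamma_n\cap B}y(x)\Bigr|,\qquad \|w\|_{\mathcal B^*}=\sup\Bigl\{\sum_{x\in\Gamma_n}w(x)v(x):\|v\|_{\mathcal B}\le1\Bigr\}\in[0,\infty]$$ (a cube with $\Gamma_n\cap B=\emptyset$ contributes $0$). For $f\in H^k_0(\mathbb T^d)$ let $$d_n(t)=\min_{\|w\|_{\mathcal B^*}\le t}\|S_n^*w-f\|_{H^k_0}\qquad(t\ge0).$$ Let $f\in H^k_0(\mathbb T^d)$ and let the data be $y_n(x)=f(x)+\xi_n(x)$, $x\in\Gamma_n$, where all $\xi_n(x)$ are defined on one probability space and, for each $n=m^d$, the variables $(\xi_n(x))_{x\in\Gamma_n}$ are i.i.d. and sub-Gaussian with parameter $\sigma>0$, i.e. $\mathbb E\,e^{\tau\xi_n(x)}\le e^{\tau^2\sigma^2/2}$ for all $\tau\in\mathbb R$; nothing is assumed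 on the joint law for different $n$. Let $\gamma_n=C_\gamma(\log n)^r$ with $r\ge1/2$ and $C_\gamma>0$, where $C_\gamma>\sigma\sqrt{5+2k/d}$ if $r=1/2$, and let $\hat f_{\gamma_n}$ be the MIND estimator, i.e. the minimizer of $\frac12\|D^kg\|_{L^2}^2$ over all $g\in H^k_0(\mathbb T^d)$ with $\|S_ng-y_n\|_{\mathcal B}\le\gamma_n$. Assume that, for some $0\le\mu<1/2$, $$\min_{t\ge0}\bigl(d_n(t)+(\log n)^{r/2}t^{1/2}\bigr)=O(n^{-\mu})\qquad\text{as } n=m^d\to\infty.$$ Put $$\vartheta=\begin{cases}\dfrac{k}{2k+d}&\text{if } q\le\dfrac{4k+2d}{d},\\[2mm]\dfrac{k-d/2+d/q}{2k}&\text{if } q>\dfrac{4k+2d}{d}\end{cases}\qquad(d/q=0\text{ for }q=\infty).$$ Then there is a (deterministic) constant $C<\infty$ such that, almost surely, $$\limsup_{n=m^d\to\infty}\; n^{\mu(1-2\vartheta)+\vartheta}(\log n)^{-2r\vartheta}\,\|\hat f_{\gamma_n}-f\|_{L^q(\mathbb T^d)}\le C.$$ -/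

import Mathlib

open MeasureTheory ProbabilityTheory Filter Asymptotics
open scoped NNReal ENNReal

namespace MIND

noncomputable section

/-! ### Functions on the torus

A function on the torus `ℝ^d / ℤ^d` is a `ℤ^d`-periodic function on `ℝ^d`; integrals over the
torus are integrals over the fundamental domain `[0,1)^d`. -/

/-- The half-open unit cube `[0,1)^d`. -/
def unitCube (d : ℕ) : Set (Fin d → ℝ) := Set.univ.pi fun _ => Set.Ico (0 : ℝ) 1

/-- The measure of the torus: Lebesgue measure on `[0,1)^d`. -/
def torusMeasure (d : ℕ) : Measure (Fin d → ℝ) := volume.restrict (unitCube d)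

/-- `f` is `ℤ^d`-periodic. -/
def IsPeriodic {d : ℕ} (f : (Fin d → ℝ) → ℝ) : Prop :=
  ∀ (x : Fin d → ℝ) (z : Fin d → ℤ), f (x + fun l => (z l : ℝ)) = f x

/-- The classical partial derivative `∂_{i 0} ⋯ ∂_{i (j-1)} φ`. -/
def partialDeriv {d j : ℕ} (i : Fin j → Fin d) (φ : (Fin d → ℝ) → ℝ) (x : Fin d → ℝ) : ℝ :=
  iteratedFDeriv ℝ j φ x fun l => Pi.single (i l) (1 : ℝ)

/-- `g ∈ L²` is the weak partial derivative `∂_{i 0} ⋯ ∂_{i (j-1)} f` of `f` on the torus, tested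
against all smooth functions on the torus. -/
def IsWeakDeriv {d j : ℕ} (i : Fin j → Fin d) (f g : (Fin d → ℝ) → ℝ) : Prop :=
  MemLp g 2 (torusMeasure d) ∧
    ∀ φ : (Fin d → ℝ) → ℝ, ContDiff ℝ (⊤ : ℕ∞) φ → IsPeriodic φ →
      ∫ x, f x * partialDeriv i φ x ∂(torusMeasure d)
        = (-1) ^ j * ∫ x, g x * φ x ∂(torusMeasure d)

open Classical in
/-- The weak partial derivative (unique almost everywhere), `0` if there is none in `L²`. -/
def weakDeriv {d j : ℕ} (i : Fin j → Fin d) (f : (Fin d → ℝ) → ℝ) : (Fin d → ℝ) → ℝ :=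
  if h : ∃ g, IsWeakDeriv i f g then h.choose else 0

/-- `f ∈ H^k_0`: mean zero, with all weak derivatives of order at most `k` in `L²`. This is used
for `k > d/2` only, when every class in `H^k_0` has exactly one continuous representative, and
`f` is this representative, so that it can be sampled at points. -/
structure MemHk0 {d : ℕ} (k : ℕ) (f : (Fin d → ℝ) → ℝ) : Prop where
  continuous : Continuous f
  periodic : IsPeriodic f
  mean_zero : ∫ x, f x ∂(torusMeasure d) = 0
  weak_deriv : ∀ j : ℕ, j ≤ k → ∀ i : Fin j → Fin d, ∃ g, IsWeakDeriv i f g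

/-- The inner product `⟨u, v⟩_{H^k_0} = ∫ D^k u · D^k v`, where `D^k` is the tensor of all
partial derivatives `∂_{i 1} ⋯ ∂_{i k}`. -/
def innerHk {d : ℕ} (k : ℕ) (u v : (Fin d → ℝ) → ℝ) : ℝ :=
  ∑ i : Fin k → Fin d, ∫ x, weakDeriv i u x * weakDeriv i v x ∂(torusMeasure d)

/-- The homogeneous Sobolev norm `‖D^k u‖_{L²}`. -/
def normHk {d : ℕ} (k : ℕ) (u : (Fin d → ℝ) → ℝ) : ℝ := Real.sqrt (innerHk k u u)

/-! ### The grid and the multiresolution norm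

`m` is the number of grid points per axis, so that the sample size is `n = m ^ d`. -/

/-- The grid point with index `τ ∈ {0, …, m-1}^d`, that is `(τ_1 / m, …, τ_d / m)`. -/
def gridPoint {d m : ℕ} (τ : Fin d → Fin m) : Fin d → ℝ := fun l => ((τ l : ℕ) : ℝ) / (m : ℝ)

/-- The sampling operator `S_n`. -/
def sample {d : ℕ} (m : ℕ) (f : (Fin d → ℝ) → ℝ) : (Fin d → Fin m) → ℝ := fun τ => f (gridPoint τ)

/-- A cube `∏ [a_l, a_l + h)` contained in `[0,1]^d`, with `0 < h ≤ 1`. -/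
structure Cube (d : ℕ) where
  corner : Fin d → ℝ
  side : ℝ
  side_pos : 0 < side
  side_le_one : side ≤ 1
  corner_nonneg : ∀ l, 0 ≤ corner l
  corner_add_side_le : ∀ l, corner l + side ≤ 1

/-- The point set of a cube. -/
def Cube.toSet {d : ℕ} (B : Cube d) : Set (Fin d → ℝ) :=
  Set.univ.pi fun l => Set.Ico (B.corner l) (B.corner l + B.side)

/-- The volume of a cube. -/
def Cube.vol {d : ℕ} (B : Cube d) : ℝ := B.side ^ d

/-- Normal systems of cubes. -/
def IsNormal {d : ℕ} (𝓑 : Set (Cube d)) : Prop :=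
  ∃ c : ℝ, 1 < c ∧ ∀ B : Cube d, ∃ B' ∈ 𝓑, B'.toSet ⊆ B.toSet ∧ B.vol / c ≤ B'.vol

open Classical in
/-- The indices of the grid points in `B`. -/
def gridIn {d : ℕ} (m : ℕ) (B : Cube d) : Finset (Fin d → Fin m) :=
  Finset.univ.filter fun τ => gridPoint τ ∈ B.toSet

/-- The multiresolution norm `sup_B n(B)^{-1/2} |∑_{x ∈ B} y x|`. A cube without grid points
contributes `0`; the supremum is over finitely many values. -/
def mrNorm {d m : ℕ} (𝓑 : Set (Cube d)) (y : (Fin d → Fin m) → ℝ) : ℝ :=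
  ⨆ B : 𝓑, |∑ τ ∈ gridIn m B.1, y τ| / Real.sqrt ((gridIn m B.1).card : ℝ)

/-- The dual multiresolution norm; it takes the value `⊤` exactly where the supremum is
infinite, which cannot happen when the multiresolution norm is definite. -/
def dualMrNorm {d m : ℕ} (𝓑 : Set (Cube d)) (w : (Fin d → Fin m) → ℝ) : EReal :=
  ⨆ v : {v : (Fin d → Fin m) → ℝ // mrNorm 𝓑 v ≤ 1}, ((∑ τ, w τ * v.1 τ : ℝ) : EReal)

/-- `g = S_n^* w`, where `S_n^*` is the adjoint of the sampling operator for the inner product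
of `H^k_0`. -/
def IsSampleAdjoint {d m : ℕ} (k : ℕ) (w : (Fin d → Fin m) → ℝ) (g : (Fin d → ℝ) → ℝ) : Prop :=
  MemHk0 k g ∧ ∀ u, MemHk0 k u → ∑ τ, sample m u τ * w τ = innerHk k u g

/-- The multiscale distance function
`d_n(t) = min {‖S_n^* w - f‖_{H^k_0} : ‖w‖_{𝓑^*} ≤ t}`. -/
def distFun {d : ℕ} (k m : ℕ) (𝓑 : Set (Cube d)) (f : (Fin d → ℝ) → ℝ) (t : ℝ) : ℝ :=
  sInf {ρ : ℝ | ∃ (w : (Fin d → Fin m) → ℝ) (g : (Fin d → ℝ) → ℝ),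
    dualMrNorm 𝓑 w ≤ (t : EReal) ∧ IsSampleAdjoint k w g ∧ ρ = normHk k (g - f)}

/-- `min_{t ≥ 0} (d_n(t) + (log n)^{r/2} t^{1/2})` for `n = m ^ d`. -/
def sourceDefect {d : ℕ} (k m : ℕ) (𝓑 : Set (Cube d)) (f : (Fin d → ℝ) → ℝ) (r : ℝ) : ℝ :=
  sInf ((fun t : ℝ => distFun k m 𝓑 f t + Real.log ((m : ℝ) ^ d) ^ (r / 2) * Real.sqrt t) ''
    Set.Ici 0)

/-- `g` is the MIND estimator for the data `y` and the threshold `γ`: it minimizes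
`½ ‖D^k g‖²` over `H^k_0` subject to `‖S_n g - y‖_𝓑 ≤ γ`. -/
def IsMIND {d m : ℕ} (k : ℕ) (𝓑 : Set (Cube d)) (y : (Fin d → Fin m) → ℝ) (γ : ℝ)
    (g : (Fin d → ℝ) → ℝ) : Prop :=
  MemHk0 k g ∧ mrNorm 𝓑 (sample m g - y) ≤ γ ∧
    ∀ h, MemHk0 k h → mrNorm 𝓑 (sample m h - y) ≤ γ →
      (1 / 2 : ℝ) * normHk k g ^ 2 ≤ (1 / 2 : ℝ) * normHk k h ^ 2

open Classical in
/-- The exponent `ϑ(k, d, q)`, with `1 / q = 0` for `q = ∞`. -/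
def vartheta (k d : ℕ) (q : ℝ≥0∞) : ℝ :=
  if q ≤ ENNReal.ofReal ((4 * k + 2 * d) / d) then (k : ℝ) / (2 * k + d)
  else ((k : ℝ) - d / 2 + d * (q⁻¹).toReal) / (2 * k)

end

end MIND

/-!
On the event that the noise `ξ` satisfies `‖ξ‖_𝓑 ≤ γ`, the function `f` competes with the estimator
`g`. Hence `‖S (g - f)‖_𝓑 ≤ 2 γ`, and minimality of `g` gives, for every `w`,
`‖g - f‖² ≤ -2 ⟨f, g - f⟩ = 2 ⟨S^* w - f, g - f⟩ - 2 ∑ w · S (g - f)`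
in `H^k_0`. The last sum is at most `2 γ ‖w‖_𝓑*` in absolute value, which bounds `‖g - f‖` by the
source defect.

What remains is an interpolation inequality between `‖S u‖_𝓑` and the energy `‖D^k u‖²`. On a cube
of side `h`, the Taylor polynomial of `u` is controlled by means of `u` over samples in small
subcubes, and these by `‖S u‖_𝓑` because `𝓑` is normal; this gives
`|u| ≲ ‖S u‖_𝓑 (n h ^ d)^(-1/2) + h ^ (k - d/2) E^(1/2)`,
where `E` is the energy of `u` in the cube.
A weak derivative enters only through the Taylor remainder, which passes to the limit from
trigonometric polynomials. Now search the dyadic cubes from the unit cube down and stop at those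
with so little energy that the first term dominates. Each stopped cube has a parent of large energy,
so for the critical exponent `p = (4 k + 2 d) / d` the integrals of `|u| ^ p` over the stopped cubes
sum to a multiple of the energy of the unit cube. Larger exponents follow from the bound on
`sup |u|`.

The noise obeys its bound eventually, almost surely, by the Borel–Cantelli lemma: a cube is seen by
the grid only through the box of indices in it, so for `n = m ^ d` there are at most
`(m + 1) ^ (2 d)` sums to control.
-/

open scoped BigOperators

namespace MIND

noncomputable section

/-! ### The torus as a quotient -/

-- The library develops multivariate Fourier series for the probability Haar measure on the
-- circle, which it installs as a local instance only.
local instance : MeasureSpace UnitAddCircle := ⟨AddCircle.haarAddCircle⟩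

local instance : Measure.IsAddHaarMeasure (volume : Measure UnitAddCircle) :=
  inferInstanceAs (Measure.IsAddHaarMeasure AddCircle.haarAddCircle)

section Torus

variable {d : ℕ}

instance : IsProbabilityMeasure (torusMeasure d) :=
  ⟨by simp [torusMeasure, unitCube, Real.volume_pi_Ico]⟩

/-- The projection from `ℝ^d` to the torus. -/
def toTorus (x : Fin d → ℝ) : UnitAddTorus (Fin d) := fun l => (x l : UnitAddCircle)

/-- The section of `toTorus` with values in the unit cube. -/
def ofTorus (t : UnitAddTorus (Fin d)) : Fin d → ℝ :=
  fun l => (AddCircle.equivIco 1 0 (t l) : ℝ)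

lemma toTorus_ofTorus (t : UnitAddTorus (Fin d)) : toTorus (ofTorus t) = t :=
  funext fun l => (AddCircle.equivIco (1 : ℝ) 0).symm_apply_apply (t l)

lemma ofTorus_toTorus {x : Fin d → ℝ} (hx : x ∈ unitCube d) : ofTorus (toTorus x) = x := by
  funext l
  have hxl : x l ∈ Set.Ico (0 : ℝ) (0 + 1) := by simpa using hx l (Set.mem_univ l)
  exact congrArg Subtype.val ((AddCircle.equivIco (1 : ℝ) 0).apply_symm_apply ⟨x l, hxl⟩)

lemma measurable_ofTorus : Measurable (ofTorus (d := d)) :=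
  measurable_pi_lambda _ fun l => measurable_subtype_coe.comp
    ((AddCircle.measurableEquivIco (1 : ℝ) 0).measurable.comp (measurable_pi_apply l))

lemma ae_mem_unitCube (d : ℕ) : ∀ᵐ x ∂torusMeasure d, x ∈ unitCube d :=
  ae_restrict_mem (MeasurableSet.univ_pi fun _ => measurableSet_Ico)

lemma torusMeasure_eq_pi (d : ℕ) :
    torusMeasure d =
      Measure.pi fun _ : Fin d => (volume : Measure ℝ).restrict (Set.Ioc 0 (0 + 1)) := by
  rw [torusMeasure, unitCube, volume_pi, Measure.restrict_pi_pi]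
  congr! 2
  rw [zero_add]
  exact Measure.restrict_congr_set Ico_ae_eq_Ioc

lemma measurePreserving_toTorus (d : ℕ) :
    MeasurePreserving (toTorus (d := d)) (torusMeasure d) volume := by
  have hcircle : MeasurePreserving (QuotientAddGroup.mk : ℝ → UnitAddCircle)
      ((volume : Measure ℝ).restrict (Set.Ioc 0 (0 + 1))) (volume : Measure UnitAddCircle) := by
    have hmk := AddCircle.measurePreserving_mk 1 0
    rwa [AddCircle.volume_eq_smul_haarAddCircle, ENNReal.ofReal_one, one_smul] at hmk
  rw [torusMeasure_eq_pi]
  exact measurePreserving_pi _ _ fun _ => hcircle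

lemma measurePreserving_ofTorus (d : ℕ) :
    MeasurePreserving (ofTorus (d := d)) volume (torusMeasure d) := by
  refine ⟨measurable_ofTorus, ?_⟩
  rw [← (measurePreserving_toTorus d).map_eq,
    Measure.map_map measurable_ofTorus (measurePreserving_toTorus d).measurable]
  conv_rhs => rw [← Measure.map_id (μ := torusMeasure d)]
  refine Measure.map_congr ?_
  filter_upwards [ae_mem_unitCube d] with x hx using ofTorus_toTorus hx

/-- The complex-valued function on the quotient torus with the values of `w` on the unit
cube. -/
def onTorus (w : (Fin d → ℝ) → ℝ) (t : UnitAddTorus (Fin d)) : ℂ := (w (ofTorus t) : ℝ)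

lemma memLp_onTorus {p : ℝ≥0∞} {w : (Fin d → ℝ) → ℝ} (hw : MemLp w p (torusMeasure d)) :
    MemLp (onTorus w) p :=
  (hw.comp_measurePreserving (measurePreserving_ofTorus d)).ofReal

lemma onTorus_toTorus (w : (Fin d → ℝ) → ℝ) {x : Fin d → ℝ} (hx : x ∈ unitCube d) :
    onTorus w (toTorus x) = w x := by
  rw [onTorus, ofTorus_toTorus hx]

end Torus

/-! ### Fourier coefficients -/

section Fourier

variable {d : ℕ}

/-- The phase `2π n · x` of the character with frequency `n`, as a linear functional of `x`. -/
def phase (n : Fin d → ℤ) : (Fin d → ℝ) →L[ℝ] ℝ :=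
  ∑ l, (2 * Real.pi * n l) • ContinuousLinearMap.proj l

lemma phase_apply (n : Fin d → ℤ) (x : Fin d → ℝ) :
    phase n x = ∑ l, 2 * Real.pi * n l * x l := by
  simp [phase]

lemma phase_neg (n : Fin d → ℤ) (x : Fin d → ℝ) : phase (-n) x = -phase n x := by
  simp [phase_apply]

lemma phase_single (n : Fin d → ℤ) (l : Fin d) :
    phase n (Pi.single l 1) = 2 * Real.pi * n l := by
  simp [phase_apply, Pi.single_apply]

lemma phase_add_int (n : Fin d → ℤ) (x : Fin d → ℝ) (z : Fin d → ℤ) :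
    phase n (x + fun l => (z l : ℝ)) = phase n x + ((∑ l, n l * z l : ℤ) : ℝ) * (2 * Real.pi) := by
  simp only [map_add, add_right_inj, phase_apply]
  push_cast
  rw [Finset.sum_mul]
  exact Finset.sum_congr rfl fun l _ => by ring

/-- The Fourier coefficient at frequency `n` of a function on the unit cube. -/
def fourierCoef (w : (Fin d → ℝ) → ℝ) (n : Fin d → ℤ) : ℂ :=
  ∫ x, (w x : ℂ) * Complex.exp (-(phase n x * Complex.I)) ∂torusMeasure d

lemma mFourier_toTorus (n : Fin d → ℤ) (x : Fin d → ℝ) :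
    UnitAddTorus.mFourier n (toTorus x) = Complex.exp (phase n x * Complex.I) := by
  simp only [UnitAddTorus.mFourier, ContinuousMap.coe_mk, toTorus, fourier_coe_apply, phase_apply,
    ← Complex.exp_sum]
  congr 1
  push_cast
  rw [Finset.sum_mul]
  exact Finset.sum_congr rfl fun l _ => by ring

lemma mFourierCoeff_onTorus {w : (Fin d → ℝ) → ℝ}
    (hw : AEStronglyMeasurable w (torusMeasure d)) (n : Fin d → ℤ) :
    UnitAddTorus.mFourierCoeff (onTorus w) n = fourierCoef w n := by
  have hmeas : AEStronglyMeasurable (onTorus w) :=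
    Complex.continuous_ofReal.comp_aestronglyMeasurable
      (hw.comp_measurePreserving (measurePreserving_ofTorus d))
  have hint : AEStronglyMeasurable (fun t => UnitAddTorus.mFourier (-n) t • onTorus w t)
      (Measure.map toTorus (torusMeasure d)) := by
    rw [(measurePreserving_toTorus d).map_eq]
    exact (UnitAddTorus.mFourier (-n)).continuous.aestronglyMeasurable.smul hmeas
  rw [UnitAddTorus.mFourierCoeff, ← (measurePreserving_toTorus d).map_eq,
    integral_map (measurePreserving_toTorus d).aemeasurable hint, fourierCoef]
  refine integral_congr_ae ?_
  filter_upwards [ae_mem_unitCube d] with x hx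
  rw [mFourier_toTorus, onTorus_toTorus w hx, smul_eq_mul, mul_comm, phase_neg,
    Complex.ofReal_neg, neg_mul]

lemma mFourierCoeff_toLp_onTorus {w : (Fin d → ℝ) → ℝ} (hw : MemLp w 2 (torusMeasure d))
    (n : Fin d → ℤ) :
    UnitAddTorus.mFourierCoeff (memLp_onTorus hw).toLp n = fourierCoef w n := by
  rw [← mFourierCoeff_onTorus hw.1]
  refine integral_congr_ae ?_
  filter_upwards [(memLp_onTorus hw).coeFn_toLp] with t ht
  rw [ht]

lemma hasSum_mFourierLp {w : (Fin d → ℝ) → ℝ} (hw : MemLp w 2 (torusMeasure d)) :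
    HasSum (fun n => fourierCoef w n • UnitAddTorus.mFourierLp 2 n) (memLp_onTorus hw).toLp := by
  simpa only [mFourierCoeff_toLp_onTorus hw]
    using UnitAddTorus.hasSum_mFourier_series_L2 (memLp_onTorus hw).toLp

theorem ae_eq_of_fourierCoef_eq {v w : (Fin d → ℝ) → ℝ}
    (hv : MemLp v 2 (torusMeasure d)) (hw : MemLp w 2 (torusMeasure d))
    (h : ∀ n, fourierCoef v n = fourierCoef w n) : v =ᵐ[torusMeasure d] w := by
  have hlp : (memLp_onTorus hv).toLp = (memLp_onTorus hw).toLp := by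
    refine (hasSum_mFourierLp hv).unique ?_
    simpa only [h] using hasSum_mFourierLp hw
  have hae : onTorus v =ᵐ[volume] onTorus w := (MemLp.toLp_eq_toLp_iff _ _).1 hlp
  filter_upwards [(measurePreserving_toTorus d).quasiMeasurePreserving.ae_eq_comp hae,
    ae_mem_unitCube d] with x hx hcube
  simpa [onTorus_toTorus _ hcube] using hx

lemma summable_sq_norm_fourierCoef {w : (Fin d → ℝ) → ℝ} (hw : MemLp w 2 (torusMeasure d)) :
    Summable fun n => ‖fourierCoef w n‖ ^ 2 := by
  simpa only [mFourierCoeff_toLp_onTorus hw]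
    using (UnitAddTorus.hasSum_sq_mFourierCoeff (memLp_onTorus hw).toLp).summable

/-! ### Trigonometric polynomials -/

/-- The real wave `Re (c e^{2π i n · x})`. -/
def wave (c : ℂ) (n : Fin d → ℤ) (x : Fin d → ℝ) : ℝ :=
  (c * Complex.exp (phase n x * Complex.I)).re

/-- The real part of the trigonometric polynomial with coefficients `c` and frequencies in `S`.
For `c = fourierCoef f` it is a partial Fourier sum of `f`. -/
def trigPoly (c : (Fin d → ℤ) → ℂ) (S : Finset (Fin d → ℤ)) (x : Fin d → ℝ) : ℝ :=
  ∑ n ∈ S, wave (c n) n x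

lemma hasDerivAt_re_mul_cexp (c : ℂ) (t : ℝ) :
    HasDerivAt (fun t : ℝ => (c * Complex.exp (t * Complex.I)).re)
      (Complex.I * c * Complex.exp (t * Complex.I)).re t := by
  have hexp : HasDerivAt (fun t : ℝ => c * Complex.exp (t * Complex.I))
      (c * (Complex.exp (t * Complex.I) * (1 * Complex.I))) t :=
    (((Complex.ofRealCLM.hasDerivAt (x := t)).mul_const Complex.I).cexp).const_mul c
  refine (Complex.reCLM.hasFDerivAt.comp_hasDerivAt t hexp).congr_deriv ?_
  rw [Complex.reCLM_apply]
  congr 1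
  ring

lemma iteratedDeriv_re_mul_cexp (c : ℂ) (j : ℕ) :
    iteratedDeriv j (fun t : ℝ => (c * Complex.exp (t * Complex.I)).re)
      = fun t : ℝ => (Complex.I ^ j * c * Complex.exp (t * Complex.I)).re := by
  induction j with
  | zero => simp
  | succ j ih =>
    rw [iteratedDeriv_succ, ih]
    funext t
    rw [(hasDerivAt_re_mul_cexp (Complex.I ^ j * c) t).deriv]
    simp only [pow_succ', mul_assoc]

lemma contDiff_re_mul_cexp (c : ℂ) (N : WithTop ℕ∞) :
    ContDiff ℝ N (fun t : ℝ => (c * Complex.exp (t * Complex.I)).re) :=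
  Complex.reCLM.contDiff.comp
    (contDiff_const.mul ((Complex.ofRealCLM.contDiff.mul contDiff_const).cexp))

lemma contDiff_wave (c : ℂ) (n : Fin d → ℤ) (N : WithTop ℕ∞) : ContDiff ℝ N (wave c n) :=
  (contDiff_re_mul_cexp c N).comp (phase n).contDiff

lemma isPeriodic_wave (c : ℂ) (n : Fin d → ℤ) : IsPeriodic (wave c n) := by
  intro x z
  simp only [wave, phase_add_int]
  rw [← Complex.exp_periodic.int_mul (∑ l, n l * z l) (phase n x * Complex.I)]
  congr 3
  push_cast
  ring

lemma partialDeriv_wave {j : ℕ} (i : Fin j → Fin d) (c : ℂ) (n : Fin d → ℤ) :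
    partialDeriv i (wave c n)
      = wave ((∏ l, (2 * Real.pi * n (i l) : ℂ)) * Complex.I ^ j * c) n := by
  funext x
  have hcomp := (phase n).iteratedFDeriv_comp_right (contDiff_re_mul_cexp c j) x le_rfl
  change iteratedFDeriv ℝ j ((fun t : ℝ => (c * Complex.exp (t * Complex.I)).re) ∘ phase n) x _ = _
  rw [hcomp, ContinuousMultilinearMap.compContinuousLinearMap_apply,
    iteratedFDeriv_apply_eq_iteratedDeriv_mul_prod, iteratedDeriv_re_mul_cexp]
  simp only [phase_single, wave, smul_eq_mul]
  rw [← Complex.re_ofReal_mul]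
  congr 1
  push_cast
  ring

lemma contDiff_trigPoly (c : (Fin d → ℤ) → ℂ) (S : Finset (Fin d → ℤ)) (N : WithTop ℕ∞) :
    ContDiff ℝ N (trigPoly c S) :=
  ContDiff.sum fun n _ => contDiff_wave (c n) n N

lemma partialDeriv_trigPoly {j : ℕ} (i : Fin j → Fin d) (c : (Fin d → ℤ) → ℂ)
    (S : Finset (Fin d → ℤ)) :
    partialDeriv i (trigPoly c S)
      = trigPoly (fun n => (∏ l, (2 * Real.pi * n (i l) : ℂ)) * Complex.I ^ j * c n) S := by
  funext x
  unfold trigPoly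
  rw [partialDeriv, iteratedFDeriv_sum fun n _ => contDiff_wave _ _ _, Finset.sum_apply,
    _root_.sum_apply]
  refine Finset.sum_congr rfl fun n _ => ?_
  rw [← partialDeriv_wave]
  rfl

lemma eLpNorm_trigPoly_sub_le {w : (Fin d → ℝ) → ℝ} (hw : MemLp w 2 (torusMeasure d))
    (c : (Fin d → ℤ) → ℂ) (S : Finset (Fin d → ℤ)) :
    eLpNorm (fun x => trigPoly c S x - w x) 2 (torusMeasure d)
      ≤ ‖∑ n ∈ S, c n • UnitAddTorus.mFourierLp (d := Fin d) 2 n - (memLp_onTorus hw).toLp‖ₑ := by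
  let p : C(UnitAddTorus (Fin d), ℂ) := ∑ n ∈ S, c n • UnitAddTorus.mFourier n
  have hp : ∑ n ∈ S, c n • UnitAddTorus.mFourierLp (d := Fin d) 2 n
      = ContinuousMap.toLp 2 volume ℂ p := by
    simp only [p, UnitAddTorus.mFourierLp, map_sum, map_smul]
  have hmeas : AEStronglyMeasurable (fun t => p t - onTorus w t) :=
    p.continuous.aestronglyMeasurable.sub (memLp_onTorus hw).1
  have hnorm : ‖ContinuousMap.toLp 2 volume ℂ p - (memLp_onTorus hw).toLp‖ₑ
      = eLpNorm (fun t => p t - onTorus w t) 2 volume := by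
    rw [Lp.enorm_def]
    refine eLpNorm_congr_ae ?_
    filter_upwards [Lp.coeFn_sub (ContinuousMap.toLp 2 volume ℂ p) (memLp_onTorus hw).toLp,
      ContinuousMap.coeFn_toLp (p := 2) (𝕜 := ℂ) volume p, (memLp_onTorus hw).coeFn_toLp]
      with t hsub hpt hwt
    rw [hsub, Pi.sub_apply, hpt, hwt]
  rw [hp, hnorm, ← eLpNorm_comp_measurePreserving hmeas (measurePreserving_toTorus d)]
  refine eLpNorm_mono_ae ?_
  filter_upwards [ae_mem_unitCube d] with x hx
  have hre : trigPoly c S x - w x = (p (toTorus x) - onTorus w (toTorus x)).re := by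
    simp [p, trigPoly, wave, onTorus_toTorus w hx, mFourier_toTorus, ContinuousMap.sum_apply]
  rw [hre, Real.norm_eq_abs]
  exact Complex.abs_re_le_norm _

theorem tendsto_eLpNorm_trigPoly_sub {w : (Fin d → ℝ) → ℝ} (hw : MemLp w 2 (torusMeasure d)) :
    Tendsto (fun S => eLpNorm (fun x => trigPoly (fourierCoef w) S x - w x) 2 (torusMeasure d))
      atTop (nhds 0) := by
  refine tendsto_of_tendsto_of_tendsto_of_le_of_le tendsto_const_nhds ?_ (fun _ => zero_le)
    (fun S => eLpNorm_trigPoly_sub_le hw _ S)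
  simpa only [edist_eq_enorm_sub, SummationFilter.unconditional_filter]
    using tendsto_iff_edist_tendsto_0.1 (hasSum_mFourierLp hw)

/-! ### Fourier coefficients of weak derivatives -/

lemma integral_mul_wave {w : (Fin d → ℝ) → ℝ} (hw : Integrable w (torusMeasure d))
    (c : ℂ) (n : Fin d → ℤ) :
    ∫ x, w x * wave c n x ∂torusMeasure d = (c * star (fourierCoef w n)).re := by
  have hint : Integrable (fun x => (w x : ℂ) * (c * Complex.exp (phase n x * Complex.I)))
      (torusMeasure d) := by
    refine hw.ofReal.mul_bdd (c := ‖c‖) ?_ (Eventually.of_forall fun x => ?_)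
    · exact Continuous.aestronglyMeasurable (by fun_prop)
    · rw [norm_mul, Complex.norm_exp_ofReal_mul_I, mul_one]
  have hcoef : c * star (fourierCoef w n)
      = ∫ x, (w x : ℂ) * (c * Complex.exp (phase n x * Complex.I)) ∂torusMeasure d := by
    rw [fourierCoef, Complex.star_def, ← integral_conj, ← integral_const_mul]
    refine integral_congr_ae (Eventually.of_forall fun x => ?_)
    simp only [map_mul, Complex.conj_ofReal, ← Complex.exp_conj, map_neg, Complex.conj_I]
    rw [mul_neg, neg_neg]
    ring
  have hre := integral_re hint
  simp only [RCLike.re_to_complex] at hre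
  rw [hcoef, ← hre]
  simp only [wave, Complex.re_ofReal_mul]

theorem IsWeakDeriv.fourierCoef_eq {j : ℕ} {i : Fin j → Fin d} {f w : (Fin d → ℝ) → ℝ}
    (hf : Integrable f (torusMeasure d)) (h : IsWeakDeriv i f w) (n : Fin d → ℤ) :
    fourierCoef w n = (∏ l, (2 * Real.pi * n (i l) : ℂ)) * Complex.I ^ j * fourierCoef f n := by
  set a := (∏ l, (2 * Real.pi * n (i l) : ℂ)) * Complex.I ^ j with ha
  have hstar : star a = (-1) ^ j * a := by
    simp only [ha, Complex.star_def, map_mul, map_pow, Complex.conj_I, map_prod,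
      Complex.conj_ofReal, Complex.conj_ofNat, map_intCast]
    rw [neg_pow Complex.I]
    ring
  have hsign : ((-1 : ℝ) ^ j) * (-1) ^ j = 1 := by rw [← mul_pow]; norm_num
  have htest : ∀ c : ℂ, (c * star (fourierCoef w n)).re = (c * star (a * fourierCoef f n)).re := by
    intro c
    have hparts := h.2 (wave c n) (contDiff_wave _ _ _) (isPeriodic_wave _ _)
    rw [partialDeriv_wave, integral_mul_wave hf, integral_mul_wave (h.1.integrable (by norm_num)),
      ← ha] at hparts
    rw [← one_mul (c * star (fourierCoef w n)).re, ← hsign, mul_assoc, ← hparts,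
      ← Complex.re_ofReal_mul, star_mul', hstar]
    congr 1
    push_cast
    ring
  refine star_injective (Complex.ext (by simpa using htest 1) ?_)
  have him := htest Complex.I
  simp only [Complex.I_mul_re] at him
  exact neg_injective him

theorem IsWeakDeriv.ae_unique {j : ℕ} {i : Fin j → Fin d} {f v w : (Fin d → ℝ) → ℝ}
    (hf : Integrable f (torusMeasure d)) (hv : IsWeakDeriv i f v) (hw : IsWeakDeriv i f w) :
    v =ᵐ[torusMeasure d] w :=
  ae_eq_of_fourierCoef_eq hv.1 hw.1 fun n => by
    rw [hv.fourierCoef_eq hf, hw.fourierCoef_eq hf]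

end Fourier

/-! ### The space `H^k_0` -/

lemma summable_int_norm_inv_pow {ι : Type*} [Fintype ι] {p : ℕ} (hp : Fintype.card ι < p) :
    Summable fun n : ι → ℤ => ‖n‖⁻¹ ^ p := by
  let L : Submodule ℤ (ι → ℝ) := Submodule.span ℤ (Set.range (Pi.basisFun ℝ ι))
  have hmem : ∀ n : ι → ℤ, (fun l => (n l : ℝ)) ∈ L := by
    intro n
    rw [(Pi.basisFun ℝ ι).mem_span_iff_repr_mem ℤ]
    exact fun l => ⟨n l, by simp⟩
  let e : (ι → ℤ) → L := fun n => ⟨fun l => (n l : ℝ), hmem n⟩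
  have he : Function.Injective e := fun m n h =>
    funext fun l => Int.cast_injective (α := ℝ) (congrFun (congrArg Subtype.val h) l)
  have hrank : Module.finrank ℤ L = Fintype.card ι := by rw [ZLattice.rank ℝ L]; simp
  have hnorm : ∀ n : ι → ℤ, ‖e n‖ = ‖n‖ := fun n =>
    show ‖fun l => (n l : ℝ)‖ = ‖n‖ by simp only [Pi.norm_def]; rfl
  refine ((ZLattice.summable_norm_pow_inv L p (hrank ▸ hp)).comp_injective he).congr fun n => ?_
  rw [Function.comp_apply, hnorm]

section Sobolev

variable {d k : ℕ} {f g u : (Fin d → ℝ) → ℝ}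

lemma integrable_mul_of_continuous {φ : (Fin d → ℝ) → ℝ} (hf : Integrable f (torusMeasure d))
    (hφ : Continuous φ) : Integrable (fun x => f x * φ x) (torusMeasure d) :=
  IntegrableOn.mul_continuousOn_of_subset hf hφ.continuousOn
    (MeasurableSet.univ_pi fun _ => measurableSet_Ico)
    (isCompact_univ_pi fun _ => isCompact_Icc)
    (Set.pi_mono fun _ _ => Set.Ico_subset_Icc_self)

lemma integrable_torusMeasure_of_continuous (hf : Continuous f) :
    Integrable f (torusMeasure d) := by
  simpa using integrable_mul_of_continuous (integrable_const (1 : ℝ)) hf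

lemma continuous_partialDeriv {j : ℕ} (i : Fin j → Fin d) (hf : ContDiff ℝ j f) :
    Continuous (partialDeriv i f) := by
  have := hf.continuous_iteratedFDeriv le_rfl
  unfold partialDeriv
  fun_prop

lemma IsWeakDeriv.sub {j : ℕ} {i : Fin j → Fin d} {v w : (Fin d → ℝ) → ℝ}
    (hf : Integrable f (torusMeasure d)) (hg : Integrable g (torusMeasure d))
    (hv : IsWeakDeriv i f v) (hw : IsWeakDeriv i g w) : IsWeakDeriv i (f - g) (v - w) := by
  refine ⟨hv.1.sub hw.1, fun φ hφ hφp => ?_⟩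
  have hdφ : Continuous (partialDeriv i φ) :=
    continuous_partialDeriv i (hφ.of_le (by exact_mod_cast le_top))
  simp only [Pi.sub_apply, sub_mul]
  rw [integral_sub (integrable_mul_of_continuous hf hdφ) (integrable_mul_of_continuous hg hdφ),
    integral_sub (integrable_mul_of_continuous (hv.1.integrable one_le_two) hφ.continuous)
      (integrable_mul_of_continuous (hw.1.integrable one_le_two) hφ.continuous),
    hv.2 φ hφ hφp, hw.2 φ hφ hφp, mul_sub]

namespace MemHk0

lemma integrable (hf : MemHk0 k f) : Integrable f (torusMeasure d) :=
  integrable_torusMeasure_of_continuous hf.continuous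

lemma isWeakDeriv (hf : MemHk0 k f) {j : ℕ} (hj : j ≤ k) (i : Fin j → Fin d) :
    IsWeakDeriv i f (weakDeriv i f) := by
  have hex := hf.weak_deriv j hj i
  rw [weakDeriv, dif_pos hex]
  exact hex.choose_spec

lemma memLp_weakDeriv (hf : MemHk0 k f) (i : Fin k → Fin d) :
    MemLp (weakDeriv i f) 2 (torusMeasure d) :=
  (hf.isWeakDeriv le_rfl i).1

lemma fourierCoef_weakDeriv (hf : MemHk0 k f) (i : Fin k → Fin d) (n : Fin d → ℤ) :
    fourierCoef (weakDeriv i f) n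
      = (∏ l, (2 * Real.pi * n (i l) : ℂ)) * Complex.I ^ k * fourierCoef f n :=
  (hf.isWeakDeriv le_rfl i).fourierCoef_eq hf.integrable n

lemma fourierCoef_zero (hf : MemHk0 k f) : fourierCoef f 0 = 0 := by
  simp [fourierCoef, phase_apply, integral_complex_ofReal, hf.mean_zero]

lemma norm_fourierCoef_weakDeriv_const (hf : MemHk0 k f) (l : Fin d) (n : Fin d → ℤ) :
    ‖fourierCoef (weakDeriv (fun _ : Fin k => l) f) n‖
      = (2 * Real.pi * ‖n l‖) ^ k * ‖fourierCoef f n‖ := by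
  rw [hf.fourierCoef_weakDeriv]
  simp [abs_of_pos Real.pi_pos, Int.norm_eq_abs]

lemma norm_fourierCoef_le (hf : MemHk0 k f) (n : Fin d → ℤ) :
    ‖fourierCoef f n‖
      ≤ ‖n‖⁻¹ ^ (2 * k) + ∑ l, ‖fourierCoef (weakDeriv (fun _ : Fin k => l) f) n‖ ^ 2 := by
  rcases eq_or_ne n 0 with rfl | hn
  · rw [hf.fourierCoef_zero, norm_zero]
    positivity
  have : Nonempty (Fin d) := ⟨(Function.ne_iff.1 hn).choose⟩
  obtain ⟨l, hl⟩ : ∃ l, ‖n l‖ = ‖n‖ := by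
    obtain ⟨l, -, hl⟩ := Finset.exists_mem_eq_sup Finset.univ Finset.univ_nonempty (‖n ·‖₊)
    exact ⟨l, by rw [Pi.norm_def, hl, coe_nnnorm]⟩
  set a := ‖fourierCoef (weakDeriv (fun _ : Fin k => l) f) n‖ with ha
  have hdecay : ‖fourierCoef f n‖ ≤ ‖n‖⁻¹ ^ k * a := by
    have hπ : 1 ≤ (2 * Real.pi) ^ k := one_le_pow₀ (by linarith [Real.pi_gt_three])
    have hpos : 0 < ‖n‖ := norm_pos_iff.2 hn
    rw [ha, hf.norm_fourierCoef_weakDeriv_const, hl, mul_pow, ← mul_assoc, mul_left_comm, ← mul_pow,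
      inv_mul_cancel₀ hpos.ne', one_pow, mul_one]
    exact le_mul_of_one_le_left (norm_nonneg _) hπ
  have hsingle : a ^ 2 ≤ ∑ l, ‖fourierCoef (weakDeriv (fun _ : Fin k => l) f) n‖ ^ 2 :=
    Finset.single_le_sum (f := fun l => ‖fourierCoef (weakDeriv (fun _ : Fin k => l) f) n‖ ^ 2)
      (fun _ _ => by positivity) (Finset.mem_univ l)
  have hamgm : ‖n‖⁻¹ ^ k * a ≤ ‖n‖⁻¹ ^ (2 * k) + a ^ 2 := by
    rw [mul_comm 2 k, pow_mul]
    nlinarith [sq_nonneg (‖n‖⁻¹ ^ k - a), sq_nonneg (‖n‖⁻¹ ^ k), sq_nonneg a]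
  linarith

lemma summable_fourierCoef (hk : (d : ℝ) / 2 < k) (hf : MemHk0 k f) :
    Summable (fourierCoef f) := by
  have hdk : Fintype.card (Fin d) < 2 * k := by
    rw [Fintype.card_fin]
    exact_mod_cast (show (d : ℝ) < 2 * k by linarith)
  exact Summable.of_norm_bounded
    ((summable_int_norm_inv_pow hdk).add
      (summable_sum fun l _ => summable_sq_norm_fourierCoef (hf.memLp_weakDeriv _)))
    hf.norm_fourierCoef_le

end MemHk0

lemma isOpenQuotientMap_toTorus (d : ℕ) : IsOpenQuotientMap (toTorus (d := d)) :=
  IsOpenQuotientMap.piMap fun _ => QuotientAddGroup.isOpenQuotientMap_mk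

lemma IsPeriodic.comp_ofTorus_toTorus (hf : IsPeriodic f) (x : Fin d → ℝ) :
    f (ofTorus (toTorus x)) = f x := by
  have hint : ∀ l, ∃ z : ℤ, ofTorus (toTorus x) l = x l + z := by
    intro l
    have hcoe : ((ofTorus (toTorus x) l : ℝ) : UnitAddCircle) = (x l : UnitAddCircle) :=
      congrFun (toTorus_ofTorus (toTorus x)) l
    rw [← sub_eq_zero, ← AddCircle.coe_sub, AddCircle.coe_eq_zero_iff] at hcoe
    obtain ⟨z, hz⟩ := hcoe
    rw [zsmul_eq_mul, mul_one] at hz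
    exact ⟨z, by linarith⟩
  choose z hz using hint
  rw [← hf x z]
  exact congrArg f (funext hz)

lemma continuous_onTorus (hf : Continuous f) (hper : IsPeriodic f) : Continuous (onTorus f) := by
  rw [← (isOpenQuotientMap_toTorus d).continuous_comp_iff]
  simpa only [Function.comp_def, onTorus, hper.comp_ofTorus_toTorus]
    using Complex.continuous_ofReal.comp hf

theorem MemHk0.tendsto_trigPoly (hk : (d : ℝ) / 2 < k) (hf : MemHk0 k f) (x : Fin d → ℝ) :
    Tendsto (fun S => trigPoly (fourierCoef f) S x) atTop (nhds (f x)) := by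
  let F : C(UnitAddTorus (Fin d), ℂ) := ⟨onTorus f, continuous_onTorus hf.continuous hf.periodic⟩
  have hcoef : UnitAddTorus.mFourierCoeff (onTorus f) = fourierCoef f :=
    funext (mFourierCoeff_onTorus hf.integrable.1)
  have hsum := UnitAddTorus.hasSum_mFourier_series_apply_of_summable (f := F)
    (hcoef.symm ▸ hf.summable_fourierCoef hk) (toTorus x)
  have hre := Complex.hasSum_re hsum
  simp only [F, ContinuousMap.coe_mk, hcoef, mFourier_toTorus, smul_eq_mul] at hre
  simp only [HasSum, SummationFilter.unconditional_filter, onTorus,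
    hf.periodic.comp_ofTorus_toTorus, Complex.ofReal_re] at hre
  exact hre

theorem MemHk0.tendsto_partialDeriv_trigPoly (hf : MemHk0 k f) (i : Fin k → Fin d) :
    Tendsto (fun S => eLpNorm (fun x => partialDeriv i (trigPoly (fourierCoef f) S) x
      - weakDeriv i f x) 2 (torusMeasure d)) atTop (nhds 0) := by
  simpa only [partialDeriv_trigPoly, ← hf.fourierCoef_weakDeriv]
    using tendsto_eLpNorm_trigPoly_sub (hf.memLp_weakDeriv i)

lemma MemHk0.sub (hf : MemHk0 k f) (hg : MemHk0 k g) : MemHk0 k (f - g) where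
  continuous := hf.continuous.sub hg.continuous
  periodic x z := by simp only [Pi.sub_apply, hf.periodic x z, hg.periodic x z]
  mean_zero := by
    simp only [Pi.sub_apply]
    rw [integral_sub hf.integrable hg.integrable, hf.mean_zero, hg.mean_zero, sub_zero]
  weak_deriv _ hj i :=
    ⟨_, (hf.isWeakDeriv hj i).sub hf.integrable hg.integrable (hg.isWeakDeriv hj i)⟩

lemma weakDeriv_sub (hf : MemHk0 k f) (hg : MemHk0 k g) (i : Fin k → Fin d) :
    weakDeriv i (f - g) =ᵐ[torusMeasure d] weakDeriv i f - weakDeriv i g :=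
  ((hf.sub hg).isWeakDeriv le_rfl i).ae_unique (hf.sub hg).integrable
    ((hf.isWeakDeriv le_rfl i).sub hf.integrable hg.integrable (hg.isWeakDeriv le_rfl i))

lemma innerHk_comm (f g : (Fin d → ℝ) → ℝ) : innerHk k f g = innerHk k g f := by
  simp only [innerHk, mul_comm]

lemma MemHk0.integrable_mul_weakDeriv (hf : MemHk0 k f) (hg : MemHk0 k g) (i : Fin k → Fin d) :
    Integrable (fun x => weakDeriv i f x * weakDeriv i g x) (torusMeasure d) :=
  (hf.memLp_weakDeriv i).integrable_mul (hg.memLp_weakDeriv i)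

lemma innerHk_sub_left (hf : MemHk0 k f) (hg : MemHk0 k g) (hu : MemHk0 k u) :
    innerHk k (f - g) u = innerHk k f u - innerHk k g u := by
  unfold innerHk
  rw [← Finset.sum_sub_distrib]
  refine Finset.sum_congr rfl fun i _ => ?_
  rw [← integral_sub (hf.integrable_mul_weakDeriv hu i) (hg.integrable_mul_weakDeriv hu i)]
  refine integral_congr_ae ?_
  filter_upwards [weakDeriv_sub hf hg i] with x hx
  rw [hx, Pi.sub_apply, sub_mul]

lemma innerHk_sub_right (hf : MemHk0 k f) (hg : MemHk0 k g) (hu : MemHk0 k u) :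
    innerHk k u (f - g) = innerHk k u f - innerHk k u g := by
  rw [innerHk_comm, innerHk_sub_left hf hg hu, innerHk_comm f, innerHk_comm g]

lemma innerHk_self_nonneg (f : (Fin d → ℝ) → ℝ) : 0 ≤ innerHk k f f :=
  Finset.sum_nonneg fun _ _ => integral_nonneg fun _ => mul_self_nonneg _

lemma normHk_sq (f : (Fin d → ℝ) → ℝ) : normHk k f ^ 2 = innerHk k f f :=
  Real.sq_sqrt (innerHk_self_nonneg f)

lemma normHk_nonneg (f : (Fin d → ℝ) → ℝ) : 0 ≤ normHk k f := Real.sqrt_nonneg _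

lemma innerHk_quadratic_nonneg (hf : MemHk0 k f) (hg : MemHk0 k g) (t : ℝ) :
    0 ≤ innerHk k g g * (t * t) + 2 * innerHk k f g * t + innerHk k f f := by
  have hsq : innerHk k g g * (t * t) + 2 * innerHk k f g * t + innerHk k f f
      = ∑ i : Fin k → Fin d, ∫ x, (t * weakDeriv i g x + weakDeriv i f x) ^ 2 ∂torusMeasure d := by
    unfold innerHk
    rw [Finset.sum_mul, Finset.mul_sum, Finset.sum_mul, ← Finset.sum_add_distrib,
      ← Finset.sum_add_distrib]
    refine Finset.sum_congr rfl fun i _ => ?_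
    have hgg := (hg.integrable_mul_weakDeriv hg i).mul_const (t * t)
    have hfg := ((hf.integrable_mul_weakDeriv hg i).const_mul 2).mul_const t
    rw [← integral_mul_const, ← integral_const_mul, ← integral_mul_const, ← integral_add hgg hfg]
    refine (integral_add (hgg.add hfg) (hf.integrable_mul_weakDeriv hf i)).symm.trans ?_
    refine integral_congr_ae (Eventually.of_forall fun x => ?_)
    simp only [Pi.add_apply]
    ring
  rw [hsq]
  exact Finset.sum_nonneg fun _ _ => integral_nonneg fun _ => sq_nonneg _

lemma innerHk_le_mul_normHk (hf : MemHk0 k f) (hg : MemHk0 k g) :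
    innerHk k f g ≤ normHk k f * normHk k g := by
  have hdisc := discrim_le_zero (innerHk_quadratic_nonneg hf hg)
  rw [discrim, ← normHk_sq f, ← normHk_sq g] at hdisc
  have hsq : innerHk k f g ^ 2 ≤ (normHk k f * normHk k g) ^ 2 := by nlinarith
  exact le_of_abs_le (abs_le_of_sq_le_sq hsq (mul_nonneg (normHk_nonneg _) (normHk_nonneg _)))

end Sobolev

/-! ### The multiresolution norm -/

section MultiresolutionNorm

variable {d m : ℕ} {𝓑 : Set (Cube d)} {y z : (Fin d → Fin m) → ℝ} {a b : ℝ}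

lemma bddAbove_mrNorm (𝓑 : Set (Cube d)) (y : (Fin d → Fin m) → ℝ) :
    BddAbove (Set.range fun B : 𝓑 =>
      |∑ τ ∈ gridIn m B.1, y τ| / Real.sqrt ((gridIn m B.1).card : ℝ)) := by
  refine ((Set.finite_range fun S : Finset (Fin d → Fin m) =>
    |∑ τ ∈ S, y τ| / Real.sqrt (S.card : ℝ)).subset ?_).bddAbove
  rintro _ ⟨B, rfl⟩
  exact ⟨gridIn m B.1, rfl⟩

lemma abs_sum_gridIn_le (h : mrNorm 𝓑 y ≤ a) {B : Cube d} (hB : B ∈ 𝓑) :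
    |∑ τ ∈ gridIn m B, y τ| ≤ a * Real.sqrt ((gridIn m B).card : ℝ) := by
  rcases (gridIn m B).eq_empty_or_nonempty with hempty | hne
  · simp [hempty]
  · rw [← div_le_iff₀ (Real.sqrt_pos.2 (by exact_mod_cast hne.card_pos))]
    exact (le_ciSup (bddAbove_mrNorm 𝓑 y) ⟨B, hB⟩).trans h

lemma mrNorm_le (ha : 0 ≤ a)
    (h : ∀ B ∈ 𝓑, |∑ τ ∈ gridIn m B, y τ| ≤ a * Real.sqrt ((gridIn m B).card : ℝ)) :
    mrNorm 𝓑 y ≤ a :=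
  Real.iSup_le (fun B => div_le_of_le_mul₀ (Real.sqrt_nonneg _) ha (h B.1 B.2)) ha

lemma mrNorm_nonneg (𝓑 : Set (Cube d)) (y : (Fin d → Fin m) → ℝ) : 0 ≤ mrNorm 𝓑 y :=
  Real.iSup_nonneg fun _ => by positivity

lemma mrNorm_sub_le (hy : mrNorm 𝓑 y ≤ a) (hz : mrNorm 𝓑 z ≤ b) : mrNorm 𝓑 (y - z) ≤ a + b := by
  refine mrNorm_le (add_nonneg ((mrNorm_nonneg 𝓑 y).trans hy) ((mrNorm_nonneg 𝓑 z).trans hz))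
    fun B hB => ?_
  simp only [Pi.sub_apply, Finset.sum_sub_distrib]
  refine (abs_sub _ _).trans ?_
  rw [add_mul]
  exact add_le_add (abs_sum_gridIn_le hy hB) (abs_sum_gridIn_le hz hB)

lemma mrNorm_smul_le (hy : mrNorm 𝓑 y ≤ a) (c : ℝ) : mrNorm 𝓑 (c • y) ≤ |c| * a := by
  refine mrNorm_le (mul_nonneg (abs_nonneg _) ((mrNorm_nonneg 𝓑 y).trans hy)) fun B hB => ?_
  simp only [Pi.smul_apply, smul_eq_mul, ← Finset.mul_sum, abs_mul, mul_assoc]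
  exact mul_le_mul_of_nonneg_left (abs_sum_gridIn_le hy hB) (abs_nonneg _)

lemma mrNorm_neg (𝓑 : Set (Cube d)) (y : (Fin d → Fin m) → ℝ) : mrNorm 𝓑 (-y) = mrNorm 𝓑 y := by
  simp only [mrNorm, Pi.neg_apply, Finset.sum_neg_distrib, abs_neg]

lemma sum_mul_le_of_dualMrNorm_le {w : (Fin d → Fin m) → ℝ} {t : ℝ}
    (hw : dualMrNorm 𝓑 w ≤ (t : EReal)) (ha : 0 < a) (hy : mrNorm 𝓑 y ≤ a) :
    ∑ τ, w τ * y τ ≤ a * t := by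
  have hunit : mrNorm 𝓑 (a⁻¹ • y) ≤ 1 := by
    simpa [abs_of_pos ha, ha.ne'] using mrNorm_smul_le hy a⁻¹
  have hdual : ∑ τ, w τ * (a⁻¹ • y) τ ≤ t := EReal.coe_le_coe_iff.1 <|
    (le_iSup (fun v : {v : (Fin d → Fin m) → ℝ // mrNorm 𝓑 v ≤ 1} =>
      ((∑ τ, w τ * v.1 τ : ℝ) : EReal)) ⟨_, hunit⟩).trans hw
  simp only [Pi.smul_apply, smul_eq_mul, mul_left_comm _ a⁻¹, ← Finset.mul_sum] at hdual
  rwa [inv_mul_le_iff₀ ha] at hdual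

lemma dualMrNorm_zero_le (𝓑 : Set (Cube d)) {t : ℝ} (ht : 0 ≤ t) :
    dualMrNorm 𝓑 (0 : (Fin d → Fin m) → ℝ) ≤ (t : EReal) :=
  iSup_le fun v => by simpa using ht

end MultiresolutionNorm

/-! ### The energy estimate for the estimator -/

section Energy

variable {d m k : ℕ} {𝓑 : Set (Cube d)} {f g h u : (Fin d → ℝ) → ℝ}
  {y w : (Fin d → Fin m) → ℝ} {γ t : ℝ}

lemma memHk0_zero : MemHk0 k (0 : (Fin d → ℝ) → ℝ) where
  continuous := continuous_const
  periodic _ _ := rfl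
  mean_zero := by simp
  weak_deriv _ _ _ := ⟨0, MemLp.zero, by simp⟩

lemma isSampleAdjoint_zero : IsSampleAdjoint (d := d) (m := m) k 0 0 := by
  refine ⟨memHk0_zero, fun u hu => ?_⟩
  have hinner := innerHk_sub_right memHk0_zero memHk0_zero hu
  rw [sub_zero, sub_self] at hinner
  simp [hinner]

lemma IsSampleAdjoint.neg_innerHk_le (hh : IsSampleAdjoint k w h)
    (hw : dualMrNorm 𝓑 w ≤ (t : EReal)) (hu : MemHk0 k u) (hγ : 0 < γ)
    (hu_mr : mrNorm 𝓑 (sample m u) ≤ γ) : -innerHk k h u ≤ γ * t := by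
  have hneg := sum_mul_le_of_dualMrNorm_le hw hγ ((mrNorm_neg 𝓑 _).trans_le hu_mr)
  rw [innerHk_comm, ← hh.2 u hu, ← Finset.sum_neg_distrib]
  simpa only [Pi.neg_apply, neg_mul, mul_neg, mul_comm (w _)] using hneg

namespace IsMIND

lemma mrNorm_sample_sub_le (hg : IsMIND k 𝓑 y γ g) (hf : mrNorm 𝓑 (sample m f - y) ≤ γ) :
    mrNorm 𝓑 (sample m (g - f)) ≤ 2 * γ := by
  have hsub : sample m (g - f) = (sample m g - y) - (sample m f - y) := by
    rw [sub_sub_sub_cancel_right]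
    rfl
  rw [hsub, two_mul]
  exact mrNorm_sub_le hg.2.1 hf

lemma innerHk_sub_self_le (hg : IsMIND k 𝓑 y γ g) (hf : MemHk0 k f)
    (hf_mr : mrNorm 𝓑 (sample m f - y) ≤ γ) :
    innerHk k (g - f) (g - f) ≤ -2 * innerHk k f (g - f) := by
  have hmin := hg.2.2 f hf hf_mr
  rw [normHk_sq, normHk_sq] at hmin
  rw [innerHk_sub_left hg.1 hf (hg.1.sub hf), innerHk_sub_right hg.1 hf hg.1,
    innerHk_sub_right hg.1 hf hf, innerHk_comm f g]
  linarith

theorem normHk_sub_le (hg : IsMIND k 𝓑 y γ g) (hγ : 0 < γ) (hf : MemHk0 k f)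
    (hf_mr : mrNorm 𝓑 (sample m f - y) ≤ γ) (ht : 0 ≤ t) (hw : dualMrNorm 𝓑 w ≤ (t : EReal))
    (hh : IsSampleAdjoint k w h) :
    normHk k (g - f) ≤ 2 * normHk k (h - f) + 2 * Real.sqrt (γ * t) := by
  have hgf : MemHk0 k (g - f) := hg.1.sub hf
  have hmin := hg.innerHk_sub_self_le hf hf_mr
  have hcs : innerHk k h (g - f) - innerHk k f (g - f) ≤ normHk k (h - f) * normHk k (g - f) := by
    rw [← innerHk_sub_left hh.1 hf hgf]
    exact innerHk_le_mul_normHk (hh.1.sub hf) hgf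
  have hadj := hh.neg_innerHk_le hw hgf (by positivity) (hg.mrNorm_sample_sub_le hf_mr)
  have hquad : normHk k (g - f) ^ 2
      ≤ 2 * normHk k (h - f) * normHk k (g - f) + (2 * Real.sqrt (γ * t)) ^ 2 := by
    rw [normHk_sq, mul_pow, Real.sq_sqrt (by positivity)]
    linarith
  have hsqrt := Real.sqrt_nonneg (γ * t)
  by_contra! hlt
  nlinarith [normHk_nonneg (k := k) (h - f), normHk_nonneg (k := k) (g - f)]

end IsMIND

lemma exists_near_sourceDefect (k m : ℕ) (𝓑 : Set (Cube d)) (f : (Fin d → ℝ) → ℝ) (r : ℝ)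
    {ε : ℝ} (hε : 0 < ε) :
    ∃ t : ℝ, 0 ≤ t ∧ ∃ (w : (Fin d → Fin m) → ℝ) (g : (Fin d → ℝ) → ℝ),
      dualMrNorm 𝓑 w ≤ (t : EReal) ∧ IsSampleAdjoint k w g ∧
      normHk k (g - f) + Real.log ((m : ℝ) ^ d) ^ (r / 2) * Real.sqrt t
        ≤ sourceDefect k m 𝓑 f r + ε := by
  obtain ⟨_, ⟨t, ht, rfl⟩, hdefect⟩ := Real.lt_sInf_add_pos (s := (fun t : ℝ => distFun k m 𝓑 f t
    + Real.log ((m : ℝ) ^ d) ^ (r / 2) * Real.sqrt t) '' Set.Ici 0)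
    (Set.nonempty_Ici.image _) (half_pos hε)
  obtain ⟨_, ⟨w, g, hw, hg, rfl⟩, hdist⟩ := Real.lt_sInf_add_pos (s := {ρ : ℝ |
    ∃ (w : (Fin d → Fin m) → ℝ) (g : (Fin d → ℝ) → ℝ), dualMrNorm 𝓑 w ≤ (t : EReal) ∧
      IsSampleAdjoint k w g ∧ ρ = normHk k (g - f)})
    ⟨_, 0, 0, dualMrNorm_zero_le 𝓑 ht, isSampleAdjoint_zero, rfl⟩ (half_pos hε)
  refine ⟨t, ht, w, g, hw, hg, ?_⟩
  change _ < sourceDefect k m 𝓑 f r + ε / 2 at hdefect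
  change _ < distFun k m 𝓑 f t + ε / 2 at hdist
  linarith only [hdefect, hdist]

theorem IsMIND.normHk_sub_le_sourceDefect {r Cγ : ℝ} (hCγ : 0 < Cγ)
    (hlog : 0 < Real.log ((m : ℝ) ^ d))
    (hg : IsMIND k 𝓑 y (Cγ * Real.log ((m : ℝ) ^ d) ^ r) g) (hf : MemHk0 k f)
    (hf_mr : mrNorm 𝓑 (sample m f - y) ≤ Cγ * Real.log ((m : ℝ) ^ d) ^ r) :
    normHk k (g - f) ≤ 2 * (1 + Real.sqrt Cγ) * sourceDefect k m 𝓑 f r := by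
  have hC : 0 < 2 * (1 + Real.sqrt Cγ) := by positivity
  rw [← div_le_iff₀' hC]
  refine le_of_forall_pos_le_add fun ε hε => ?_
  rw [div_le_iff₀' hC]
  obtain ⟨t, ht, w, h, hw, hh, hle⟩ := exists_near_sourceDefect k m 𝓑 f r hε
  have henergy := hg.normHk_sub_le (by positivity) hf hf_mr ht hw hh
  have hsqrt : Real.sqrt (Cγ * Real.log ((m : ℝ) ^ d) ^ r * t)
      = Real.sqrt Cγ * (Real.log ((m : ℝ) ^ d) ^ (r / 2) * Real.sqrt t) := by
    rw [mul_assoc, Real.sqrt_mul hCγ.le, Real.sqrt_mul (by positivity),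
      Real.sqrt_eq_rpow (_ ^ r), ← Real.rpow_mul hlog.le]
    congr 3
    ring
  set s := Real.log ((m : ℝ) ^ d) ^ (r / 2) * Real.sqrt t
  have hs : 0 ≤ s := by positivity
  calc normHk k (g - f) ≤ 2 * normHk k (h - f) + 2 * (Real.sqrt Cγ * s) := hsqrt ▸ henergy
    _ ≤ 2 * (1 + Real.sqrt Cγ) * (normHk k (h - f) + s) := by
      nlinarith [mul_nonneg (Real.sqrt_nonneg Cγ) (normHk_nonneg (k := k) (h - f))]
    _ ≤ 2 * (1 + Real.sqrt Cγ) * (sourceDefect k m 𝓑 f r + ε) := by gcongr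

end Energy

/-! ### Taylor expansion with an `L²` remainder -/

section Taylor

variable {d k : ℕ} {G : (Fin d → ℝ) → ℝ} {Q : Set (Fin d → ℝ)} {x y : Fin d → ℝ}

/-- The Taylor polynomial of order `k - 1` of `G` at `y`, evaluated at `x`. -/
def taylorPoly (k : ℕ) (G : (Fin d → ℝ) → ℝ) (y x : Fin d → ℝ) : ℝ :=
  ∑ j ∈ Finset.range k, (j.factorial : ℝ)⁻¹ *
    ∑ i : Fin j → Fin d, (∏ l, (x - y) (i l)) * partialDeriv i G y

/-- The sum of the absolute values of all partial derivatives of order `k`, the form in which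
`D^k G` enters the Taylor remainder. -/
def absDeriv (k : ℕ) (G : (Fin d → ℝ) → ℝ) (z : Fin d → ℝ) : ℝ :=
  ∑ i : Fin k → Fin d, |partialDeriv i G z|

lemma absDeriv_nonneg (k : ℕ) (G : (Fin d → ℝ) → ℝ) (z : Fin d → ℝ) : 0 ≤ absDeriv k G z :=
  Finset.sum_nonneg fun _ _ => abs_nonneg _

lemma continuous_absDeriv (hG : ContDiff ℝ k G) : Continuous (absDeriv k G) :=
  continuous_finsetSum _ fun i _ => (continuous_partialDeriv i hG).abs

lemma continuous_taylorPoly_left (hG : ContDiff ℝ k G) (x : Fin d → ℝ) :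
    Continuous fun y => taylorPoly k G y x := by
  refine continuous_finsetSum _ fun j hj => continuous_const.mul (continuous_finsetSum _
    fun i _ => ?_)
  have hderiv : Continuous (partialDeriv i G) :=
    continuous_partialDeriv i (hG.of_le (by exact_mod_cast (Finset.mem_range.1 hj).le))
  fun_prop

lemma iteratedFDeriv_apply_eq_sum_partialDeriv {j : ℕ} (G : (Fin d → ℝ) → ℝ) (z v : Fin d → ℝ) :
    iteratedFDeriv ℝ j G z (fun _ => v)
      = ∑ i : Fin j → Fin d, (∏ l, v (i l)) * partialDeriv i G z := by
  have hv : v = ∑ l, v l • (Pi.single l (1 : ℝ) : Fin d → ℝ) := pi_eq_sum_univ' v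
  conv_lhs => rw [hv]
  rw [ContinuousMultilinearMap.map_sum]
  exact Finset.sum_congr rfl fun i _ => ContinuousMultilinearMap.map_smul_univ _ _ _

lemma iteratedDeriv_comp_segment {j : ℕ} (hG : ContDiff ℝ j G) (y v : Fin d → ℝ) (s : ℝ) :
    iteratedDeriv j (fun s : ℝ => G (y + s • v)) s
      = ∑ i : Fin j → Fin d, (∏ l, v (i l)) * partialDeriv i G (y + s • v) := by
  have hcomp : (fun s : ℝ => G (y + s • v))
      = (fun z => G (y + z)) ∘ ContinuousLinearMap.toSpanSingleton ℝ v := by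
    funext s
    simp
  rw [← iteratedFDeriv_apply_eq_sum_partialDeriv, iteratedDeriv_eq_iteratedFDeriv, hcomp,
    (ContinuousLinearMap.toSpanSingleton ℝ v).iteratedFDeriv_comp_right
      (f := fun z => G (y + z)) (hG.comp (contDiff_const.add contDiff_id)) s le_rfl,
    iteratedFDeriv_comp_add_left]
  simp

lemma sub_taylorPoly_eq_integral {n : ℕ} (hG : ContDiff ℝ (n + 1 : ℕ) G) (x y : Fin d → ℝ) :
    G x - taylorPoly (n + 1) G y x = ∫ s in (0 : ℝ)..1, (1 - s) ^ n / n.factorial *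
      ∑ i : Fin (n + 1) → Fin d, (∏ l, (x - y) (i l)) * partialDeriv i G (y + s • (x - y)) := by
  set φ : ℝ → ℝ := fun s => G (y + s • (x - y)) with hφ
  have hφ_smooth : ContDiff ℝ (n + 1 : ℕ) φ :=
    hG.comp (contDiff_const.add (contDiff_id.smul contDiff_const))
  have hderiv : ∀ j ≤ n + 1, ∀ s ∈ Set.uIcc (0 : ℝ) 1, iteratedDerivWithin j φ (Set.uIcc 0 1) s
      = ∑ i : Fin j → Fin d, (∏ l, (x - y) (i l)) * partialDeriv i G (y + s • (x - y)) := by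
    intro j hj s hs
    have hj' : (j : WithTop ℕ∞) ≤ (n + 1 : ℕ) := by exact_mod_cast hj
    rw [iteratedDerivWithin_eq_iteratedDeriv (uniqueDiffOn_uIcc zero_ne_one)
      (hφ_smooth.of_le hj').contDiffAt hs, iteratedDeriv_comp_segment (hG.of_le hj')]
  have htaylor : taylorWithinEval φ n (Set.uIcc 0 1) 0 1 = taylorPoly (n + 1) G y x := by
    rw [taylor_within_apply, taylorPoly]
    refine Finset.sum_congr rfl fun j hj => ?_
    rw [hderiv j (Finset.mem_range.1 hj).le 0 Set.left_mem_uIcc]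
    simp
  have hφ_one : φ 1 = G x := by simp [hφ]
  rw [← htaylor, ← hφ_one, taylor_integral_remainder hφ_smooth.contDiffOn]
  refine intervalIntegral.integral_congr fun s hs => ?_
  simp only [smul_eq_mul, hderiv (n + 1) le_rfl s hs]

lemma abs_sum_prod_mul_partialDeriv_le (k : ℕ) (G : (Fin d → ℝ) → ℝ) (v z : Fin d → ℝ) :
    |∑ i : Fin k → Fin d, (∏ l, v (i l)) * partialDeriv i G z| ≤ ‖v‖ ^ k * absDeriv k G z := by
  rw [absDeriv, Finset.mul_sum]
  refine (Finset.abs_sum_le_sum_abs _ _).trans (Finset.sum_le_sum fun i _ => ?_)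
  rw [abs_mul, Finset.abs_prod]
  refine mul_le_mul_of_nonneg_right ?_ (abs_nonneg _)
  calc ∏ l, |v (i l)| ≤ ∏ _l : Fin k, ‖v‖ :=
        Finset.prod_le_prod (fun _ _ => abs_nonneg _) fun l _ => norm_le_pi_norm v (i l)
    _ = ‖v‖ ^ k := by simp

lemma enorm_sub_taylorPoly_le (hk : 0 < k) (hG : ContDiff ℝ k G) {h : ℝ} (hxy : ‖x - y‖ ≤ h) :
    ‖G x - taylorPoly k G y x‖ₑ ≤ ∫⁻ s in Set.Ioo (0 : ℝ) 1, ENNReal.ofReal (h ^ k) *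
      (ENNReal.ofReal ((1 - s) ^ (k - 1)) * ‖absDeriv k G (y + s • (x - y))‖ₑ) := by
  obtain ⟨n, rfl⟩ := Nat.exists_eq_add_of_le' hk
  have hh : 0 ≤ h := (norm_nonneg _).trans hxy
  rw [sub_taylorPoly_eq_integral hG, intervalIntegral.integral_of_le zero_le_one,
    integral_Ioc_eq_integral_Ioo]
  refine (enorm_integral_le_lintegral_enorm _).trans
    (setLIntegral_mono' measurableSet_Ioo fun s hs => ?_)
  have hs_nonneg : 0 ≤ (1 - s) ^ n := pow_nonneg (sub_nonneg.2 hs.2.le) _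
  rw [Real.enorm_eq_ofReal (absDeriv_nonneg _ _ _), Nat.add_sub_cancel,
    ← ENNReal.ofReal_mul hs_nonneg, ← ENNReal.ofReal_mul (by positivity), Real.enorm_eq_ofReal_abs,
    abs_mul, abs_of_nonneg (by positivity)]
  refine ENNReal.ofReal_le_ofReal ?_
  have hfactorial : (1 : ℝ) ≤ n.factorial := by exact_mod_cast n.factorial_pos
  calc (1 - s) ^ n / n.factorial * _
      ≤ (1 - s) ^ n * (‖x - y‖ ^ (n + 1) * absDeriv (n + 1) G (y + s • (x - y))) :=
        mul_le_mul (div_le_self hs_nonneg hfactorial) (abs_sum_prod_mul_partialDeriv_le _ _ _ _)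
          (abs_nonneg _) hs_nonneg
    _ ≤ (1 - s) ^ n * (h ^ (n + 1) * absDeriv (n + 1) G (y + s • (x - y))) := by
        have := absDeriv_nonneg (n + 1) G (y + s • (x - y))
        gcongr
    _ = _ := by ring

lemma setLIntegral_comp_contraction_le (hQm : MeasurableSet Q) (hQ : Convex ℝ Q) (hx : x ∈ Q)
    {s : ℝ} (hs : s ∈ Set.Ioo (0 : ℝ) 1) {F : (Fin d → ℝ) → ℝ≥0∞} (hF : Measurable F) :
    ∫⁻ y in Q, F (y + s • (x - y)) ≤ ENNReal.ofReal (((1 - s) ^ d)⁻¹) * ∫⁻ y in Q, F y := by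
  have hs_pos : 0 < 1 - s := sub_pos.2 hs.2
  calc ∫⁻ y in Q, F (y + s • (x - y))
      ≤ ∫⁻ y in Q, Q.indicator F ((1 - s) • y + s • x) := by
        refine setLIntegral_mono' hQm fun y hy => ?_
        have hmem : (1 - s) • y + s • x ∈ Q := hQ hy hx hs_pos.le hs.1.le (by ring)
        rw [Set.indicator_of_mem hmem]
        refine le_of_eq (congrArg F ?_)
        module
    _ ≤ ∫⁻ y, Q.indicator F ((1 - s) • y + s • x) := setLIntegral_le_lintegral _ _
    _ = ∫⁻ z, Q.indicator F (z + s • x) ∂Measure.map (fun y => (1 - s) • y) volume := by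
        have := hF.indicator hQm
        rw [lintegral_map (by fun_prop) (by fun_prop)]
    _ = ENNReal.ofReal (((1 - s) ^ d)⁻¹) * ∫⁻ z, Q.indicator F (z + s • x) := by
        rw [Measure.map_addHaar_smul _ hs_pos.ne', lintegral_smul_measure, smul_eq_mul]
        simp [abs_of_pos hs_pos]
    _ = _ := by
        rw [lintegral_add_right_eq_self, lintegral_indicator hQm]

lemma lintegral_le_rpow_measure_univ_mul {α : Type*} [MeasurableSpace α] {μ : Measure α}
    {F : α → ℝ≥0∞} (hF : AEMeasurable F μ) :
    ∫⁻ a, F a ∂μ ≤ μ Set.univ ^ (1 / 2 : ℝ) * (∫⁻ a, F a ^ 2 ∂μ) ^ (1 / 2 : ℝ) := by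
  simpa using ENNReal.lintegral_mul_le_Lp_mul_Lq μ Real.HolderConjugate.two_two
    (f := fun _ => 1) (g := F) aemeasurable_const hF

/-- The constant `∫₀¹ (1 - s)^(k - 1 - d/2) ds` of the Taylor estimate: the factor `(1 - s)^(-d/2)`
is the price of contracting a cube towards one of its points by the ratio `1 - s`. -/
def taylorConst (k d : ℕ) : ℝ≥0∞ :=
  ∫⁻ s in Set.Ioo (0 : ℝ) 1, ENNReal.ofReal ((1 - s) ^ (k - 1)) *
    ENNReal.ofReal (((1 - s) ^ d)⁻¹) ^ (1 / 2 : ℝ)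

lemma taylorConst_eq_lintegral_rpow (hk : 0 < k) (d : ℕ) :
    taylorConst k d = ∫⁻ t in Set.Ioo (0 : ℝ) 1, ENNReal.ofReal (t ^ ((k : ℝ) - 1 - d / 2)) := by
  rw [taylorConst, ← lintegral_indicator measurableSet_Ioo,
    ← lintegral_indicator (f := fun t : ℝ => ENNReal.ofReal _) measurableSet_Ioo,
    ← lintegral_sub_left_eq_self _ (1 : ℝ)]
  refine lintegral_congr fun t => ?_
  have hmem : 1 - t ∈ Set.Ioo (0 : ℝ) 1 ↔ t ∈ Set.Ioo (0 : ℝ) 1 := by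
    simp only [Set.mem_Ioo, sub_pos, sub_lt_self_iff, and_comm]
  simp only [Set.indicator_apply, hmem, sub_sub_cancel]
  split_ifs with ht
  · have ht_pos := ht.1
    rw [ENNReal.ofReal_rpow_of_pos (by positivity), ← ENNReal.ofReal_mul (by positivity),
      ← Real.rpow_natCast, ← Real.rpow_natCast, ← Real.rpow_neg ht_pos.le,
      ← Real.rpow_mul ht_pos.le, ← Real.rpow_add ht_pos]
    congr 2
    push_cast [Nat.one_le_iff_ne_zero.2 hk.ne']
    ring
  · rfl

lemma taylorConst_ne_top (hk : (d : ℝ) / 2 < k) : taylorConst k d ≠ ⊤ := by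
  have hk_pos : 0 < k := by exact_mod_cast (show (0 : ℝ) ≤ d / 2 by positivity).trans_lt hk
  have hint : IntegrableOn (fun t : ℝ => t ^ ((k : ℝ) - 1 - d / 2)) (Set.Ioo 0 1) volume :=
    (intervalIntegral.integrableOn_Ioo_rpow_iff zero_lt_one).2 (by linarith)
  rw [taylorConst_eq_lintegral_rpow hk_pos]
  exact hint.lintegral_lt_top.ne

lemma eLpNorm_two_eq_rpow_lintegral {α : Type*} [MeasurableSpace α] (μ : Measure α) (F : α → ℝ) :
    eLpNorm F 2 μ = (∫⁻ a, ‖F a‖ₑ ^ 2 ∂μ) ^ (1 / 2 : ℝ) := by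
  rw [eLpNorm_eq_lintegral_rpow_enorm_toReal two_ne_zero ENNReal.ofNat_ne_top]
  simp

lemma setLIntegral_enorm_comp_contraction_le (hG : ContDiff ℝ k G) (hQm : MeasurableSet Q)
    (hQ : Convex ℝ Q) (hx : x ∈ Q) {s : ℝ} (hs : s ∈ Set.Ioo (0 : ℝ) 1) :
    ∫⁻ y in Q, ‖absDeriv k G (y + s • (x - y))‖ₑ ≤ ENNReal.ofReal (((1 - s) ^ d)⁻¹) ^ (1 / 2 : ℝ) *
      (volume Q ^ (1 / 2 : ℝ) * eLpNorm (absDeriv k G) 2 (volume.restrict Q)) := by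
  have hcont := continuous_absDeriv hG
  have hmeas : Measurable fun z => ‖absDeriv k G z‖ₑ := hcont.measurable.enorm
  have hmeas_comp : Measurable fun y => ‖absDeriv k G (y + s • (x - y))‖ₑ :=
    (hcont.comp (by fun_prop)).measurable.enorm
  refine (lintegral_le_rpow_measure_univ_mul hmeas_comp.aemeasurable).trans ?_
  rw [Measure.restrict_apply_univ, mul_left_comm, eLpNorm_two_eq_rpow_lintegral]
  refine mul_le_mul_right ?_ _
  rw [← ENNReal.mul_rpow_of_nonneg _ _ one_half_pos.le]
  exact ENNReal.rpow_le_rpow (setLIntegral_comp_contraction_le hQm hQ hx hs (hmeas.pow_const 2))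
    one_half_pos.le

lemma lintegral_enorm_sub_taylorPoly_le (hk : 0 < k) (hG : ContDiff ℝ k G)
    (hQm : MeasurableSet Q) (hQ : Convex ℝ Q) {h : ℝ} (hQh : ∀ x ∈ Q, ∀ y ∈ Q, ‖x - y‖ ≤ h)
    (hx : x ∈ Q) :
    ∫⁻ y in Q, ‖G x - taylorPoly k G y x‖ₑ ≤ ENNReal.ofReal (h ^ k) * (taylorConst k d *
      (volume Q ^ (1 / 2 : ℝ) * eLpNorm (absDeriv k G) 2 (volume.restrict Q))) := by
  have hcont := continuous_absDeriv hG
  have hmeas : Measurable (Function.uncurry fun (y : Fin d → ℝ) (s : ℝ) =>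
      ENNReal.ofReal (h ^ k) *
      (ENNReal.ofReal ((1 - s) ^ (k - 1)) * ‖absDeriv k G (y + s • (x - y))‖ₑ)) := by
    have hcomp : Continuous fun p : (Fin d → ℝ) × ℝ => absDeriv k G (p.1 + p.2 • (x - p.1)) :=
      hcont.comp (by fun_prop)
    have := hcomp.measurable.enorm
    unfold Function.uncurry
    fun_prop
  calc ∫⁻ y in Q, ‖G x - taylorPoly k G y x‖ₑ
      ≤ ∫⁻ y in Q, ∫⁻ s in Set.Ioo (0 : ℝ) 1, ENNReal.ofReal (h ^ k) *
      (ENNReal.ofReal ((1 - s) ^ (k - 1)) * ‖absDeriv k G (y + s • (x - y))‖ₑ) :=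
        setLIntegral_mono' hQm fun y hy => enorm_sub_taylorPoly_le hk hG (hQh x hx y hy)
    _ = ∫⁻ s in Set.Ioo (0 : ℝ) 1, ∫⁻ y in Q, ENNReal.ofReal (h ^ k) *
      (ENNReal.ofReal ((1 - s) ^ (k - 1)) * ‖absDeriv k G (y + s • (x - y))‖ₑ) :=
        lintegral_lintegral_swap hmeas.aemeasurable
    _ ≤ ∫⁻ s in Set.Ioo (0 : ℝ) 1, ENNReal.ofReal (h ^ k) *
      (ENNReal.ofReal ((1 - s) ^ (k - 1)) * ENNReal.ofReal (((1 - s) ^ d)⁻¹) ^ (1 / 2 : ℝ) *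
        (volume Q ^ (1 / 2 : ℝ) * eLpNorm (absDeriv k G) 2 (volume.restrict Q))) := by
        refine setLIntegral_mono' measurableSet_Ioo fun s hs => ?_
        have hmeas_comp : Measurable fun y => ‖absDeriv k G (y + s • (x - y))‖ₑ :=
          (hcont.comp (by fun_prop)).measurable.enorm
        rw [lintegral_const_mul _ (by fun_prop), lintegral_const_mul _ hmeas_comp, mul_assoc]
        gcongr
        exact setLIntegral_enorm_comp_contraction_le hG hQm hQ hx hs
    _ = _ := by
        rw [lintegral_const_mul _ (by fun_prop), lintegral_mul_const _ (by fun_prop)]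
        rfl

end Taylor

/-! ### Polynomials on a cube are controlled by means over small subcubes -/

section PolynomialMeans

variable {d k n N : ℕ}

lemma exists_dist_lt_abs_sub_le_mul_norm {K E : Type*} [PseudoMetricSpace K] [CompactSpace K]
    [NormedAddCommGroup E] [NormedSpace ℝ E] [FiniteDimensional ℝ E] (T : E →ₗ[ℝ] C(K, ℝ))
    {ε : ℝ} (hε : 0 < ε) :
    ∃ δ > 0, ∀ p : E, ∀ x y : K, dist x y < δ → |T p x - T p y| ≤ ε * ‖p‖ := by
  let evalAt : K → E →L[ℝ] ℝ := fun x => (ContinuousMap.evalCLM ℝ x).comp T.toContinuousLinearMap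
  have hcont : Continuous evalAt := continuous_clm_apply.2 fun p => (T p).continuous
  have hunif : UniformContinuous evalAt := CompactSpace.uniformContinuous_of_continuous hcont
  obtain ⟨δ, hδ, hclose⟩ := Metric.uniformContinuous_iff.1 hunif ε hε
  refine ⟨δ, hδ, fun p x y hxy => ?_⟩
  calc |T p x - T p y| = ‖(evalAt x - evalAt y) p‖ := rfl
    _ ≤ ‖evalAt x - evalAt y‖ * ‖p‖ := ContinuousLinearMap.le_opNorm _ _
    _ ≤ ε * ‖p‖ := by
        gcongr
        exact (dist_eq_norm (evalAt x) (evalAt y) ▸ hclose hxy).le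

/-- Evaluation of polynomials on the unit cube. -/
def evalUnitCube (d : ℕ) : MvPolynomial (Fin d) ℝ →ₗ[ℝ] C(Set.Icc (0 : Fin d → ℝ) 1, ℝ) where
  toFun p := ⟨fun u => MvPolynomial.eval u.1 p, p.continuous_eval.comp continuous_subtype_val⟩
  map_add' p q := by
    ext
    simp
  map_smul' a p := by
    ext
    simp [MvPolynomial.smul_eval]

/-- Every polynomial of degree at most `n` in `d` variables varies on the unit cube, within the
distance `1 / N` of some maximum point of its absolute value, by at most half of the maximum. -/
def IsSubdivision (n d N : ℕ) : Prop :=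
  ∀ p : MvPolynomial (Fin d) ℝ, p.totalDegree ≤ n → ∃ u₀ ∈ Set.Icc (0 : Fin d → ℝ) 1,
    (∀ u ∈ Set.Icc (0 : Fin d → ℝ) 1, |MvPolynomial.eval u p| ≤ |MvPolynomial.eval u₀ p|) ∧
    ∀ u ∈ Set.Icc (0 : Fin d → ℝ) 1, ‖u₀ - u‖ ≤ 1 / N →
      |MvPolynomial.eval u₀ p - MvPolynomial.eval u p| ≤ |MvPolynomial.eval u₀ p| / 2

lemma exists_isSubdivision (n d : ℕ) : ∃ N : ℕ, 0 < N ∧ IsSubdivision n d N := by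
  let V := (MvPolynomial.restrictTotalDegree (Fin d) ℝ n).map (evalUnitCube d)
  obtain ⟨δ, hδ, hosc⟩ := exists_dist_lt_abs_sub_le_mul_norm (E := V) V.subtype
    (one_half_pos (α := ℝ))
  obtain ⟨N, hN⟩ := exists_nat_gt (1 / δ)
  have hN_pos : (0 : ℝ) < N := (one_div_pos.2 hδ).trans hN
  refine ⟨N, by exact_mod_cast hN_pos, fun p hp => ?_⟩
  have : Nonempty (Set.Icc (0 : Fin d → ℝ) 1) := ⟨⟨0, le_rfl, zero_le_one⟩⟩
  obtain ⟨u₀, -, hmax⟩ := isCompact_univ.exists_isMaxOn Set.univ_nonempty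
    (f := fun u => |evalUnitCube d p u|) (evalUnitCube d p).continuous.abs.continuousOn
  have hnorm : ‖evalUnitCube d p‖ ≤ |MvPolynomial.eval u₀.1 p| :=
    (ContinuousMap.norm_le _ (abs_nonneg _)).2 fun u => hmax (Set.mem_univ u)
  refine ⟨u₀, u₀.2, fun u hu => hmax (Set.mem_univ ⟨u, hu⟩), fun u hu hdist => ?_⟩
  have hlt : dist u₀ ⟨u, hu⟩ < δ := by
    rw [Subtype.dist_eq, dist_eq_norm]
    exact hdist.trans_lt ((div_lt_comm₀ hN_pos hδ).2 hN)
  have hosc_p := hosc ⟨evalUnitCube d p, p, (MvPolynomial.mem_restrictTotalDegree _ _ _).2 hp, rfl⟩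
    u₀ ⟨u, hu⟩ hlt
  change |MvPolynomial.eval u₀.1 p - MvPolynomial.eval u p| ≤ 1 / 2 * ‖evalUnitCube d p‖ at hosc_p
  linarith

lemma exists_fin_div_le {N : ℕ} (hN : 0 < N) {u : ℝ} (hu : u ∈ Set.Icc (0 : ℝ) 1) :
    ∃ z : Fin N, u ∈ Set.Icc ((z : ℝ) / N) ((z + 1) / N) := by
  have hN' : (0 : ℝ) < N := by exact_mod_cast hN
  simp only [Set.mem_Icc, div_le_iff₀ hN', le_div_iff₀ hN']
  rcases hu.2.lt_or_eq with hlt | rfl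
  · have huN : 0 ≤ u * N := mul_nonneg hu.1 hN'.le
    exact ⟨⟨⌊u * N⌋₊, (Nat.floor_lt huN).2 (by nlinarith)⟩, Nat.floor_le huN,
      (Nat.lt_floor_add_one _).le⟩
  · refine ⟨⟨N - 1, Nat.sub_one_lt hN.ne'⟩, ?_, ?_⟩ <;> push_cast [Nat.cast_pred hN] <;> linarith

lemma abs_sub_expect_le {ι : Type*} {S : Finset ι} (hS : S.Nonempty) {f : ι → ℝ} {a b : ℝ}
    (hf : ∀ τ ∈ S, |a - f τ| ≤ b) : |a - (𝔼 τ ∈ S, f τ)| ≤ b := by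
  rw [← Finset.expect_const hS a, ← Finset.expect_sub_distrib]
  exact (Finset.abs_expect_le _ _).trans (Finset.expect_le hS hf)

lemma IsSubdivision.abs_eval_le (hN : IsSubdivision n d N) (hN_pos : 0 < N)
    {p : MvPolynomial (Fin d) ℝ} (hp : p.totalDegree ≤ n) {ι : Type*}
    {S : (Fin d → Fin N) → Finset ι} (hS : ∀ z, (S z).Nonempty) {x : ι → Fin d → ℝ}
    (hx : ∀ z, ∀ τ ∈ S z, ∀ l, x τ l ∈ Set.Icc ((z l : ℝ) / N) ((z l + 1) / N))
    {u : Fin d → ℝ} (hu : u ∈ Set.Icc (0 : Fin d → ℝ) 1) :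
    |MvPolynomial.eval u p| ≤ 2 * ∑ z, |(𝔼 τ ∈ S z, MvPolynomial.eval (x τ) p)| := by
  obtain ⟨u₀, hu₀, hmax, hosc⟩ := hN p hp
  choose z hz using fun l => exists_fin_div_le hN_pos ⟨hu₀.1 l, hu₀.2 l⟩
  have hN' : (0 : ℝ) < N := by exact_mod_cast hN_pos
  have hmean : |MvPolynomial.eval u₀ p - (𝔼 τ ∈ S z, MvPolynomial.eval (x τ) p)|
      ≤ |MvPolynomial.eval u₀ p| / 2 := by
    refine abs_sub_expect_le (hS z) fun τ hτ => hosc _ ?_ ?_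
    · refine ⟨fun l => le_trans ?_ (hx z τ hτ l).1, fun l => (hx z τ hτ l).2.trans ?_⟩
      · exact div_nonneg (Nat.cast_nonneg _) hN'.le
      · exact (div_le_one hN').2 (by exact_mod_cast (z l).2)
    · refine (pi_norm_le_iff_of_nonneg (by positivity)).2 fun l => ?_
      rw [Pi.sub_apply, Real.norm_eq_abs, abs_le]
      have hwidth : ((z l : ℝ) + 1) / N = z l / N + 1 / N := add_div _ _ _
      constructor <;> linarith [(hz l).1, (hz l).2, (hx z τ hτ l).1, (hx z τ hτ l).2]
  have hsingle : |(𝔼 τ ∈ S z, MvPolynomial.eval (x τ) p)|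
      ≤ ∑ z, |(𝔼 τ ∈ S z, MvPolynomial.eval (x τ) p)| :=
    Finset.single_le_sum (f := fun z => |(𝔼 τ ∈ S z, MvPolynomial.eval (x τ) p)|)
      (fun _ _ => abs_nonneg _) (Finset.mem_univ z)
  have htriangle := abs_sub_abs_le_abs_sub (MvPolynomial.eval u₀ p)
    (𝔼 τ ∈ S z, MvPolynomial.eval (x τ) p)
  linarith [hmax u hu]

lemma exists_eval_eq_taylorPoly (k : ℕ) (G : (Fin d → ℝ) → ℝ) (y c : Fin d → ℝ) (h : ℝ) :
    ∃ p : MvPolynomial (Fin d) ℝ, p.totalDegree ≤ k ∧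
      ∀ u, MvPolynomial.eval u p = taylorPoly k G y (c + h • u) := by
  let factor : Fin d → MvPolynomial (Fin d) ℝ := fun l =>
    MvPolynomial.C (c l - y l) + MvPolynomial.C h * MvPolynomial.X l
  have hfactor : ∀ l, (factor l).totalDegree ≤ 1 := fun l => by
    refine (MvPolynomial.totalDegree_add _ _).trans (max_le ?_ ?_)
    · exact (MvPolynomial.totalDegree_C _).trans_le zero_le_one
    · exact (MvPolynomial.totalDegree_mul _ _).trans (by simp)
  refine ⟨∑ j ∈ Finset.range k, MvPolynomial.C (j.factorial : ℝ)⁻¹ *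
    ∑ i : Fin j → Fin d, (∏ l, factor (i l)) * MvPolynomial.C (partialDeriv i G y), ?_, ?_⟩
  · refine MvPolynomial.totalDegree_finsetSum_le fun j hj => ?_
    refine (MvPolynomial.totalDegree_mul _ _).trans ?_
    rw [MvPolynomial.totalDegree_C, zero_add]
    refine MvPolynomial.totalDegree_finsetSum_le fun i _ => ?_
    refine (MvPolynomial.totalDegree_mul _ _).trans ?_
    rw [MvPolynomial.totalDegree_C, add_zero]
    calc (∏ l, factor (i l)).totalDegree ≤ ∑ l, (factor (i l)).totalDegree :=
          MvPolynomial.totalDegree_finsetProd _ _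
      _ ≤ ∑ _l : Fin j, 1 := Finset.sum_le_sum fun l _ => hfactor (i l)
      _ ≤ k := by simpa using (Finset.mem_range.1 hj).le
  · intro u
    simp only [taylorPoly, factor, map_sum, map_mul, map_prod, map_add, MvPolynomial.eval_C,
      MvPolynomial.eval_X, Pi.add_apply, Pi.sub_apply, Pi.smul_apply, smul_eq_mul,
      sub_add_eq_add_sub]

end PolynomialMeans

/-! ### Pointwise bounds on a box by means over subboxes and local energy -/

section LocalEstimate

variable {d k m N : ℕ} {c x y : Fin d → ℝ} {h : ℝ}

/-- The half-open cube with corner `c` and side `h`, on which the local estimates are stated. -/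
def box (c : Fin d → ℝ) (h : ℝ) : Set (Fin d → ℝ) :=
  Set.univ.pi fun l => Set.Ico (c l) (c l + h)

lemma mem_box : x ∈ box c h ↔ ∀ l, c l ≤ x l ∧ x l < c l + h := by
  simp [box]

lemma measurableSet_box (c : Fin d → ℝ) (h : ℝ) : MeasurableSet (box c h) :=
  MeasurableSet.univ_pi fun _ => measurableSet_Ico

lemma convex_box (c : Fin d → ℝ) (h : ℝ) : Convex ℝ (box c h) :=
  convex_pi fun _ _ => convex_Ico _ _

lemma volume_box (c : Fin d → ℝ) (h : ℝ) : volume (box c h) = ENNReal.ofReal h ^ d := by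
  simp [box, Real.volume_pi_Ico]

lemma norm_sub_le_of_mem_box (hh : 0 ≤ h) (hx : x ∈ box c h) (hy : y ∈ box c h) :
    ‖x - y‖ ≤ h := by
  rw [mem_box] at hx hy
  refine (pi_norm_le_iff_of_nonneg hh).2 fun l => ?_
  rw [Pi.sub_apply, Real.norm_eq_abs, abs_le]
  constructor <;> linarith [hx l, hy l]

lemma box_subset_unitCube (hc : ∀ l, 0 ≤ c l) (hch : ∀ l, c l + h ≤ 1) :
    box c h ⊆ unitCube d :=
  Set.pi_mono fun l _ => Set.Ico_subset_Ico (hc l) (hch l)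

/-- The corner of the subcube with index `z` in the subdivision of `box c h` into `N ^ d` cubes of
side `h / N`. -/
def subCorner (c : Fin d → ℝ) (h : ℝ) (z : Fin d → Fin N) : Fin d → ℝ :=
  fun l => c l + h * (z l / N)

lemma subCorner_add_le (hh : 0 ≤ h) (c : Fin d → ℝ) (z : Fin d → Fin N) (l : Fin d) :
    subCorner c h z l + h / N ≤ c l + h := by
  have hz : ((z l : ℕ) : ℝ) + 1 ≤ N := by exact_mod_cast (z l).2
  have hN : (0 : ℝ) < N := lt_of_lt_of_le (by positivity) hz
  calc subCorner c h z l + h / N = c l + h * ((z l + 1) / N) := by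
        rw [subCorner]
        ring
    _ ≤ c l + h := by
        gcongr
        exact mul_le_of_le_one_right hh ((div_le_one hN).2 hz)

lemma le_subCorner (hh : 0 ≤ h) (c : Fin d → ℝ) (z : Fin d → Fin N) (l : Fin d) :
    c l ≤ subCorner c h z l :=
  le_add_of_nonneg_right (by positivity)

lemma subBox_subset (hh : 0 ≤ h) (z : Fin d → Fin N) :
    box (subCorner c h z) (h / N) ⊆ box c h :=
  Set.pi_mono fun l _ => Set.Ico_subset_Ico (le_subCorner hh c z l) (subCorner_add_le hh c z l)

section Samples

variable {ι : Type*} {S : (Fin d → Fin N) → Finset ι} {p : ι → Fin d → ℝ}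
  {G g : (Fin d → ℝ) → ℝ}

/-- The family `S` selects from the points `p` a nonempty sample in each of the `N ^ d` subcubes
of `box c h`. -/
def SamplesSubBoxes (c : Fin d → ℝ) (h : ℝ) (S : (Fin d → Fin N) → Finset ι)
    (p : ι → Fin d → ℝ) : Prop :=
  ∀ z, (S z).Nonempty ∧ ∀ τ ∈ S z, p τ ∈ box (subCorner c h z) (h / N)

/-- The sum over all samples of the absolute value of the mean of `G`, the discrete data by which
`G` is controlled. -/
def meanSum (S : (Fin d → Fin N) → Finset ι) (p : ι → Fin d → ℝ) (G : (Fin d → ℝ) → ℝ) : ℝ :=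
  ∑ z, |(𝔼 τ ∈ S z, G (p τ))|

lemma meanSum_nonneg (S : (Fin d → Fin N) → Finset ι) (p : ι → Fin d → ℝ)
    (G : (Fin d → ℝ) → ℝ) : 0 ≤ meanSum S p G :=
  Finset.sum_nonneg fun _ _ => abs_nonneg _

lemma tendsto_meanSum {α : Type*} {l : Filter α} {F : α → (Fin d → ℝ) → ℝ}
    (hF : ∀ x, Tendsto (fun a => F a x) l (nhds (g x))) :
    Tendsto (fun a => meanSum S p (F a)) l (nhds (meanSum S p g)) := by
  unfold meanSum
  simp only [Finset.expect_eq_sum_div_card]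
  exact tendsto_finsetSum _ fun z _ => ((tendsto_finsetSum _ fun _ _ => hF _).div_const _).abs

lemma abs_taylorPoly_le (hN : IsSubdivision k d N) (hN_pos : 0 < N) (hh : 0 < h)
    (hS : SamplesSubBoxes c h S p) (G : (Fin d → ℝ) → ℝ) (y : Fin d → ℝ) (hx : x ∈ box c h) :
    |taylorPoly k G y x| ≤ 2 * meanSum S p (taylorPoly k G y) := by
  obtain ⟨P, hdeg, hP⟩ := exists_eval_eq_taylorPoly k G y c h
  have heval : ∀ q, MvPolynomial.eval (h⁻¹ • (q - c)) P = taylorPoly k G y q := fun q => by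
    rw [hP, smul_inv_smul₀ hh.ne', add_sub_cancel]
  have hrescale : ∀ z, ∀ τ ∈ S z, ∀ l,
      (h⁻¹ • (p τ - c)) l ∈ Set.Icc ((z l : ℝ) / N) ((z l + 1) / N) := by
    intro z τ hτ l
    obtain ⟨hlower, hupper⟩ := mem_box.1 ((hS z).2 τ hτ) l
    simp only [subCorner] at hlower hupper
    rw [Pi.smul_apply, Pi.sub_apply, smul_eq_mul, Set.mem_Icc, le_inv_mul_iff₀ hh,
      inv_mul_le_iff₀ hh, add_div, mul_add, mul_one_div]
    constructor <;> linarith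
  have hu : h⁻¹ • (x - c) ∈ Set.Icc (0 : Fin d → ℝ) 1 := by
    refine ⟨fun l => ?_, fun l => ?_⟩ <;> obtain ⟨hlower, hupper⟩ := mem_box.1 hx l <;>
      simp only [Pi.smul_apply, Pi.sub_apply, smul_eq_mul, Pi.zero_apply, Pi.one_apply]
    · exact mul_nonneg (inv_nonneg.2 hh.le) (sub_nonneg.2 hlower)
    · exact (inv_mul_le_iff₀ hh).2 (by linarith)
  simpa only [heval, meanSum] using hN.abs_eval_le hN_pos hdeg (fun z => (hS z).1) hrescale hu

lemma abs_le_abs_sub_taylorPoly_add (hN : IsSubdivision k d N) (hN_pos : 0 < N) (hh : 0 < h)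
    (hS : SamplesSubBoxes c h S p) (G : (Fin d → ℝ) → ℝ) (y : Fin d → ℝ) (hx : x ∈ box c h) :
    |G x| ≤ |G x - taylorPoly k G y x| + (2 * meanSum S p G +
      2 * ∑ z, 𝔼 τ ∈ S z, |G (p τ) - taylorPoly k G y (p τ)|) := by
  have hmean : ∀ z, |(𝔼 τ ∈ S z, taylorPoly k G y (p τ))|
      ≤ |(𝔼 τ ∈ S z, G (p τ))| + 𝔼 τ ∈ S z, |G (p τ) - taylorPoly k G y (p τ)| := by
    intro z
    have htri := abs_sub_abs_le_abs_sub (𝔼 τ ∈ S z, taylorPoly k G y (p τ)) (𝔼 τ ∈ S z, G (p τ))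
    have hdiff := Finset.abs_expect_le (S z) fun τ => G (p τ) - taylorPoly k G y (p τ)
    rw [Finset.expect_sub_distrib, abs_sub_comm] at hdiff
    linarith
  have hsum : meanSum S p (taylorPoly k G y)
      ≤ meanSum S p G + ∑ z, 𝔼 τ ∈ S z, |G (p τ) - taylorPoly k G y (p τ)| :=
    (Finset.sum_le_sum fun z _ => hmean z).trans_eq Finset.sum_add_distrib
  have hT := abs_taylorPoly_le hN hN_pos hh hS G y hx
  linarith [abs_sub_abs_le_abs_sub (G x) (taylorPoly k G y x)]

lemma lintegral_ofReal_expect_abs_le {α : Type*} [MeasurableSpace α] {μ : Measure α}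
    {T : Finset ι} (hT : T.Nonempty) {F : ι → α → ℝ} (hF : ∀ i ∈ T, Measurable (F i)) {R : ℝ≥0∞}
    (hR : ∀ i ∈ T, ∫⁻ a, ‖F i a‖ₑ ∂μ ≤ R) : ∫⁻ a, ENNReal.ofReal (𝔼 i ∈ T, |F i a|) ∂μ ≤ R := by
  have hcard : (T.card : ℝ≥0∞) ≠ 0 := by exact_mod_cast hT.card_pos.ne'
  have hexpect : ∀ a, ENNReal.ofReal (𝔼 i ∈ T, |F i a|)
      = (T.card : ℝ≥0∞)⁻¹ * ∑ i ∈ T, ‖F i a‖ₑ := by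
    intro a
    rw [Finset.expect_eq_sum_div_card, ENNReal.ofReal_div_of_pos (by exact_mod_cast hT.card_pos),
      ENNReal.ofReal_sum_of_nonneg fun _ _ => abs_nonneg _, ENNReal.ofReal_natCast,
      ENNReal.div_eq_inv_mul]
    simp only [Real.enorm_eq_ofReal_abs]
  simp only [hexpect]
  rw [lintegral_const_mul _ (Finset.measurable_fun_sum _ fun i hi => (hF i hi).enorm),
    lintegral_finsetSum _ fun i hi => (hF i hi).enorm,
    ENNReal.inv_mul_le_iff hcard (ENNReal.natCast_ne_top _)]
  exact (Finset.sum_le_card_nsmul _ _ _ hR).trans_eq (nsmul_eq_mul _ _)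

lemma enorm_mul_volume_le (hN : IsSubdivision k d N) (hN_pos : 0 < N) (hh : 0 < h)
    (hS : SamplesSubBoxes c h S p) (hG : ContDiff ℝ k G) (hx : x ∈ box c h) {R : ℝ≥0∞}
    (hR : ∀ q ∈ box c h, ∫⁻ y in box c h, ‖G q - taylorPoly k G y q‖ₑ ≤ R) :
    ‖G x‖ₑ * volume (box c h)
      ≤ ENNReal.ofReal (2 * meanSum S p G) * volume (box c h) + (1 + 2 * (N : ℝ≥0∞) ^ d) * R := by
  have hmeas : ∀ q, Measurable fun y => G q - taylorPoly k G y q := fun q =>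
    (continuous_const.sub (continuous_taylorPoly_left hG q)).measurable
  have hmeas_mean : ∀ z, Measurable fun y =>
      ENNReal.ofReal (𝔼 τ ∈ S z, |G (p τ) - taylorPoly k G y (p τ)|) := fun z => by
    simp only [Finset.expect_eq_sum_div_card]
    have := fun τ => hmeas (p τ)
    fun_prop
  have hpoint : ∀ y, ‖G x‖ₑ ≤ ‖G x - taylorPoly k G y x‖ₑ + (ENNReal.ofReal (2 * meanSum S p G) +
      2 * ∑ z, ENNReal.ofReal (𝔼 τ ∈ S z, |G (p τ) - taylorPoly k G y (p τ)|)) := by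
    intro y
    have hmean_nonneg : ∀ z, 0 ≤ 𝔼 τ ∈ S z, |G (p τ) - taylorPoly k G y (p τ)| := fun z =>
      Finset.expect_nonneg fun _ _ => abs_nonneg _
    have hmeanSum := meanSum_nonneg S p G
    rw [← ENNReal.ofReal_sum_of_nonneg fun z _ => hmean_nonneg z, ← ENNReal.ofReal_ofNat 2,
      ← ENNReal.ofReal_mul zero_le_two, ← ENNReal.ofReal_add (by positivity)
        (mul_nonneg zero_le_two (Finset.sum_nonneg fun z _ => hmean_nonneg z)),
      Real.enorm_eq_ofReal_abs, Real.enorm_eq_ofReal_abs]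
    exact (ENNReal.ofReal_le_ofReal
      (abs_le_abs_sub_taylorPoly_add hN hN_pos hh hS G y hx)).trans ENNReal.ofReal_add_le
  calc ‖G x‖ₑ * volume (box c h) = ∫⁻ _y in box c h, ‖G x‖ₑ := (setLIntegral_const _ _).symm
    _ ≤ ∫⁻ y in box c h, _ := lintegral_mono hpoint
    _ = (∫⁻ y in box c h, ‖G x - taylorPoly k G y x‖ₑ) +
        (ENNReal.ofReal (2 * meanSum S p G) * volume (box c h) + 2 * ∑ z, ∫⁻ y in box c h,
          ENNReal.ofReal (𝔼 τ ∈ S z, |G (p τ) - taylorPoly k G y (p τ)|)) := by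
        rw [lintegral_add_left (hmeas x).enorm, lintegral_add_left measurable_const,
          setLIntegral_const, lintegral_const_mul _ (by fun_prop),
          lintegral_finsetSum _ fun z _ => hmeas_mean z]
    _ ≤ R + (ENNReal.ofReal (2 * meanSum S p G) * volume (box c h) +
        2 * ∑ _z : Fin d → Fin N, R) := by
        gcongr with z
        · exact hR x hx
        · exact lintegral_ofReal_expect_abs_le (hS z).1 (fun τ _ => hmeas (p τ)) fun τ hτ =>
            hR _ (subBox_subset hh.le z ((hS z).2 τ hτ))
    _ = _ := by
        simp only [Finset.sum_const, Finset.card_univ, Fintype.card_fun, Fintype.card_fin,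
          nsmul_eq_mul, Nat.cast_pow]
        ring

lemma volume_box_eq_ofReal_rpow (hh : 0 < h) (c : Fin d → ℝ) (s : ℝ) :
    volume (box c h) ^ s = ENNReal.ofReal (h ^ (d * s)) := by
  rw [volume_box, ← ENNReal.rpow_natCast, ENNReal.ofReal_rpow_of_pos hh,
    ENNReal.ofReal_rpow_of_pos (by positivity), ← Real.rpow_mul hh.le]

lemma enorm_le_meanSum_add (hk : 0 < k) (hN : IsSubdivision k d N) (hN_pos : 0 < N) (hh : 0 < h)
    (hS : SamplesSubBoxes c h S p) (hG : ContDiff ℝ k G) (hx : x ∈ box c h) :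
    ‖G x‖ₑ ≤ ENNReal.ofReal (2 * meanSum S p G) + (1 + 2 * (N : ℝ≥0∞) ^ d) * taylorConst k d *
      ENNReal.ofReal (h ^ ((k : ℝ) - d / 2)) *
        eLpNorm (absDeriv k G) 2 (volume.restrict (box c h)) := by
  have hvol_ne_zero : volume (box c h) ≠ 0 := by
    rw [volume_box]
    exact (ENNReal.pow_pos (ENNReal.ofReal_pos.2 hh) d).ne'
  have hvol_ne_top : volume (box c h) ≠ ⊤ := by
    rw [volume_box]
    finiteness
  have hpow : ENNReal.ofReal (h ^ k) * volume (box c h) ^ (1 / 2 : ℝ)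
      = ENNReal.ofReal (h ^ ((k : ℝ) - d / 2)) * volume (box c h) := by
    rw [← ENNReal.rpow_one (volume (box c h)), ← ENNReal.rpow_mul,
      volume_box_eq_ofReal_rpow hh, volume_box_eq_ofReal_rpow hh,
      ← ENNReal.ofReal_mul (by positivity), ← ENNReal.ofReal_mul (by positivity),
      ← Real.rpow_natCast, ← Real.rpow_add hh, ← Real.rpow_add hh]
    congr 2
    ring
  rw [← ENNReal.mul_le_mul_iff_left hvol_ne_zero hvol_ne_top]
  refine (enorm_mul_volume_le hN hN_pos hh hS hG hx fun q hq =>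
    lintegral_enorm_sub_taylorPoly_le hk hG (measurableSet_box c h) (convex_box c h)
      (fun x hx y hy => norm_sub_le_of_mem_box hh.le hx hy) hq).trans_eq ?_
  rw [mul_left_comm (taylorConst k d), ← mul_assoc (ENNReal.ofReal (h ^ k)), hpow]
  ring

/-- The energy of `g` in the set `Q`, i.e. the part of `‖D^k g‖²` in `Q`. -/
def localEnergy (k : ℕ) (g : (Fin d → ℝ) → ℝ) (Q : Set (Fin d → ℝ)) : ℝ≥0∞ :=
  ∑ i : Fin k → Fin d, ∫⁻ y in Q, ‖weakDeriv i g y‖ₑ ^ 2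

lemma localEnergy_mono (g : (Fin d → ℝ) → ℝ) {Q Q' : Set (Fin d → ℝ)} (h : Q ⊆ Q') :
    localEnergy k g Q ≤ localEnergy k g Q' :=
  Finset.sum_le_sum fun _ _ => lintegral_mono_set h

lemma localEnergy_unitCube (hg : MemHk0 k g) :
    localEnergy k g (unitCube d) = ENNReal.ofReal (normHk k g ^ 2) := by
  rw [normHk_sq, innerHk, localEnergy,
    ENNReal.ofReal_sum_of_nonneg fun _ _ => integral_nonneg fun _ => mul_self_nonneg _]
  refine Finset.sum_congr rfl fun i _ => ?_
  rw [ofReal_integral_eq_lintegral_ofReal (hg.integrable_mul_weakDeriv hg i)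
    (Eventually.of_forall fun _ => mul_self_nonneg _)]
  refine lintegral_congr fun x => ?_
  rw [Real.enorm_eq_ofReal_abs, ← ENNReal.ofReal_pow (abs_nonneg _), sq_abs, sq]

lemma localEnergy_le_ofReal (hg : MemHk0 k g) {Q : Set (Fin d → ℝ)} (hQ : Q ⊆ unitCube d) :
    localEnergy k g Q ≤ ENNReal.ofReal (normHk k g ^ 2) :=
  localEnergy_unitCube hg ▸ localEnergy_mono g hQ

lemma localEnergy_ne_top (hg : MemHk0 k g) {Q : Set (Fin d → ℝ)} (hQ : Q ⊆ unitCube d) :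
    localEnergy k g Q ≠ ⊤ :=
  ne_top_of_le_ne_top ENNReal.ofReal_ne_top (localEnergy_le_ofReal hg hQ)

lemma eLpNorm_weakDeriv_le (i : Fin k → Fin d) (g : (Fin d → ℝ) → ℝ) (Q : Set (Fin d → ℝ)) :
    eLpNorm (weakDeriv i g) 2 (volume.restrict Q) ≤ localEnergy k g Q ^ (1 / 2 : ℝ) := by
  rw [eLpNorm_two_eq_rpow_lintegral]
  exact ENNReal.rpow_le_rpow (Finset.single_le_sum (f := fun i : Fin k → Fin d =>
    ∫⁻ y in Q, ‖weakDeriv i g y‖ₑ ^ 2) (fun _ _ => zero_le) (Finset.mem_univ i)) one_half_pos.le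

lemma eLpNorm_absDeriv_le (hG : ContDiff ℝ k G) (hg : MemHk0 k g) {Q : Set (Fin d → ℝ)}
    (hQ : Q ⊆ unitCube d) :
    eLpNorm (absDeriv k G) 2 (volume.restrict Q)
      ≤ (∑ i : Fin k → Fin d,
          eLpNorm (fun x => partialDeriv i G x - weakDeriv i g x) 2 (torusMeasure d))
        + (d : ℝ≥0∞) ^ k * localEnergy k g Q ^ (1 / 2 : ℝ) := by
  have hle : volume.restrict Q ≤ torusMeasure d := Measure.restrict_mono hQ le_rfl
  have hmeas_weak : ∀ i : Fin k → Fin d,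
      AEStronglyMeasurable (weakDeriv i g) (volume.restrict Q) := fun i =>
    (hg.isWeakDeriv le_rfl i).1.1.mono_measure hle
  have hmeas : ∀ i : Fin k → Fin d,
      AEStronglyMeasurable (partialDeriv i G) (volume.restrict Q) := fun i =>
    (continuous_partialDeriv i hG).aestronglyMeasurable
  have hderiv : ∀ i : Fin k → Fin d, eLpNorm (partialDeriv i G) 2 (volume.restrict Q)
      ≤ eLpNorm (fun x => partialDeriv i G x - weakDeriv i g x) 2 (torusMeasure d)
        + localEnergy k g Q ^ (1 / 2 : ℝ) := fun i =>
    calc eLpNorm (partialDeriv i G) 2 (volume.restrict Q)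
        = eLpNorm ((partialDeriv i G - weakDeriv i g) + weakDeriv i g) 2 (volume.restrict Q) := by
          rw [sub_add_cancel]
      _ ≤ _ := eLpNorm_add_le ((hmeas i).sub (hmeas_weak i)) (hmeas_weak i) one_le_two
      _ ≤ _ := add_le_add (eLpNorm_mono_measure _ hle) (eLpNorm_weakDeriv_le i g Q)
  calc eLpNorm (absDeriv k G) 2 (volume.restrict Q)
      = eLpNorm (∑ i : Fin k → Fin d, fun x => ‖partialDeriv i G x‖) 2 (volume.restrict Q) := by
        congr 1
        funext x
        simp [absDeriv]
    _ ≤ ∑ i : Fin k → Fin d, eLpNorm (fun x => ‖partialDeriv i G x‖) 2 (volume.restrict Q) :=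
        eLpNorm_sum_le (fun i _ => (hmeas i).norm) one_le_two
    _ ≤ ∑ i : Fin k → Fin d,
          (eLpNorm (fun x => partialDeriv i G x - weakDeriv i g x) 2 (torusMeasure d)
            + localEnergy k g Q ^ (1 / 2 : ℝ)) :=
        Finset.sum_le_sum fun i _ => (eLpNorm_norm _).trans_le (hderiv i)
    _ = _ := by
        rw [Finset.sum_add_distrib]
        simp

lemma MemHk0.enorm_le_meanSum_add (hk : (d : ℝ) / 2 < k) (hN : IsSubdivision k d N)
    (hN_pos : 0 < N) (hg : MemHk0 k g) (hh : 0 < h) (hQ : box c h ⊆ unitCube d)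
    (hS : SamplesSubBoxes c h S p) (hx : x ∈ box c h) :
    ‖g x‖ₑ ≤ ENNReal.ofReal (2 * meanSum S p g) + (1 + 2 * (N : ℝ≥0∞) ^ d) * taylorConst k d *
      ENNReal.ofReal (h ^ ((k : ℝ) - d / 2)) *
        ((d : ℝ≥0∞) ^ k * localEnergy k g (box c h) ^ (1 / 2 : ℝ)) := by
  have hk_pos : 0 < k := by exact_mod_cast (show (0 : ℝ) ≤ d / 2 by positivity).trans_lt hk
  have hlim : ∀ x, Tendsto (fun F => trigPoly (fourierCoef g) F x) atTop (nhds (g x)) :=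
    hg.tendsto_trigPoly hk
  have hlim_mean : Tendsto (fun F => ENNReal.ofReal (2 * meanSum S p (trigPoly (fourierCoef g) F)))
      atTop (nhds (ENNReal.ofReal (2 * meanSum S p g))) :=
    ENNReal.tendsto_ofReal ((tendsto_meanSum hlim).const_mul 2)
  have hlim_energy : Tendsto (fun F => (∑ i : Fin k → Fin d, eLpNorm (fun x =>
        partialDeriv i (trigPoly (fourierCoef g) F) x - weakDeriv i g x) 2 (torusMeasure d))
        + (d : ℝ≥0∞) ^ k * localEnergy k g (box c h) ^ (1 / 2 : ℝ)) atTop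
      (nhds ((d : ℝ≥0∞) ^ k * localEnergy k g (box c h) ^ (1 / 2 : ℝ))) := by
    simpa using (tendsto_finsetSum Finset.univ fun i _ =>
      hg.tendsto_partialDeriv_trigPoly i).add_const _
  have hconst : (1 + 2 * (N : ℝ≥0∞) ^ d) * taylorConst k d *
      ENNReal.ofReal (h ^ ((k : ℝ) - d / 2)) ≠ ⊤ := by
    have := taylorConst_ne_top hk
    finiteness
  refine le_of_tendsto_of_tendsto' (hlim x).enorm
    (hlim_mean.add (ENNReal.Tendsto.const_mul hlim_energy (Or.inr hconst))) fun F => ?_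
  have hsmooth : ContDiff ℝ k (trigPoly (fourierCoef g) F) := contDiff_trigPoly _ _ _
  refine (MIND.enorm_le_meanSum_add hk_pos hN hN_pos hh hS hsmooth hx).trans ?_
  gcongr
  exact eLpNorm_absDeriv_le hsmooth hg hQ

lemma MemHk0.exists_abs_le_meanSum_add (hk : (d : ℝ) / 2 < k) (hN : IsSubdivision k d N)
    (hN_pos : 0 < N) : ∃ C : ℝ, 0 ≤ C ∧ ∀ {ι : Type} {S : (Fin d → Fin N) → Finset ι}
      {p : ι → Fin d → ℝ} {g : (Fin d → ℝ) → ℝ} {c x : Fin d → ℝ} {h : ℝ}, MemHk0 k g → 0 < h →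
      box c h ⊆ unitCube d → SamplesSubBoxes c h S p → x ∈ box c h →
      |g x| ≤ 2 * meanSum S p g +
        C * (h ^ ((k : ℝ) - d / 2) * √(localEnergy k g (box c h)).toReal) := by
  have hconst : (1 + 2 * (N : ℝ≥0∞) ^ d) * taylorConst k d * (d : ℝ≥0∞) ^ k ≠ ⊤ := by
    have := taylorConst_ne_top hk
    finiteness
  refine ⟨((1 + 2 * (N : ℝ≥0∞) ^ d) * taylorConst k d * (d : ℝ≥0∞) ^ k).toReal,
    ENNReal.toReal_nonneg, fun {ι S p g c x h} hg hh hQ hS hx => ?_⟩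
  have hmean := meanSum_nonneg S p g
  have henergy : localEnergy k g (box c h) ^ (1 / 2 : ℝ)
      = ENNReal.ofReal √(localEnergy k g (box c h)).toReal := by
    rw [Real.sqrt_eq_rpow, ← ENNReal.ofReal_rpow_of_nonneg ENNReal.toReal_nonneg one_half_pos.le,
      ENNReal.ofReal_toReal (localEnergy_ne_top hg hQ)]
  rw [← ENNReal.ofReal_le_ofReal_iff (by positivity), ← Real.enorm_eq_ofReal_abs,
    ENNReal.ofReal_add (by positivity) (by positivity), ENNReal.ofReal_mul ENNReal.toReal_nonneg,
    ENNReal.ofReal_toReal hconst, ENNReal.ofReal_mul (p := h ^ ((k : ℝ) - d / 2)) (by positivity),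
    ← henergy]
  refine (hg.enorm_le_meanSum_add hk hN hN_pos hh hQ hS hx).trans_eq ?_
  ring

end Samples

/-- The indices `τ` with `(ab l).1 ≤ τ l < (ab l).2` for all `l`. -/
def indexBox (ab : Fin d → Fin (m + 1) × Fin (m + 1)) : Finset (Fin d → Fin m) :=
  Fintype.piFinset fun l => (Finset.Ico ((ab l).1 : ℕ) (ab l).2).attachFin fun _ hi =>
    (Finset.mem_Ico.1 hi).2.trans_le (Nat.le_of_lt_succ (ab l).2.2)

lemma mem_indexBox {ab : Fin d → Fin (m + 1) × Fin (m + 1)} {τ : Fin d → Fin m} :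
    τ ∈ indexBox ab ↔ ∀ l, ((ab l).1 : ℕ) ≤ τ l ∧ (τ l : ℕ) < (ab l).2 := by
  simp [indexBox]

lemma card_indexBox (ab : Fin d → Fin (m + 1) × Fin (m + 1)) :
    (indexBox ab).card = ∏ l, (((ab l).2 : ℕ) - (ab l).1) := by
  simp [indexBox]

lemma ceil_mul_lt_succ (m : ℕ) {u : ℝ} (hu : u ≤ 1) : ⌈m * u⌉₊ < m + 1 :=
  Nat.lt_succ_of_le (Nat.ceil_le.2 (mul_le_of_le_one_right m.cast_nonneg hu))

/-- The bounds, in each coordinate, of the indices of the grid points in `B`. -/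
def gridBounds (m : ℕ) (B : Cube d) : Fin d → Fin (m + 1) × Fin (m + 1) := fun l =>
  (⟨⌈m * B.corner l⌉₊,
      ceil_mul_lt_succ m (by linarith [B.corner_add_side_le l, B.side_pos])⟩,
    ⟨⌈m * (B.corner l + B.side)⌉₊, ceil_mul_lt_succ m (B.corner_add_side_le l)⟩)

lemma mem_gridIn {B : Cube d} {τ : Fin d → Fin m} :
    τ ∈ gridIn m B ↔ gridPoint τ ∈ B.toSet := by
  classical
  simp [gridIn]

lemma gridIn_eq_indexBox (m : ℕ) (B : Cube d) : gridIn m B = indexBox (gridBounds m B) := by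
  ext τ
  rw [mem_gridIn, mem_indexBox, Cube.toSet, Set.mem_univ_pi]
  refine forall_congr' fun l => ?_
  have hm : (0 : ℝ) < m := by exact_mod_cast (τ l).pos
  rw [Set.mem_Ico, gridPoint, gridBounds, Nat.ceil_le, Nat.lt_ceil, le_div_iff₀ hm,
    div_lt_iff₀ hm, mul_comm (B.corner l), mul_comm (B.corner l + B.side)]

lemma half_pow_le_card_gridIn {B : Cube d} (hB : 1 ≤ m * B.side) :
    (m * B.side / 2) ^ d ≤ ((gridIn m B).card : ℝ) := by
  rw [gridIn_eq_indexBox, card_indexBox, Nat.cast_prod, ← Fin.prod_const]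
  refine Finset.prod_le_prod (fun _ _ => by linarith) fun l _ => ?_
  have hlower := Nat.ceil_lt_add_one (mul_nonneg m.cast_nonneg (B.corner_nonneg l))
  have hupper := Nat.le_ceil (m * (B.corner l + B.side))
  have hlt : ⌈m * B.corner l⌉₊ < ⌈m * (B.corner l + B.side)⌉₊ :=
    Nat.lt_ceil.2 (by linarith)
  have hone : (⌈m * B.corner l⌉₊ : ℝ) + 1 ≤ ⌈m * (B.corner l + B.side)⌉₊ := by exact_mod_cast hlt
  rw [gridBounds, Nat.cast_sub hlt.le]
  linarith

lemma IsNormal.exists_subset (hd : 0 < d) {𝓑 : Set (Cube d)} (h𝓑 : IsNormal 𝓑) :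
    ∃ a : ℝ, 1 < a ∧ ∀ B : Cube d, ∃ B' ∈ 𝓑, B'.toSet ⊆ B.toSet ∧ B.side / a ≤ B'.side := by
  obtain ⟨a, ha, hvol⟩ := h𝓑
  refine ⟨a, ha, fun B => ?_⟩
  obtain ⟨B', hB', hsub, hB'_vol⟩ := hvol B
  refine ⟨B', hB', hsub, le_of_pow_le_pow_left₀ hd.ne' B'.side_pos.le ?_⟩
  calc (B.side / a) ^ d = B.vol / a ^ d := div_pow _ _ _
    _ ≤ B.vol / a := div_le_div_of_nonneg_left (pow_nonneg B.side_pos.le d) (by positivity)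
        (le_self_pow₀ ha.le hd.ne')
    _ ≤ B'.side ^ d := hB'_vol

lemma abs_expect_gridIn_le {𝓑 : Set (Cube d)} {B : Cube d} {g : (Fin d → ℝ) → ℝ} {ρ s : ℝ}
    (hρ : 0 ≤ ρ) (hmr : mrNorm 𝓑 (sample m g) ≤ ρ * (m : ℝ) ^ ((d : ℝ) / 2)) (hB : B ∈ 𝓑)
    (hs : 0 < s) (hms : 1 ≤ m * s) (hsB : s ≤ B.side) :
    |(𝔼 τ ∈ gridIn m B, g (gridPoint τ))| ≤ ρ * (s / 2) ^ (-((d : ℝ) / 2)) := by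
  have hm : (0 : ℝ) < m := pos_of_mul_pos_left (one_pos.trans_le hms) hs.le
  have hcard : (m * (s / 2)) ^ d ≤ ((gridIn m B).card : ℝ) :=
    calc (m * (s / 2)) ^ d ≤ (m * B.side / 2) ^ d := by
          rw [mul_div_assoc]
          gcongr
      _ ≤ _ := half_pow_le_card_gridIn (hms.trans (by gcongr))
  have hcard_pos : (0 : ℝ) < (gridIn m B).card := lt_of_lt_of_le (by positivity) hcard
  have hsqrt : (m * (s / 2)) ^ ((d : ℝ) / 2) ≤ √(gridIn m B).card := by
    rw [← mul_one_div (d : ℝ), Real.rpow_mul (by positivity), Real.rpow_natCast,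
      ← Real.sqrt_eq_rpow]
    exact Real.sqrt_le_sqrt hcard
  calc |(𝔼 τ ∈ gridIn m B, g (gridPoint τ))|
      = |∑ τ ∈ gridIn m B, sample m g τ| / (gridIn m B).card := by
        rw [Finset.expect_eq_sum_div_card, abs_div, Nat.abs_cast]
        rfl
    _ ≤ ρ * (m : ℝ) ^ ((d : ℝ) / 2) * √(gridIn m B).card / (gridIn m B).card := by
        gcongr
        exact abs_sum_gridIn_le hmr hB
    _ = ρ * (m : ℝ) ^ ((d : ℝ) / 2) / √(gridIn m B).card := by
        rw [mul_div_assoc, Real.sqrt_div_self', mul_one_div]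
    _ ≤ ρ * (m : ℝ) ^ ((d : ℝ) / 2) / (m * (s / 2)) ^ ((d : ℝ) / 2) := by gcongr
    _ = ρ * (s / 2) ^ (-((d : ℝ) / 2)) := by
        rw [Real.mul_rpow hm.le (by positivity), Real.rpow_neg (by positivity)]
        field_simp

lemma exists_mem_subset_subBox {𝓑 : Set (Cube d)} {a : ℝ}
    (h𝓑 : ∀ B : Cube d, ∃ B' ∈ 𝓑, B'.toSet ⊆ B.toSet ∧ B.side / a ≤ B'.side) (hN : 0 < N)
    (hh : 0 < h) (hh_le : h ≤ 1) (hc : ∀ l, 0 ≤ c l) (hch : ∀ l, c l + h ≤ 1)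
    (z : Fin d → Fin N) :
    ∃ B ∈ 𝓑, B.toSet ⊆ box (subCorner c h z) (h / N) ∧ h / N / a ≤ B.side :=
  h𝓑 { corner := subCorner c h z
       side := h / N
       side_pos := by positivity
       side_le_one := (div_le_self hh.le (by exact_mod_cast hN)).trans hh_le
       corner_nonneg := fun l => (hc l).trans (le_subCorner hh.le c z l)
       corner_add_side_le := fun l => (subCorner_add_le hh.le c z l).trans (hch l) }

theorem IsNormal.exists_local_estimate {k : ℕ} (hd : 0 < d) (hk : (d : ℝ) / 2 < k)
    {𝓑 : Set (Cube d)} (h𝓑 : IsNormal 𝓑) :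
    ∃ C > 0, ∃ K > 0, ∀ {m : ℕ} {g : (Fin d → ℝ) → ℝ} {ρ : ℝ}, MemHk0 k g → 0 ≤ ρ →
      mrNorm 𝓑 (sample m g) ≤ ρ * (m : ℝ) ^ ((d : ℝ) / 2) →
      ∀ {c : Fin d → ℝ} {h : ℝ}, 0 < h → (∀ l, 0 ≤ c l) → (∀ l, c l + h ≤ 1) → K ≤ m * h →
        ∀ x ∈ box c h, |g x| ≤ C * (ρ * h ^ (-((d : ℝ) / 2)) +
          h ^ ((k : ℝ) - d / 2) * √(localEnergy k g (box c h)).toReal) := by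
  obtain ⟨N, hN_pos, hN⟩ := exists_isSubdivision k d
  obtain ⟨a, ha, h𝓑'⟩ := h𝓑.exists_subset hd
  obtain ⟨C, hC, hlocal⟩ := MemHk0.exists_abs_le_meanSum_add hk hN hN_pos
  have : (0 : ℝ) < N := by exact_mod_cast hN_pos
  set b : ℝ := (2 * N * a)⁻¹ with hb
  refine ⟨2 * (N ^ d * b ^ (-((d : ℝ) / 2))) + C, by positivity, N * a, by positivity, ?_⟩
  intro m g ρ hg hρ hmr c h hh hc hch hmh x hx
  have hh_le : h ≤ 1 := (le_add_of_nonneg_left (hc ⟨0, hd⟩)).trans (hch ⟨0, hd⟩)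
  choose B hB hB_sub hB_side using exists_mem_subset_subBox h𝓑' hN_pos hh hh_le hc hch
  have hside : 1 ≤ m * (h / N / a) := by
    rwa [div_div, ← mul_div_assoc, one_le_div (by positivity)]
  have hmean : ∀ z, |(𝔼 τ ∈ gridIn m (B z), g (gridPoint τ))|
      ≤ ρ * (b ^ (-((d : ℝ) / 2)) * h ^ (-((d : ℝ) / 2))) := fun z => by
    refine (abs_expect_gridIn_le hρ hmr (hB z) (by positivity) hside (hB_side z)).trans_eq ?_
    rw [← Real.mul_rpow (by positivity) hh.le, hb]
    congr 2
    field_simp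
  have hsamples : SamplesSubBoxes c h (fun z => gridIn m (B z)) gridPoint := fun z => by
    refine ⟨Finset.card_pos.1 ?_, fun τ hτ => hB_sub z (mem_gridIn.1 hτ)⟩
    have hB_one : 1 ≤ m * (B z).side :=
      hside.trans (mul_le_mul_of_nonneg_left (hB_side z) m.cast_nonneg)
    have hcard_pos : (0 : ℝ) < (gridIn m (B z)).card :=
      lt_of_lt_of_le (by positivity) (half_pow_le_card_gridIn hB_one)
    exact_mod_cast hcard_pos
  have hmeanSum : meanSum (fun z => gridIn m (B z)) gridPoint g
      ≤ N ^ d * b ^ (-((d : ℝ) / 2)) * (ρ * h ^ (-((d : ℝ) / 2))) := by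
    refine (Finset.sum_le_sum fun z _ => hmean z).trans_eq ?_
    simp only [Finset.sum_const, Finset.card_univ, Fintype.card_fun, Fintype.card_fin,
      nsmul_eq_mul, Nat.cast_pow]
    ring
  refine (hlocal hg hh (box_subset_unitCube hc hch) hsamples hx).trans ?_
  have hcross : 0 ≤ C * (ρ * h ^ (-((d : ℝ) / 2))) := by positivity
  have hcross' : 0 ≤ N ^ d * b ^ (-((d : ℝ) / 2)) *
    (h ^ ((k : ℝ) - d / 2) * √(localEnergy k g (box c h)).toReal) := by positivity
  linarith

end LocalEstimate

/-! ### A stopping time argument on trees -/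

section Tree

variable {ι β : Type*} [Fintype β] {q a b x : ℝ}

lemma sum_add_le_of_forall_child {t e : β → ℝ} {e₀ : ℝ} (hq : 2 ≤ q) (ha : 0 ≤ a)
    (hb : b = Fintype.card β * (a * q)) (hx : 0 ≤ x) (he : ∀ i, 0 ≤ e i) (hsum : ∑ i, e i ≤ e₀)
    (hxe : x < e₀) (ht : ∀ i, t i ≤ a * (q * x) ∨ t i + b * (q * x) ≤ 2 * b * e i) :
    ∑ i, t i + b * x ≤ 2 * b * e₀ := by
  classical
  have hb_nonneg : 0 ≤ b := hb ▸ by positivity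
  have hax : 0 ≤ a * (q * x) := by positivity
  have hcard : ∑ _i : β, a * (q * x) = b * x := by
    rw [Finset.sum_const, Finset.card_univ, nsmul_eq_mul, hb]
    ring
  by_cases hbad : ∃ i, t i + b * (q * x) ≤ 2 * b * e i
  · obtain ⟨i₀, hi₀⟩ := hbad
    have ht' : ∀ i, t i ≤ 2 * b * e i + (a * (q * x) - if i = i₀ then b * (q * x) else 0) := by
      intro i
      have hei : 0 ≤ 2 * b * e i := mul_nonneg (by positivity) (he i)
      have hbx : 0 ≤ b * (q * x) := by positivity
      rcases eq_or_ne i i₀ with rfl | hi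
      · rw [if_pos rfl]
        linarith
      · rw [if_neg hi]
        rcases ht i with h | h <;> linarith
    have hsum_t : ∑ i, t i ≤ 2 * b * ∑ i, e i + (b * x - b * (q * x)) :=
      (Finset.sum_le_sum fun i _ => ht' i).trans_eq <| by
        rw [Finset.sum_add_distrib, Finset.sum_sub_distrib, hcard, Finset.sum_ite_eq',
          if_pos (Finset.mem_univ i₀), Finset.mul_sum]
    have hgain : b * (2 * x) ≤ b * (q * x) := by gcongr
    have henergy : 2 * b * ∑ i, e i ≤ 2 * b * e₀ := by gcongr
    linarith
  · have hsum_t : ∑ i, t i ≤ b * x :=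
      (Finset.sum_le_sum fun i _ => (ht i).resolve_right fun h => hbad ⟨i, h⟩).trans_eq hcard
    have henergy : b * x ≤ b * e₀ := by gcongr
    linarith

/-- `X (gen z) < E z` marks the nodes below which the tree is searched further. The term
`- b * X` gained at the first unmarked generation is what lets the induction absorb the unmarked
children of a marked node. -/
theorem tree_bound (child : ι → β → ι) (gen : ι → ℕ) (hgen : ∀ z i, gen (child z i) = gen z + 1)
    {T E : ι → ℝ} {X : ℕ → ℝ} {J : ℕ} (hq : 2 ≤ q) (ha : 0 ≤ a) (hX_nonneg : ∀ j, 0 ≤ X j)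
    (hX : ∀ j, X (j + 1) = q * X j) (hE_nonneg : ∀ z, 0 ≤ E z)
    (hE : ∀ z, ∑ i, E (child z i) ≤ E z) (hT : ∀ z, T z ≤ ∑ i, T (child z i))
    (hgood : ∀ z, gen z ≤ J → E z ≤ X (gen z) → T z ≤ a * X (gen z))
    (hlast : ∀ z, gen z = J → E z ≤ X J) (z : ι) (hz : gen z ≤ J) :
    T z ≤ (a + 2 * (Fintype.card β * (a * q))) * max (E z) (X (gen z)) := by
  obtain ⟨b, hb⟩ : ∃ b, b = Fintype.card β * (a * q) := ⟨_, rfl⟩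
  have hb_nonneg : 0 ≤ b := hb ▸ by positivity
  have hbad : ∀ i z, gen z + i = J → X (gen z) < E z → T z + b * X (gen z) ≤ 2 * b * E z := by
    intro i
    induction i with
    | zero =>
      intro z hz hlt
      rw [add_zero] at hz
      exact absurd (hlast z hz) (hz ▸ hlt).not_ge
    | succ i ih =>
      intro z hz hlt
      refine (add_le_add_left (hT z) _).trans (sum_add_le_of_forall_child hq ha hb (hX_nonneg _)
        (fun j => hE_nonneg _) (hE z) hlt fun j => ?_)
      rw [← hX, ← hgen z j]
      exact (le_or_gt (E (child z j)) (X (gen (child z j)))).imp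
        (hgood _ (by rw [hgen]; omega)) (ih _ (by rw [hgen]; omega))
  have hmax : 0 ≤ max (E z) (X (gen z)) := le_max_of_le_left (hE_nonneg z)
  rw [← hb, add_mul]
  rcases le_or_gt (E z) (X (gen z)) with hle | hlt
  · calc T z ≤ a * X (gen z) := hgood z hz hle
      _ ≤ a * max (E z) (X (gen z)) := by
          gcongr
          exact le_max_right _ _
      _ ≤ _ := le_add_of_nonneg_right (by positivity)
  · calc T z ≤ 2 * b * E z :=
          (le_add_of_nonneg_right (mul_nonneg hb_nonneg (hX_nonneg _))).trans
            (hbad (J - gen z) z (by omega) hlt)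
      _ ≤ 2 * b * max (E z) (X (gen z)) := by
          gcongr
          exact le_max_left _ _
      _ ≤ _ := le_add_of_nonneg_left (by positivity)

end Tree

/-! ### Dyadic cubes -/

section Dyadic

variable {d k : ℕ}

/-- The indices of the dyadic cubes in the unit cube: generation and position. -/
abbrev DyadicIndex (d : ℕ) : Type := Σ j : ℕ, Fin d → Fin (2 ^ j)

/-- The side of the dyadic cubes of generation `j`. -/
def dyadicSide (j : ℕ) : ℝ := ((2 : ℝ) ^ j)⁻¹

/-- The corner of the dyadic cube with index `z`. -/
def dyadicCorner (z : DyadicIndex d) : Fin d → ℝ := fun l => (z.2 l : ℕ) * dyadicSide z.1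

/-- The dyadic cube with index `z`. -/
def dyadicBox (z : DyadicIndex d) : Set (Fin d → ℝ) := box (dyadicCorner z) (dyadicSide z.1)

/-- The `2 ^ d` dyadic cubes of the next generation in the dyadic cube with index `z`. -/
def dyadicChild (z : DyadicIndex d) (b : Fin d → Fin 2) : DyadicIndex d :=
  ⟨z.1 + 1, fun l => ⟨2 * (z.2 l : ℕ) + (b l : ℕ), by
    rw [pow_succ]
    omega⟩⟩

lemma dyadicSide_pos (j : ℕ) : 0 < dyadicSide j :=
  inv_pos.2 (by positivity)

lemma dyadicSide_rpow_neg (j : ℕ) (s : ℝ) : dyadicSide j ^ (-s) = ((2 : ℝ) ^ j) ^ s := by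
  rw [dyadicSide, Real.inv_rpow (by positivity), Real.rpow_neg (by positivity), inv_inv]

lemma mem_dyadicBox {z : DyadicIndex d} {x : Fin d → ℝ} :
    x ∈ dyadicBox z ↔ ∀ l, 0 ≤ x l ∧ ⌊x l * 2 ^ z.1⌋₊ = (z.2 l : ℕ) := by
  have hpow : (0 : ℝ) < 2 ^ z.1 := by positivity
  rw [dyadicBox, mem_box]
  refine forall_congr' fun l => ?_
  rw [dyadicCorner, dyadicSide, ← add_one_mul, ← div_eq_mul_inv, ← div_eq_mul_inv,
    div_le_iff₀ hpow, lt_div_iff₀ hpow]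
  constructor
  · rintro ⟨hlower, hupper⟩
    have hx : 0 ≤ x l := nonneg_of_mul_nonneg_left ((Nat.cast_nonneg _).trans hlower) hpow
    exact ⟨hx, (Nat.floor_eq_iff (by positivity)).2 ⟨hlower, hupper⟩⟩
  · rintro ⟨hx, hfloor⟩
    exact (Nat.floor_eq_iff (by positivity)).1 hfloor

lemma floor_mul_two_pow_succ_div_two (u : ℝ) (j : ℕ) :
    ⌊u * 2 ^ (j + 1)⌋₊ / 2 = ⌊u * 2 ^ j⌋₊ := by
  rw [← Nat.floor_div_ofNat, pow_succ, ← mul_assoc, mul_div_cancel_right₀ _ two_ne_zero]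

lemma dyadicBox_eq_iUnion (z : DyadicIndex d) :
    dyadicBox z = ⋃ b, dyadicBox (dyadicChild z b) := by
  ext x
  simp only [Set.mem_iUnion, mem_dyadicBox, dyadicChild]
  constructor
  · intro hx
    refine ⟨fun l => ⟨⌊x l * 2 ^ (z.1 + 1)⌋₊ % 2, Nat.mod_lt _ two_pos⟩, fun l => ⟨(hx l).1, ?_⟩⟩
    have hhalf := (floor_mul_two_pow_succ_div_two (x l) z.1).trans (hx l).2
    rw [← hhalf]
    exact (Nat.div_add_mod _ 2).symm
  · rintro ⟨b, hx⟩ l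
    refine ⟨(hx l).1, ?_⟩
    rw [← floor_mul_two_pow_succ_div_two, (hx l).2]
    omega

lemma pairwise_disjoint_dyadicChild (z : DyadicIndex d) :
    Pairwise (Function.onFun Disjoint fun b => dyadicBox (dyadicChild z b)) := by
  refine fun b b' hb => Set.disjoint_left.2 fun x hx hx' => hb (funext fun l => Fin.ext ?_)
  have hfloor := (mem_dyadicBox.1 hx l).2
  have hfloor' := (mem_dyadicBox.1 hx' l).2
  simp only [dyadicChild] at hfloor hfloor'
  omega

lemma lintegral_dyadicBox (z : DyadicIndex d) (F : (Fin d → ℝ) → ℝ≥0∞) :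
    ∫⁻ x in dyadicBox z, F x = ∑ b, ∫⁻ x in dyadicBox (dyadicChild z b), F x := by
  rw [dyadicBox_eq_iUnion, lintegral_iUnion (s := fun b => dyadicBox (dyadicChild z b))
    (fun b => measurableSet_box _ _) (pairwise_disjoint_dyadicChild z), tsum_fintype]

lemma localEnergy_dyadicBox (g : (Fin d → ℝ) → ℝ) (z : DyadicIndex d) :
    localEnergy k g (dyadicBox z) = ∑ b, localEnergy k g (dyadicBox (dyadicChild z b)) := by
  simp only [localEnergy]
  rw [Finset.sum_comm]
  exact Finset.sum_congr rfl fun i _ => lintegral_dyadicBox z _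

lemma dyadicCorner_nonneg (z : DyadicIndex d) (l : Fin d) : 0 ≤ dyadicCorner z l :=
  mul_nonneg (Nat.cast_nonneg _) (dyadicSide_pos _).le

lemma dyadicCorner_add_le (z : DyadicIndex d) (l : Fin d) :
    dyadicCorner z l + dyadicSide z.1 ≤ 1 := by
  rw [dyadicCorner, dyadicSide, ← add_one_mul, ← div_eq_mul_inv, div_le_one (by positivity)]
  exact_mod_cast (z.2 l).2

lemma dyadicBox_subset (z : DyadicIndex d) : dyadicBox z ⊆ unitCube d :=
  box_subset_unitCube (dyadicCorner_nonneg z) (dyadicCorner_add_le z)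

lemma exists_mem_dyadicBox {x : Fin d → ℝ} (hx : x ∈ unitCube d) (J : ℕ) :
    ∃ z : DyadicIndex d, z.1 = J ∧ x ∈ dyadicBox z := by
  have hx' : ∀ l, 0 ≤ x l ∧ x l < 1 := fun l => hx l (Set.mem_univ l)
  refine ⟨⟨J, fun l => ⟨⌊x l * 2 ^ J⌋₊, ?_⟩⟩, rfl, mem_dyadicBox.2 fun l => ⟨(hx' l).1, rfl⟩⟩
  rw [Nat.floor_lt (mul_nonneg (hx' l).1 (by positivity))]
  push_cast
  exact mul_lt_of_lt_one_left (by positivity) (hx' l).2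

/-- The index of the unit cube. -/
def dyadicRoot (d : ℕ) : DyadicIndex d := ⟨0, fun _ => 0⟩

lemma dyadicBox_dyadicRoot : dyadicBox (dyadicRoot d) = unitCube d := by
  simp [dyadicBox, dyadicRoot, box, dyadicCorner, dyadicSide, unitCube]

/-- The energy of `g` in a dyadic cube, as a real number. -/
def cubeEnergy (k : ℕ) (g : (Fin d → ℝ) → ℝ) (z : DyadicIndex d) : ℝ :=
  (localEnergy k g (dyadicBox z)).toReal

variable {g : (Fin d → ℝ) → ℝ} {D : ℝ}

lemma sum_cubeEnergy_dyadicChild (hg : MemHk0 k g) (z : DyadicIndex d) :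
    ∑ b, cubeEnergy k g (dyadicChild z b) = cubeEnergy k g z := by
  simp only [cubeEnergy]
  rw [localEnergy_dyadicBox, ENNReal.toReal_sum fun b _ =>
    localEnergy_ne_top hg (dyadicBox_subset (dyadicChild z b))]

lemma cubeEnergy_le_sq (hg : MemHk0 k g) (hD : normHk k g ≤ D) (z : DyadicIndex d) :
    cubeEnergy k g z ≤ D ^ 2 :=
  (ENNReal.toReal_le_of_le_ofReal (sq_nonneg _)
    (localEnergy_le_ofReal hg (dyadicBox_subset z))).trans
      (pow_le_pow_left₀ (normHk_nonneg g) hD 2)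

lemma lintegral_dyadicBox_rpow_le {M p : ℝ} (hM : 0 ≤ M) (hp : 0 ≤ p) {z : DyadicIndex d}
    (hg : ∀ x ∈ dyadicBox z, |g x| ≤ M) :
    ∫⁻ x in dyadicBox z, ‖g x‖ₑ ^ p ≤ ENNReal.ofReal (M ^ p * dyadicSide z.1 ^ d) :=
  calc ∫⁻ x in dyadicBox z, ‖g x‖ₑ ^ p ≤ ∫⁻ _x in dyadicBox z, ENNReal.ofReal M ^ p :=
        setLIntegral_mono' (measurableSet_box _ _) fun x hx => by
          rw [Real.enorm_eq_ofReal_abs]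
          gcongr
          exact hg x hx
    _ = _ := by
        rw [setLIntegral_const, dyadicBox, volume_box, ENNReal.ofReal_mul (by positivity),
          ENNReal.ofReal_rpow_of_nonneg hM hp, ENNReal.ofReal_pow (dyadicSide_pos _).le]

end Dyadic

/-! ### The interpolation inequality -/

section Interpolation

variable {d k J : ℕ} {g : (Fin d → ℝ) → ℝ} {B C D ρ : ℝ}

/-- The exponent up to which `ϑ(k, d, q)` does not depend on `q`. -/
def critExp (k d : ℕ) : ℝ := (4 * k + 2 * d) / d

/-- The energy up to which a dyadic cube of generation `j` counts as good. At this value the two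
terms of the local estimate agree. -/
def goodEnergy (k : ℕ) (ρ : ℝ) (j : ℕ) : ℝ := ρ ^ 2 * (4 ^ k) ^ j

lemma goodEnergy_eq_sq (k : ℕ) (ρ : ℝ) (j : ℕ) : goodEnergy k ρ j = (ρ * (2 ^ j) ^ k) ^ 2 := by
  rw [goodEnergy, show (4 : ℝ) = 2 ^ 2 by norm_num, mul_pow]
  congr 1
  rw [← pow_mul, ← pow_mul, ← pow_mul, ← pow_mul]
  congr 1
  ring

/-- On good dyadic cubes of generation at most `J` the function `g` is of the size that the
multiresolution norm alone predicts. -/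
def BoundedOnGoodCubes (k J : ℕ) (B ρ : ℝ) (g : (Fin d → ℝ) → ℝ) : Prop :=
  ∀ z : DyadicIndex d, z.1 ≤ J → cubeEnergy k g z ≤ goodEnergy k ρ z.1 →
    ∀ x ∈ dyadicBox z, |g x| ≤ B * (ρ * dyadicSide z.1 ^ (-((d : ℝ) / 2)))

lemma boundedOnGoodCubes_of_local_estimate (hC : 0 ≤ C) (hρ : 0 ≤ ρ)
    (hlocal : ∀ z : DyadicIndex d, z.1 ≤ J → ∀ x ∈ dyadicBox z,
      |g x| ≤ C * (ρ * dyadicSide z.1 ^ (-((d : ℝ) / 2)) +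
        dyadicSide z.1 ^ ((k : ℝ) - d / 2) * √(cubeEnergy k g z))) :
    BoundedOnGoodCubes k J (2 * C) ρ g := by
  intro z hz hgood x hx
  have hside := dyadicSide_pos z.1
  have hsqrt : √(cubeEnergy k g z) ≤ ρ * dyadicSide z.1 ^ (-(k : ℝ)) := by
    rw [dyadicSide_rpow_neg, Real.rpow_natCast, ← Real.sqrt_sq (by positivity : 0 ≤ ρ * _),
      ← goodEnergy_eq_sq]
    exact Real.sqrt_le_sqrt hgood
  calc |g x| ≤ C * (ρ * dyadicSide z.1 ^ (-((d : ℝ) / 2)) +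
          dyadicSide z.1 ^ ((k : ℝ) - d / 2) * (ρ * dyadicSide z.1 ^ (-(k : ℝ)))) := by
        refine (hlocal z hz x hx).trans ?_
        gcongr
    _ = 2 * C * (ρ * dyadicSide z.1 ^ (-((d : ℝ) / 2))) := by
        rw [mul_left_comm (dyadicSide z.1 ^ _), ← Real.rpow_add hside]
        ring_nf

lemma exists_generation (hk : k ≠ 0) (hρ : 0 < ρ) (hρD : ρ ≤ D) :
    ∃ J : ℕ, (2 : ℝ) ^ J ≤ 2 * (D / ρ) ^ (1 / k : ℝ) ∧ D ^ 2 ≤ goodEnergy k ρ J := by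
  have hratio : 1 ≤ D / ρ := (one_le_div hρ).2 hρD
  obtain ⟨n, hlower, hupper⟩ :=
    exists_nat_pow_near (Real.one_le_rpow hratio (by positivity : 0 ≤ (1 / k : ℝ))) one_lt_two
  refine ⟨n + 1, by rw [pow_succ]; linarith, ?_⟩
  have hD : D ≤ ρ * (2 ^ (n + 1)) ^ k := by
    have := pow_le_pow_left₀ (by positivity) hupper.le k
    rwa [one_div, Real.rpow_inv_natCast_pow (by positivity) hk, div_le_iff₀' hρ] at this
  rw [goodEnergy_eq_sq]
  exact pow_le_pow_left₀ (hρ.le.trans hρD) hD 2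

lemma dyadicSide_rpow_neg_le (hρ : 0 < ρ) (hD : 0 ≤ D)
    (hJ : (2 : ℝ) ^ J ≤ 2 * (D / ρ) ^ (1 / k : ℝ)) :
    dyadicSide J ^ (-((d : ℝ) / 2)) ≤ 2 ^ ((d : ℝ) / 2) * (D / ρ) ^ ((d : ℝ) / (2 * k)) :=
  calc dyadicSide J ^ (-((d : ℝ) / 2)) ≤ (2 * (D / ρ) ^ (1 / k : ℝ)) ^ ((d : ℝ) / 2) := by
        rw [dyadicSide_rpow_neg]
        gcongr
    _ = _ := by
        rw [Real.mul_rpow zero_le_two (by positivity), ← Real.rpow_mul (by positivity)]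
        ring_nf

lemma BoundedOnGoodCubes.abs_le (h : BoundedOnGoodCubes k J B ρ g) (hg : MemHk0 k g)
    (hD : normHk k g ≤ D) (hJ : D ^ 2 ≤ goodEnergy k ρ J) {x : Fin d → ℝ} (hx : x ∈ unitCube d) :
    |g x| ≤ B * (ρ * dyadicSide J ^ (-((d : ℝ) / 2))) := by
  obtain ⟨z, rfl, hxz⟩ := exists_mem_dyadicBox hx J
  exact h z le_rfl ((cubeEnergy_le_sq hg hD z).trans hJ) x hxz

lemma one_le_critExp (hd : 0 < d) : 1 ≤ critExp k d := by
  rw [critExp, one_le_div (by exact_mod_cast hd)]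
  linarith [k.cast_nonneg (α := ℝ), d.cast_nonneg (α := ℝ)]

lemma critExp_pos (hd : 0 < d) : 0 < critExp k d :=
  one_pos.trans_le (one_le_critExp hd)

lemma BoundedOnGoodCubes.lintegral_dyadicBox_le (h : BoundedOnGoodCubes k J B ρ g) (hd : 0 < d)
    (hB : 0 ≤ B) (hρ : 0 < ρ) {z : DyadicIndex d} (hz : z.1 ≤ J)
    (hgood : cubeEnergy k g z ≤ goodEnergy k ρ z.1) :
    ∫⁻ x in dyadicBox z, ‖g x‖ₑ ^ critExp k d
      ≤ ENNReal.ofReal (B ^ critExp k d * ρ ^ (critExp k d - 2) * goodEnergy k ρ z.1) := by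
  have hside := dyadicSide_pos z.1
  have hexp : -((d : ℝ) / 2) * critExp k d + d = -(k * 2 : ℕ) := by
    have : (0 : ℝ) < d := by exact_mod_cast hd
    rw [critExp]
    push_cast
    field_simp
    ring
  have hgoodEnergy : goodEnergy k ρ z.1
      = ρ ^ (2 : ℝ) * (dyadicSide z.1 ^ (-((d : ℝ) / 2) * critExp k d) * dyadicSide z.1 ^ d) := by
    rw [← Real.rpow_natCast _ d, ← Real.rpow_add hside, hexp, dyadicSide_rpow_neg,
      Real.rpow_natCast, goodEnergy_eq_sq, mul_pow, pow_mul, Real.rpow_two]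
  refine (lintegral_dyadicBox_rpow_le (by positivity) (critExp_pos hd).le
    (h z hz hgood)).trans_eq ?_
  rw [Real.mul_rpow hB (by positivity), Real.mul_rpow hρ.le (by positivity),
    ← Real.rpow_mul hside.le, hgoodEnergy, Real.rpow_sub hρ]
  congr 1
  field_simp

/-- The factor lost in the stopping time argument over the `2 ^ d` children of a dyadic cube. -/
def treeConst (k d : ℕ) : ℝ := 1 + 2 * (2 ^ d * 4 ^ k)

lemma one_le_treeConst (k d : ℕ) : 1 ≤ treeConst k d :=
  le_add_of_nonneg_right (by positivity)

lemma two_rpow_le_treeConst (k d : ℕ) : (2 : ℝ) ^ ((d : ℝ) / 2) ≤ treeConst k d := by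
  have hd : (2 : ℝ) ^ ((d : ℝ) / 2) ≤ 2 ^ d := by
    rw [← Real.rpow_natCast]
    exact Real.rpow_le_rpow_of_exponent_le one_le_two (half_le_self d.cast_nonneg)
  have hk : (2 : ℝ) ^ d ≤ 2 ^ d * 4 ^ k :=
    le_mul_of_one_le_right (by positivity) (one_le_pow₀ (by norm_num))
  rw [treeConst]
  linarith [pow_pos (zero_lt_two' ℝ) d]

lemma BoundedOnGoodCubes.lintegral_le (h : BoundedOnGoodCubes k J B ρ g) (hd : 0 < d)
    (hk : k ≠ 0) (hB : 0 ≤ B) (hρ : 0 < ρ) (hρD : ρ ≤ D) (hg : MemHk0 k g)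
    (hD : normHk k g ≤ D) (hJ : D ^ 2 ≤ goodEnergy k ρ J) :
    ∫⁻ x, ‖g x‖ₑ ^ critExp k d ∂torusMeasure d ≤ ENNReal.ofReal
      (treeConst k d * B ^ critExp k d * (ρ ^ critExp k d * (D / ρ) ^ 2)) := by
  set p := critExp k d
  set I : DyadicIndex d → ℝ≥0∞ := fun z => ∫⁻ x in dyadicBox z, ‖g x‖ₑ ^ p
  have hside := dyadicSide_pos J
  have hI : ∀ z, I z ≠ ⊤ := fun z => ne_top_of_le_ne_top ENNReal.ofReal_ne_top <|
    lintegral_dyadicBox_rpow_le (by positivity) (critExp_pos hd).le fun x hx =>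
      h.abs_le hg hD hJ (dyadicBox_subset z hx)
  have htree : (I (dyadicRoot d)).toReal ≤ (B ^ p * ρ ^ (p - 2) +
      2 * (Fintype.card (Fin d → Fin 2) * (B ^ p * ρ ^ (p - 2) * 4 ^ k))) *
        max (cubeEnergy k g (dyadicRoot d)) (goodEnergy k ρ 0) :=
    tree_bound dyadicChild Sigma.fst (fun _ _ => rfl) (T := fun z => (I z).toReal)
      (E := cubeEnergy k g) (X := goodEnergy k ρ) (J := J)
      ((by norm_num : (2 : ℝ) ≤ 4).trans (le_self_pow₀ (by norm_num) hk)) (by positivity)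
      (fun j => by unfold goodEnergy; positivity) (fun j => by unfold goodEnergy; ring)
      (fun z => ENNReal.toReal_nonneg) (fun z => (sum_cubeEnergy_dyadicChild hg z).le)
      (fun z => by
        rw [← ENNReal.toReal_sum fun b _ => hI _]
        exact (congrArg ENNReal.toReal (lintegral_dyadicBox z _)).le)
      (fun z hz hgood => ENNReal.toReal_le_of_le_ofReal (by unfold goodEnergy; positivity)
        (h.lintegral_dyadicBox_le hd hB hρ hz hgood))
      (fun z _ => (cubeEnergy_le_sq hg hD z).trans hJ) _ (Nat.zero_le J)
  have hmax : max (cubeEnergy k g (dyadicRoot d)) (goodEnergy k ρ 0) ≤ D ^ 2 :=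
    max_le (cubeEnergy_le_sq hg hD _) (by
      rw [goodEnergy, pow_zero, mul_one]
      gcongr)
  rw [torusMeasure, ← dyadicBox_dyadicRoot]
  change I (dyadicRoot d) ≤ _
  rw [← ENNReal.ofReal_toReal (hI (dyadicRoot d))]
  refine ENNReal.ofReal_le_ofReal
    ((htree.trans (mul_le_mul_of_nonneg_left hmax (by positivity))).trans_eq ?_)
  rw [Fintype.card_fun, Fintype.card_fin, Fintype.card_fin, treeConst, Real.rpow_sub hρ,
    Real.rpow_two]
  push_cast
  field_simp

lemma one_sub_two_mul_vartheta_of_le (hd : 0 < d) {q : ℝ≥0∞}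
    (hq : q ≤ ENNReal.ofReal (critExp k d)) : 1 - 2 * vartheta k d q = 2 / critExp k d := by
  have : (0 : ℝ) < d := by exact_mod_cast hd
  rw [vartheta, if_pos (by rwa [critExp] at hq), critExp]
  field_simp
  ring

lemma one_sub_two_mul_vartheta_of_lt (hk : k ≠ 0) {q : ℝ≥0∞}
    (hq : ENNReal.ofReal (critExp k d) < q) :
    1 - 2 * vartheta k d q = d / (2 * k) * (1 - 2 * q⁻¹.toReal) := by
  rw [vartheta, if_neg (by rwa [critExp, ← not_le] at hq)]
  field_simp
  ring

lemma lintegral_enorm_rpow_le_of_ae_le {α : Type*} [MeasurableSpace α] {μ : Measure α}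
    {f : α → ℝ} {M : ℝ≥0∞} (hM : M ≠ ⊤) (hf : ∀ᵐ x ∂μ, ‖f x‖ₑ ≤ M) {p s : ℝ} (hp : 0 ≤ p)
    (hps : p ≤ s) : ∫⁻ x, ‖f x‖ₑ ^ s ∂μ ≤ M ^ (s - p) * ∫⁻ x, ‖f x‖ₑ ^ p ∂μ := by
  have hsub : 0 ≤ s - p := sub_nonneg.2 hps
  rw [← lintegral_const_mul' _ _ (ENNReal.rpow_ne_top_of_nonneg hsub hM)]
  refine lintegral_mono_ae (hf.mono fun x hx => ?_)
  calc ‖f x‖ₑ ^ s = ‖f x‖ₑ ^ (s - p) * ‖f x‖ₑ ^ p := by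
        rw [← ENNReal.rpow_add_of_nonneg _ _ hsub hp, sub_add_cancel]
    _ ≤ M ^ (s - p) * ‖f x‖ₑ ^ p := by gcongr

section Lq

variable {a R : ℝ} {q : ℝ≥0∞}

lemma eLpNorm_le_of_le_critExp (hd : 0 < d) (ha : 0 ≤ a) (hR : 0 ≤ R)
    (hg : AEStronglyMeasurable g (torusMeasure d))
    (hint : ∫⁻ x, ‖g x‖ₑ ^ critExp k d ∂torusMeasure d
      ≤ ENNReal.ofReal (a ^ critExp k d * R ^ 2))
    (hq : q ≤ ENNReal.ofReal (critExp k d)) :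
    eLpNorm g q (torusMeasure d) ≤ ENNReal.ofReal (a * R ^ (1 - 2 * vartheta k d q)) := by
  have hp := critExp_pos (k := k) hd
  refine (eLpNorm_le_eLpNorm_of_exponent_le hq hg).trans ?_
  rw [eLpNorm_eq_lintegral_rpow_enorm_toReal (by simpa using hp) ENNReal.ofReal_ne_top,
    ENNReal.toReal_ofReal hp.le]
  refine (ENNReal.rpow_le_rpow hint (by positivity)).trans_eq ?_
  rw [ENNReal.ofReal_rpow_of_nonneg (by positivity) (by positivity),
    one_sub_two_mul_vartheta_of_le hd hq, Real.mul_rpow (by positivity) (by positivity),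
    ← Real.rpow_mul ha, ← Real.rpow_two, ← Real.rpow_mul hR, mul_one_div_cancel hp.ne',
    Real.rpow_one, mul_one_div]

lemma eLpNorm_le_of_critExp_lt (hd : 0 < d) (hk : k ≠ 0) (ha : 0 < a) (hR : 0 < R)
    (hsup : ∀ x ∈ unitCube d, |g x| ≤ a * R ^ ((d : ℝ) / (2 * k)))
    (hint : ∫⁻ x, ‖g x‖ₑ ^ critExp k d ∂torusMeasure d
      ≤ ENNReal.ofReal (a ^ critExp k d * R ^ 2))
    (hq : ENNReal.ofReal (critExp k d) < q) (hq_top : q ≠ ⊤) :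
    eLpNorm g q (torusMeasure d) ≤ ENNReal.ofReal (a * R ^ (1 - 2 * vartheta k d q)) := by
  have hp := critExp_pos (k := k) hd
  have hps : critExp k d < q.toReal := (ENNReal.ofReal_lt_iff_lt_toReal hp.le hq_top).1 hq
  have hs : 0 < q.toReal := hp.trans hps
  have hae : ∀ᵐ x ∂torusMeasure d, ‖g x‖ₑ ≤ ENNReal.ofReal (a * R ^ ((d : ℝ) / (2 * k))) :=
    (ae_mem_unitCube d).mono fun x hx => by
      rw [Real.enorm_eq_ofReal_abs]
      exact ENNReal.ofReal_le_ofReal (hsup x hx)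
  have hexp : (d : ℝ) / (2 * k) * (q.toReal - critExp k d) + 2
      = (1 - 2 * vartheta k d q) * q.toReal := by
    have : (0 : ℝ) < d := by exact_mod_cast hd
    rw [one_sub_two_mul_vartheta_of_lt hk hq, ENNReal.toReal_inv, critExp]
    field_simp
    ring
  rw [eLpNorm_eq_lintegral_rpow_enorm_toReal (pos_of_gt hq).ne' hq_top, one_div,
    ENNReal.rpow_inv_le_iff hs]
  calc ∫⁻ x, ‖g x‖ₑ ^ q.toReal ∂torusMeasure d
      ≤ ENNReal.ofReal (a * R ^ ((d : ℝ) / (2 * k))) ^ (q.toReal - critExp k d) *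
          ENNReal.ofReal (a ^ critExp k d * R ^ 2) :=
        (lintegral_enorm_rpow_le_of_ae_le ENNReal.ofReal_ne_top hae hp.le hps.le).trans (by gcongr)
    _ = ENNReal.ofReal (a ^ q.toReal * R ^ ((1 - 2 * vartheta k d q) * q.toReal)) := by
        rw [ENNReal.ofReal_rpow_of_pos (by positivity), ← ENNReal.ofReal_mul (by positivity),
          Real.mul_rpow ha.le (by positivity), ← Real.rpow_mul hR.le, ← hexp, Real.rpow_add hR,
          Real.rpow_sub ha, Real.rpow_two]
        congr 1
        field_simp
    _ = _ := by
        rw [ENNReal.ofReal_rpow_of_pos (by positivity), Real.mul_rpow ha.le (by positivity),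
          Real.rpow_mul hR.le]

lemma eLpNorm_le_of_sup_of_lintegral (hd : 0 < d) (hk : k ≠ 0) (ha : 0 < a) (hR : 0 < R)
    (hg : AEStronglyMeasurable g (torusMeasure d))
    (hsup : ∀ x ∈ unitCube d, |g x| ≤ a * R ^ ((d : ℝ) / (2 * k)))
    (hint : ∫⁻ x, ‖g x‖ₑ ^ critExp k d ∂torusMeasure d
      ≤ ENNReal.ofReal (a ^ critExp k d * R ^ 2)) (q : ℝ≥0∞) :
    eLpNorm g q (torusMeasure d) ≤ ENNReal.ofReal (a * R ^ (1 - 2 * vartheta k d q)) := by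
  rcases le_or_gt q (ENNReal.ofReal (critExp k d)) with hq | hq
  · exact eLpNorm_le_of_le_critExp hd ha.le hR.le hg hint hq
  rcases eq_or_ne q ⊤ with rfl | hq_top
  · rw [one_sub_two_mul_vartheta_of_lt hk hq, ENNReal.inv_top, ENNReal.toReal_zero, mul_zero,
      sub_zero, mul_one, eLpNorm_exponent_top]
    exact eLpNormEssSup_le_of_ae_bound ((ae_mem_unitCube d).mono hsup)
  · exact eLpNorm_le_of_critExp_lt hd hk ha hR hsup hint hq hq_top

end Lq

theorem IsNormal.exists_eLpNorm_le (hd : 0 < d) (hk : (d : ℝ) / 2 < k) {𝓑 : Set (Cube d)}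
    (h𝓑 : IsNormal 𝓑) :
    ∃ C > 0, ∃ K > 0, ∀ {m : ℕ} {g : (Fin d → ℝ) → ℝ} {ρ D : ℝ}, MemHk0 k g → 0 < ρ → ρ ≤ D →
      mrNorm 𝓑 (sample m g) ≤ ρ * (m : ℝ) ^ ((d : ℝ) / 2) → normHk k g ≤ D →
      K * (D / ρ) ^ (1 / k : ℝ) ≤ m → ∀ q : ℝ≥0∞,
      eLpNorm g q (torusMeasure d)
        ≤ ENNReal.ofReal (C * ρ * (D / ρ) ^ (1 - 2 * vartheta k d q)) := by
  obtain ⟨C, hC, K, hK, hlocal⟩ := h𝓑.exists_local_estimate hd hk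
  have hk_pos : (0 : ℝ) < k := lt_of_le_of_lt (by positivity) hk
  have hk_ne : k ≠ 0 := by exact_mod_cast hk_pos.ne'
  have hconst : 2 ^ ((d : ℝ) / 2) ≤ treeConst k d := two_rpow_le_treeConst k d
  have hconst_pos : 0 < treeConst k d := lt_of_lt_of_le (by positivity) hconst
  have hconst_rpow : treeConst k d ≤ treeConst k d ^ critExp k d :=
    Real.self_le_rpow_of_one_le (one_le_treeConst k d) (one_le_critExp hd)
  refine ⟨treeConst k d * (2 * C), by positivity, 2 * K, by positivity, ?_⟩
  intro m g ρ D hg hρ hρD hmr hD hm q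
  have hD_pos : 0 < D := hρ.trans_le hρD
  obtain ⟨J, hJ, hDJ⟩ := exists_generation hk_ne hρ hρD
  have hscale : ∀ j ≤ J, K ≤ m * dyadicSide j := fun j hj => by
    rw [dyadicSide, ← div_eq_mul_inv, le_div_iff₀ (by positivity)]
    calc K * 2 ^ j ≤ K * (2 * (D / ρ) ^ (1 / k : ℝ)) := by
          gcongr
          exact (pow_le_pow_right₀ one_le_two hj).trans hJ
      _ ≤ m := by linarith
  have hgood : BoundedOnGoodCubes k J (2 * C) ρ g :=
    boundedOnGoodCubes_of_local_estimate hC.le hρ.le fun z hz =>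
      hlocal hg hρ.le hmr (dyadicSide_pos _) (dyadicCorner_nonneg z) (dyadicCorner_add_le z)
        (hscale _ hz)
  refine eLpNorm_le_of_sup_of_lintegral hd hk_ne (by positivity) (by positivity)
    hg.continuous.aestronglyMeasurable (fun x hx => ?_) ?_ q
  · calc |g x| ≤ 2 * C * (ρ * (2 ^ ((d : ℝ) / 2) * (D / ρ) ^ ((d : ℝ) / (2 * k)))) := by
          refine (hgood.abs_le hg hD hDJ hx).trans ?_
          gcongr
          exact dyadicSide_rpow_neg_le hρ hD_pos.le hJ
      _ ≤ 2 * C * (ρ * (treeConst k d * (D / ρ) ^ ((d : ℝ) / (2 * k)))) := by gcongr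
      _ = _ := by ring
  · refine (hgood.lintegral_le hd hk_ne (by positivity) hρ hρD hg hD hDJ).trans
      (ENNReal.ofReal_le_ofReal ?_)
    rw [Real.mul_rpow (by positivity) hρ.le, Real.mul_rpow hconst_pos.le (by positivity),
      ← mul_assoc]
    gcongr

end Interpolation

/-! ### The multiresolution norm of the noise -/

section Noise

variable {Ω : Type*} [MeasurableSpace Ω] {P : Measure Ω}

lemma measureReal_lt_abs_le [IsFiniteMeasure P] {X : Ω → ℝ} {c : ℝ≥0}
    (hX : HasSubgaussianMGF X c P) {ε : ℝ} (hε : 0 ≤ ε) :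
    P.real {ω | ε < |X ω|} ≤ 2 * Real.exp (-ε ^ 2 / (2 * c)) := by
  have hsubset : {ω | ε < |X ω|} ⊆ {ω | ε ≤ X ω} ∪ {ω | ε ≤ (-X) ω} :=
    fun ω hω => (lt_abs.1 hω).imp le_of_lt (le_of_lt (b := (-X) ω))
  calc P.real {ω | ε < |X ω|} ≤ P.real {ω | ε ≤ X ω} + P.real {ω | ε ≤ (-X) ω} :=
        (measureReal_mono hsubset).trans (measureReal_union_le _ _)
    _ ≤ 2 * Real.exp (-ε ^ 2 / (2 * c)) := by
        linarith [hX.measure_ge_le hε, hX.neg.measure_ge_le hε]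

lemma measureReal_lt_abs_sum_le [IsFiniteMeasure P] {ι : Type*} {ξ : ι → Ω → ℝ} {σ : ℝ≥0}
    (hindep : iIndepFun ξ P) (hsub : ∀ i, HasSubgaussianMGF (ξ i) (σ ^ 2) P) (S : Finset ι)
    {γ : ℝ} (hγ : 0 ≤ γ) :
    P.real {ω | γ * √(S.card : ℝ) < |∑ i ∈ S, ξ i ω|} ≤ 2 * Real.exp (-γ ^ 2 / (2 * σ ^ 2)) := by
  rcases S.eq_empty_or_nonempty with rfl | hS
  · simp only [Finset.card_empty, Nat.cast_zero, Real.sqrt_zero, mul_zero, Finset.sum_empty,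
      abs_zero, lt_self_iff_false, Set.ofPred_false, measureReal_empty]
    positivity
  have hcard : (S.card : ℝ) ≠ 0 := by exact_mod_cast hS.card_ne_zero
  refine (measureReal_lt_abs_le (HasSubgaussianMGF.sum_of_iIndepFun hindep fun i _ => hsub i)
    (by positivity)).trans_eq ?_
  rw [mul_pow, Real.sq_sqrt (Nat.cast_nonneg _), Finset.sum_const, nsmul_eq_mul]
  push_cast
  rw [mul_left_comm, ← neg_mul, mul_comm (-γ ^ 2), mul_div_mul_left _ _ hcard]

theorem measure_lt_mrNorm_le [IsFiniteMeasure P] {d m : ℕ} (𝓑 : Set (Cube d))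
    {ξ : (Fin d → Fin m) → Ω → ℝ} {σ : ℝ≥0} (hindep : iIndepFun ξ P)
    (hsub : ∀ τ, HasSubgaussianMGF (ξ τ) (σ ^ 2) P) {γ : ℝ} (hγ : 0 ≤ γ) :
    P {ω | γ < mrNorm 𝓑 fun τ => ξ τ ω}
      ≤ ENNReal.ofReal (((m : ℝ) + 1) ^ (2 * d) * (2 * Real.exp (-γ ^ 2 / (2 * σ ^ 2)))) := by
  have hsubset : {ω | γ < mrNorm 𝓑 fun τ => ξ τ ω}
      ⊆ ⋃ ab, {ω | γ * √((indexBox ab).card : ℝ) < |∑ τ ∈ indexBox (m := m) ab, ξ τ ω|} := by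
    intro ω hω
    contrapose! hω
    simp only [Set.mem_iUnion, Set.mem_ofPred_eq, not_exists, not_lt] at hω ⊢
    exact mrNorm_le hγ fun B _ => gridIn_eq_indexBox m B ▸ hω (gridBounds m B)
  rw [← ofReal_measureReal]
  refine ENNReal.ofReal_le_ofReal ?_
  calc P.real {ω | γ < mrNorm 𝓑 fun τ => ξ τ ω}
      ≤ ∑ ab, P.real {ω | γ * √((indexBox ab).card : ℝ)
          < |∑ τ ∈ indexBox (m := m) ab, ξ τ ω|} :=
        (measureReal_mono hsubset).trans (measureReal_iUnion_fintype_le _)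
    _ ≤ ∑ _ab : Fin d → Fin (m + 1) × Fin (m + 1), 2 * Real.exp (-γ ^ 2 / (2 * σ ^ 2)) :=
        Finset.sum_le_sum fun ab _ => measureReal_lt_abs_sum_le hindep hsub (indexBox ab) hγ
    _ = _ := by
        rw [Finset.sum_const, Finset.card_univ, nsmul_eq_mul, Fintype.card_fun, Fintype.card_prod,
          Fintype.card_fin, Fintype.card_fin, ← sq, ← pow_mul]
        push_cast
        rfl

lemma exists_eventually_mul_sq_le {A σ r Cγ : ℝ} (hσ : 0 < σ) (hCγ : 0 < Cγ)
    (hr : 1 / 2 ≤ r) (hCγ' : r = 1 / 2 → σ * √A < Cγ) :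
    ∃ A' > A, ∀ᶠ L : ℝ in atTop, A' * L * σ ^ 2 ≤ (Cγ * L ^ r) ^ 2 := by
  rcases hr.eq_or_lt with rfl | hr
  · refine ⟨(Cγ / σ) ^ 2, ?_, (eventually_ge_atTop 0).mono fun L hL => ?_⟩
    · rw [gt_iff_lt, ← Real.sqrt_lt' (by positivity), lt_div_iff₀' hσ]
      exact hCγ' rfl
    · rw [← Real.sqrt_eq_rpow, mul_pow, Real.sq_sqrt hL, div_pow]
      field_simp
      rfl
  · have hpos : 0 < 2 * r - 1 := by linarith
    refine ⟨A + 1, lt_add_one A, ?_⟩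
    filter_upwards [(tendsto_rpow_atTop hpos).eventually_ge_atTop ((A + 1) * σ ^ 2 / Cγ ^ 2),
      eventually_gt_atTop 0] with L hlarge hL
    rw [div_le_iff₀' (by positivity)] at hlarge
    calc (A + 1) * L * σ ^ 2 = (A + 1) * σ ^ 2 * L := by ring
      _ ≤ Cγ ^ 2 * L ^ (2 * r - 1) * L := by gcongr
      _ = (Cγ * L ^ r) ^ 2 := by
          rw [mul_pow, mul_assoc, ← Real.rpow_add_one hL.ne', ← Real.rpow_mul_natCast hL.le]
          push_cast
          ring_nf

lemma succ_pow_mul_exp_le {d m : ℕ} (hm : 0 < m) {A γ σ : ℝ} (hσ : 0 < σ)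
    (hγ : A * Real.log ((m : ℝ) ^ d) * σ ^ 2 ≤ γ ^ 2) :
    ((m : ℝ) + 1) ^ (2 * d) * (2 * Real.exp (-γ ^ 2 / (2 * σ ^ 2)))
      ≤ 2 * 4 ^ d * (m : ℝ) ^ (2 * d - A * d / 2) := by
  have hm_pos : (0 : ℝ) < m := by exact_mod_cast hm
  have hm_one : (1 : ℝ) ≤ m := by exact_mod_cast hm
  have hexp : Real.exp (-γ ^ 2 / (2 * σ ^ 2)) ≤ (m : ℝ) ^ (-(A * d / 2)) := by
    rw [Real.rpow_def_of_pos hm_pos, Real.exp_le_exp, div_le_iff₀ (by positivity)]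
    rw [Real.log_pow] at hγ
    linarith
  calc ((m : ℝ) + 1) ^ (2 * d) * (2 * Real.exp (-γ ^ 2 / (2 * σ ^ 2)))
      ≤ (2 * m) ^ (2 * d) * (2 * (m : ℝ) ^ (-(A * d / 2))) := by
        gcongr
        linarith
    _ = 2 * 4 ^ d * ((m : ℝ) ^ ((2 * d : ℕ) : ℝ) * (m : ℝ) ^ (-(A * d / 2))) := by
        rw [mul_pow, pow_mul 2 2 d, Real.rpow_natCast]
        ring
    _ = 2 * 4 ^ d * (m : ℝ) ^ (2 * d - A * d / 2) := by
        rw [← Real.rpow_add hm_pos, ← sub_eq_add_neg]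
        push_cast
        rfl

lemma ae_eventually_notMem_of_summable {s : ℕ → Set Ω} {u : ℕ → ℝ} (hu : Summable u)
    (hs : ∀ᶠ m in atTop, P (s m) ≤ ENNReal.ofReal (u m)) :
    ∀ᵐ ω ∂P, ∀ᶠ m in atTop, ω ∉ s m := by
  obtain ⟨M, hM⟩ := eventually_atTop.1 hs
  have htail : ∑' m, P (s (m + M)) ≠ ⊤ :=
    ne_top_of_le_ne_top ((summable_nat_add_iff M).2 hu).tsum_ofReal_ne_top
      (ENNReal.tsum_le_tsum fun m => hM (m + M) le_add_self)
  refine (ae_eventually_notMem htail).mono fun ω hω => ?_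
  rwa [← map_add_atTop_eq_nat M, eventually_map]

lemma tendsto_natCast_pow_atTop {d : ℕ} (hd : 0 < d) :
    Tendsto (fun m : ℕ => (m : ℝ) ^ d) atTop atTop :=
  (tendsto_pow_atTop hd.ne').comp tendsto_natCast_atTop_atTop

lemma tendsto_log_natCast_pow_atTop {d : ℕ} (hd : 0 < d) :
    Tendsto (fun m : ℕ => Real.log ((m : ℝ) ^ d)) atTop atTop :=
  Real.tendsto_log_atTop.comp (tendsto_natCast_pow_atTop hd)

theorem ae_eventually_mrNorm_le [IsFiniteMeasure P] {d : ℕ} (hd : 0 < d) (𝓑 : Set (Cube d))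
    {σ : ℝ≥0} (hσ : 0 < σ) {ξ : (m : ℕ) → (Fin d → Fin m) → Ω → ℝ}
    (hindep : ∀ m, iIndepFun (ξ m) P) (hsub : ∀ m τ, HasSubgaussianMGF (ξ m τ) (σ ^ 2) P)
    {r : ℝ} (hr : 1 / 2 ≤ r) {Cγ : ℝ} (hCγ : 0 < Cγ)
    (hCγ' : r = 1 / 2 → (σ : ℝ) * √(4 + 2 / d) < Cγ) :
    ∀ᵐ ω ∂P, ∀ᶠ m : ℕ in atTop,
      mrNorm 𝓑 (fun τ => ξ m τ ω) ≤ Cγ * Real.log ((m : ℝ) ^ d) ^ r := by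
  have hd_pos : (0 : ℝ) < d := by exact_mod_cast hd
  obtain ⟨A, hA, hγ⟩ := exists_eventually_mul_sq_le (by exact_mod_cast hσ) hCγ hr hCγ'
  have hexp : 2 * d - A * d / 2 < -1 := by
    have hAd : (4 + 2 / d) * d < A * d := mul_lt_mul_of_pos_right hA hd_pos
    rw [add_mul, div_mul_cancel₀ _ hd_pos.ne'] at hAd
    linarith
  refine (ae_eventually_notMem_of_summable
    ((Real.summable_nat_rpow.2 hexp).mul_left (2 * 4 ^ d)) ?_).mono fun ω hω =>
      hω.mono fun m => not_lt.1
  have hlog := tendsto_log_natCast_pow_atTop hd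
  filter_upwards [hlog.eventually hγ, hlog.eventually_ge_atTop 0, eventually_gt_atTop 0]
    with m hγm hlogm hm
  exact (measure_lt_mrNorm_le 𝓑 (hindep m) (hsub m) (by positivity)).trans
    (ENNReal.ofReal_le_ofReal (succ_pow_mul_exp_le hm (by exact_mod_cast hσ) hγm))

end Noise

/-! ### The convergence rate -/

section Rate

variable {a M r μ : ℝ}

lemma exists_pos_eventually_le_mul {α : Type*} {l : Filter α} {u v : α → ℝ} (huv : u =O[l] v)
    (hv : ∀ x, 0 ≤ v x) : ∃ M > 0, ∀ᶠ x in l, u x ≤ M * v x := by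
  obtain ⟨M, hM, hbound⟩ := huv.exists_pos
  refine ⟨M, hM, hbound.bound.mono fun x hx => ?_⟩
  rw [Real.norm_of_nonneg (hv x)] at hx
  exact (Real.le_norm_self _).trans hx

/-- The noise level `a (log n) ^ r n ^ (-1/2)`: for `a = 2 C_γ` this is `2 γ_n / √n`, the scale `ρ`
at which the interpolation inequality is applied. -/
def noiseLevel (a r n : ℝ) : ℝ := a * Real.log n ^ r * n ^ (-(1 / 2) : ℝ)

lemma noiseLevel_pos (ha : 0 < a) {n : ℝ} (hn : 1 < n) : 0 < noiseLevel a r n := by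
  have hlog := Real.log_pos hn
  have := one_pos.trans hn
  unfold noiseLevel
  positivity

lemma noiseLevel_mul_rpow (a r : ℝ) {d m : ℕ} (hm : 0 < m) :
    noiseLevel a r ((m : ℝ) ^ d) * (m : ℝ) ^ ((d : ℝ) / 2)
      = a * Real.log ((m : ℝ) ^ d) ^ r := by
  have hm_pos : (0 : ℝ) < m := by exact_mod_cast hm
  rw [noiseLevel, ← Real.rpow_natCast_mul hm_pos.le, mul_assoc, ← Real.rpow_add hm_pos,
    mul_neg, mul_one_div, neg_add_cancel, Real.rpow_zero, mul_one]

lemma div_noiseLevel (M μ : ℝ) {n : ℝ} (hn : 1 < n) :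
    M * n ^ (-μ) / noiseLevel a r n = M / a * (Real.log n ^ (-r) * n ^ (1 / 2 - μ)) := by
  have hlog := Real.log_pos hn
  have hn_pos := one_pos.trans hn
  rw [noiseLevel, Real.rpow_neg hlog.le, show 1 / 2 - μ = -μ - -(1 / 2) by ring,
    Real.rpow_sub hn_pos]
  field_simp

lemma eventually_noiseLevel_le (r : ℝ) (hμ : μ < 1 / 2) (ha : 0 < a) (hM : 0 < M) :
    ∀ᶠ n : ℝ in atTop, noiseLevel a r n ≤ M * n ^ (-μ) := by
  have hlittle := (isLittleO_log_rpow_rpow_atTop r (sub_pos.2 hμ)).bound (div_pos hM ha)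
  filter_upwards [hlittle, eventually_gt_atTop 0] with n hn hn_pos
  rw [Real.norm_of_nonneg (by positivity : 0 ≤ n ^ (1 / 2 - μ))] at hn
  calc noiseLevel a r n ≤ a * (M / a * n ^ (1 / 2 - μ)) * n ^ (-(1 / 2) : ℝ) := by
        rw [noiseLevel]
        gcongr
        exact (Real.le_norm_self _).trans hn
    _ = M * n ^ (-μ) := by
        rw [← mul_assoc, mul_div_cancel₀ _ ha.ne', mul_assoc, ← Real.rpow_add hn_pos]
        ring_nf

lemma div_noiseLevel_le (ha : 0 < a) (hM : 0 < M) (hμ : 0 ≤ μ) (hr : 0 ≤ r) {n : ℝ} (hn : 1 < n)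
    (hlog : 1 ≤ Real.log n) :
    M * n ^ (-μ) / noiseLevel a r n ≤ M / a * n ^ (1 / 2 : ℝ) := by
  have := one_pos.trans hn
  rw [div_noiseLevel M μ hn]
  gcongr
  calc Real.log n ^ (-r) * n ^ (1 / 2 - μ) ≤ 1 * n ^ (1 / 2 : ℝ) := by
        gcongr
        · exact Real.rpow_le_one_of_one_le_of_nonpos hlog (neg_nonpos.2 hr)
        · exact hn.le
        · exact sub_le_self _ hμ
    _ = n ^ (1 / 2 : ℝ) := one_mul _

lemma eventually_resolution_le {k d : ℕ} (hd : 0 < d) (hk : (d : ℝ) / 2 < k) {K : ℝ}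
    (hK : 0 ≤ K) (hμ : 0 ≤ μ) (hr : 0 ≤ r) (ha : 0 < a) (hM : 0 < M) :
    ∀ᶠ m : ℕ in atTop,
      K * (M * ((m : ℝ) ^ d) ^ (-μ) / noiseLevel a r ((m : ℝ) ^ d)) ^ (1 / k : ℝ) ≤ m := by
  have hk_pos : (0 : ℝ) < k := lt_of_le_of_lt (by positivity) hk
  have hgap : 0 < 1 - (d : ℝ) / (2 * k) := by
    rw [sub_pos, div_lt_one (by positivity)]
    linarith
  have hn_atTop := tendsto_natCast_pow_atTop hd
  filter_upwards [eventually_gt_atTop 0, hn_atTop.eventually_gt_atTop 1,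
    (tendsto_log_natCast_pow_atTop hd).eventually_ge_atTop 1,
    ((tendsto_rpow_atTop hgap).comp tendsto_natCast_atTop_atTop).eventually_ge_atTop
      (K * (M / a) ^ (1 / k : ℝ))] with m hm hn hlog hlarge
  have hm_pos : (0 : ℝ) < m := by exact_mod_cast hm
  have hnoise := noiseLevel_pos (r := r) ha hn
  calc K * (M * ((m : ℝ) ^ d) ^ (-μ) / noiseLevel a r ((m : ℝ) ^ d)) ^ (1 / k : ℝ)
      ≤ K * (M / a * ((m : ℝ) ^ d) ^ (1 / 2 : ℝ)) ^ (1 / k : ℝ) := by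
        gcongr
        exact div_noiseLevel_le ha hM hμ hr hn hlog
    _ = K * (M / a) ^ (1 / k : ℝ) * (m : ℝ) ^ ((d : ℝ) / (2 * k)) := by
        rw [Real.mul_rpow (by positivity) (by positivity), ← Real.rpow_natCast_mul hm_pos.le,
          ← Real.rpow_mul hm_pos.le, mul_assoc]
        ring_nf
    _ ≤ (m : ℝ) ^ (1 - (d : ℝ) / (2 * k)) * (m : ℝ) ^ ((d : ℝ) / (2 * k)) := by
        gcongr
        exact hlarge
    _ = m := by rw [← Real.rpow_add hm_pos, sub_add_cancel, Real.rpow_one]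

lemma rate_mul_interpolation_eq (C : ℝ) {n ϑ : ℝ} (hn : 1 < n) (ha : 0 < a) (hM : 0 < M) :
    n ^ (μ * (1 - 2 * ϑ) + ϑ) * Real.log n ^ (-(2 * r * ϑ)) *
      (C * noiseLevel a r n * (M * n ^ (-μ) / noiseLevel a r n) ^ (1 - 2 * ϑ))
      = C * a * (M / a) ^ (1 - 2 * ϑ) := by
  have hn_pos := one_pos.trans hn
  have hL := Real.log_pos hn
  have hlog_cancel : Real.log n ^ (-(2 * r * ϑ)) * Real.log n ^ r *
      Real.log n ^ (-r * (1 - 2 * ϑ)) = 1 := by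
    rw [← Real.rpow_add hL, ← Real.rpow_add hL,
      show -(2 * r * ϑ) + r + -r * (1 - 2 * ϑ) = 0 by ring, Real.rpow_zero]
  have hpow_cancel : n ^ (μ * (1 - 2 * ϑ) + ϑ) * n ^ (-(1 / 2) : ℝ) *
      n ^ ((1 / 2 - μ) * (1 - 2 * ϑ)) = 1 := by
    rw [← Real.rpow_add hn_pos, ← Real.rpow_add hn_pos,
      show μ * (1 - 2 * ϑ) + ϑ + -(1 / 2) + (1 / 2 - μ) * (1 - 2 * ϑ) = 0 by ring, Real.rpow_zero]
  rw [div_noiseLevel M μ hn, Real.mul_rpow (by positivity) (by positivity),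
    Real.mul_rpow (by positivity) (by positivity), ← Real.rpow_mul hL.le,
    ← Real.rpow_mul hn_pos.le, noiseLevel]
  calc _ = (Real.log n ^ (-(2 * r * ϑ)) * Real.log n ^ r * Real.log n ^ (-r * (1 - 2 * ϑ))) *
        (n ^ (μ * (1 - 2 * ϑ) + ϑ) * n ^ (-(1 / 2) : ℝ) * n ^ ((1 / 2 - μ) * (1 - 2 * ϑ))) *
        (C * a * (M / a) ^ (1 - 2 * ϑ)) := by ring
    _ = C * a * (M / a) ^ (1 - 2 * ϑ) := by rw [hlog_cancel, hpow_cancel, one_mul, one_mul]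

lemma sqrt_four_add_two_div_le {k d : ℕ} (hk : 1 ≤ k) :
    √(4 + 2 / d : ℝ) ≤ √(5 + 2 * k / d) := by
  have : (1 : ℝ) ≤ k := by exact_mod_cast hk
  gcongr <;> linarith

end Rate

end

end MIND

theorem mainTheorem2_general {Ω : Type*} [MeasurableSpace Ω] (P : Measure Ω)
    [IsProbabilityMeasure P] (k d : ℕ) (hd : 0 < d) (hk : (d : ℝ) / 2 < k) (q : ℝ≥0∞)
    (𝓑 : Set (MIND.Cube d)) (h𝓑 : MIND.IsNormal 𝓑)
    (f : (Fin d → ℝ) → ℝ) (hf : MIND.MemHk0 k f) (σ : ℝ≥0) (hσ : 0 < σ)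
    (ξ : (m : ℕ) → (Fin d → Fin m) → Ω → ℝ) (hξ_indep : ∀ m, iIndepFun (ξ m) P)
    (hξ_subG : ∀ m τ, HasSubgaussianMGF (ξ m τ) (σ ^ 2) P)
    (r : ℝ) (hr : 1 / 2 ≤ r) (Cγ : ℝ) (hCγ : 0 < Cγ)
    (hCγ' : r = 1 / 2 → (σ : ℝ) * √(4 + 2 / d) < Cγ)
    (μ : ℝ) (hμ0 : 0 ≤ μ) (hμ : μ < 1 / 2)
    (hsource : (fun m : ℕ => MIND.sourceDefect k m 𝓑 f r)
      =O[atTop] fun m : ℕ => ((m : ℝ) ^ d) ^ (-μ))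
    (fhat : ℕ → Ω → (Fin d → ℝ) → ℝ)
    (hfhat : ∀ m, 0 < m → ∀ ω, MIND.IsMIND k 𝓑 (fun τ => MIND.sample m f τ + ξ m τ ω)
      (Cγ * Real.log ((m : ℝ) ^ d) ^ r) (fhat m ω)) :
    ∃ C : ℝ≥0, ∀ᵐ ω ∂P,
      limsup (fun m : ℕ =>
        ENNReal.ofReal
          (((m : ℝ) ^ d) ^ (μ * (1 - 2 * MIND.vartheta k d q) + MIND.vartheta k d q)
            * Real.log ((m : ℝ) ^ d) ^ (-(2 * r * MIND.vartheta k d q)))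
          * eLpNorm (fun x => fhat m ω x - f x) q (MIND.torusMeasure d)) atTop ≤ (C : ℝ≥0∞) := by
  obtain ⟨C, _, K, hK, hinterp⟩ := h𝓑.exists_eLpNorm_le hd hk
  obtain ⟨M, hM, henergy⟩ := MIND.exists_pos_eventually_le_mul
    (hsource.const_mul_left (2 * (1 + √Cγ))) fun m => by positivity
  have ha : 0 < 2 * Cγ := by positivity
  refine ⟨(C * (2 * Cγ) * (M / (2 * Cγ)) ^ (1 - 2 * MIND.vartheta k d q)).toNNReal, ?_⟩
  have hn_atTop := MIND.tendsto_natCast_pow_atTop hd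
  filter_upwards [MIND.ae_eventually_mrNorm_le hd 𝓑 hσ hξ_indep hξ_subG hr hCγ hCγ'] with ω hω
  refine limsup_le_of_le (by isBoundedDefault) ?_
  filter_upwards [hω, henergy, eventually_gt_atTop 0, hn_atTop.eventually_gt_atTop 1,
    hn_atTop.eventually (MIND.eventually_noiseLevel_le r hμ ha hM),
    MIND.eventually_resolution_le hd hk hK.le hμ0 (by linarith : 0 ≤ r) ha hM]
    with m hnoise hdefect hm hn hscale hres
  have hmind := hfhat m hm ω
  have hlog := Real.log_pos hn
  have hf_mr : MIND.mrNorm 𝓑 (MIND.sample m f - fun τ => MIND.sample m f τ + ξ m τ ω)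
      ≤ Cγ * Real.log ((m : ℝ) ^ d) ^ r := by
    rwa [show (MIND.sample m f - fun τ => MIND.sample m f τ + ξ m τ ω) = -fun τ => ξ m τ ω from
      sub_add_cancel_left _ _, MIND.mrNorm_neg]
  have hmr : MIND.mrNorm 𝓑 (MIND.sample m (fhat m ω - f))
      ≤ MIND.noiseLevel (2 * Cγ) r ((m : ℝ) ^ d) * (m : ℝ) ^ ((d : ℝ) / 2) := by
    rw [MIND.noiseLevel_mul_rpow _ _ hm, mul_assoc]
    exact hmind.mrNorm_sample_sub_le hf_mr
  have hD := (hmind.normHk_sub_le_sourceDefect hCγ hlog hf hf_mr).trans hdefect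
  have hLq := hinterp (hmind.1.sub hf) (MIND.noiseLevel_pos ha hn) hscale hmr hD hres q
  refine (mul_le_mul_right hLq _).trans_eq ?_
  rw [← ENNReal.ofReal_mul (by positivity), MIND.rate_mul_interpolation_eq C hn ha hM]
  rfl

theorem mainTheorem2 {Ω : Type*} [MeasurableSpace Ω] (P : Measure Ω) [IsProbabilityMeasure P]
    (k d : ℕ) (hd : 0 < d) (hk : (d : ℝ) / 2 < k)
    (q : ℝ≥0∞) (hq : 1 ≤ q)
    (𝓑 : Set (MIND.Cube d)) (h𝓑 : MIND.IsNormal 𝓑)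
    (f : (Fin d → ℝ) → ℝ) (hf : MIND.MemHk0 k f)
    (σ : ℝ≥0) (hσ : 0 < σ)
    -- for each sample size `n = m ^ d`, the noise is i.i.d. sub-Gaussian with parameter `σ`
    (ξ : (m : ℕ) → (Fin d → Fin m) → Ω → ℝ)
    (hξ_meas : ∀ m τ, Measurable (ξ m τ))
    (hξ_indep : ∀ m, iIndepFun (ξ m) P)
    (hξ_ident : ∀ m τ τ', IdentDistrib (ξ m τ) (ξ m τ') P P)
    (hξ_subG : ∀ m τ, HasSubgaussianMGF (ξ m τ) (σ ^ 2) P)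
    (r : ℝ) (hr : 1 / 2 ≤ r) (Cγ : ℝ) (hCγ : 0 < Cγ)
    (hCγ' : r = 1 / 2 → (σ : ℝ) * Real.sqrt (5 + 2 * k / d) < Cγ)
    (μ : ℝ) (hμ0 : 0 ≤ μ) (hμ : μ < 1 / 2)
    (hsource : (fun m : ℕ => MIND.sourceDefect k m 𝓑 f r)
      =O[atTop] fun m : ℕ => ((m : ℝ) ^ d) ^ (-μ))
    (fhat : ℕ → Ω → (Fin d → ℝ) → ℝ)
    (hfhat : ∀ m, 0 < m → ∀ ω, MIND.IsMIND k 𝓑 (fun τ => MIND.sample m f τ + ξ m τ ω)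
      (Cγ * Real.log ((m : ℝ) ^ d) ^ r) (fhat m ω)) :
    ∃ C : ℝ≥0, ∀ᵐ ω ∂P,
      limsup (fun m : ℕ =>
        ENNReal.ofReal
          (((m : ℝ) ^ d) ^ (μ * (1 - 2 * MIND.vartheta k d q) + MIND.vartheta k d q)
            * Real.log ((m : ℝ) ^ d) ^ (-(2 * r * MIND.vartheta k d q)))
          * eLpNorm (fun x => fhat m ω x - f x) q (MIND.torusMeasure d)) atTop ≤ (C : ℝ≥0∞) := by
  have hk_pos : 0 < k := Nat.cast_pos.1 ((by positivity : (0 : ℝ) ≤ d / 2).trans_lt hk)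
  exact mainTheorem2_general P k d hd hk q 𝓑 h𝓑 f hf σ hσ ξ hξ_indep hξ_subG r hr Cγ hCγ
    (fun h => (mul_le_mul_of_nonneg_left (MIND.sqrt_four_add_two_div_le hk_pos) σ.2).trans_lt
      (hCγ' h)) μ hμ0 hμ hsource fhat hfhat
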